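/- Let $\lambda\in(0,1)$, $c_\lambda>0$, $T>0$, let $f:\mathbb R\to\mathbb R$ be Lipschitz continuous, and for $w\in L^1(\mathbb R)\cap BV(\mathbb R)$ (and for bounded step functions) let $$g[w](x)=c_\lambda\int_{|z|>0}\frac{w(x+z)-w(x)}{|z|^{1+\lambda}}\,dz ,\qquad d_\lambda=c_\lambda\Big(\int_{|z|<1}\frac{dz}{|z|^{\lambda}}+\int_{|z|>1}\frac{dz}{|z|^{1+\lambda}}\Big)$$ (for a suitable $c_\lambda$, $g=-(-\partial_x^2)^{\lambda/2}$). Consider $\partial_tu+\partial_xf(u)=g[u]$ on $Q_T=\mathbb R\times(0,T)$ with $u(\cdot,0)=u_0$. A BV entropy solution is a function $u\in L^\infty(Q_T)\cap C([0,T];L^1(\mathbb R))\cap L^\infty(0,T;BV(\mathbb R))$ such that, for all $k\in\mathbb R$ and all nonnegative $\varphi\in C_c^\infty(\overline{Q_T})$, $$\int_{Q_T}\Big(|u-k|\,\varphi_t+\operatorname{sgn}(u-k)(f(u)-f(k))\,\varphi_x+\operatorname{sgn}(u-k)\,g[u]\,\varphi\Big)dx\,dt+\int_{\mathbb R}|u_0-k|\,\varphi(x,0)\,dx-\int_{\mathbb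 R}|u(x,T)-k|\,\varphi(x,T)\,dx\ge 0 .$$ Let $F:\mathbb R\times\mathbb R\to\mathbb R$ be a numerical flux with $F(a,a)=f(a)$, nondecreasing in the first and nonincreasing in the second variable, and Lipschitz continuous with constants $F_1$, $F_2$ in its first and second variable, where $F_1+F_2>0$. For $\Delta x,\Delta t>0$ and $N\in\mathbb N$ with $N\Delta t=T$, put $x_i=i\Delta x$, $I_i=(x_i,x_{i+1})$, $t_n=n\Delta t$. For $V=(V_i)_{i\in\mathbb Z}$ let $\bar V$ be the step function equal to $V_i$ on $[x_i,x_{i+1})$, and let $g\langle V\rangle_i=\frac1{\Delta x}\int_{I_i}g[\bar V]\,dx$ and $D_-F(V_i,V_{i+1})=\frac{1}{\Delta x}\big(F(V_i,V_{i+1})-F(V_{i-1},V_i)\big)$. With $U_i^0=\frac1{\Delta x}\int_{I_i}u_0\,dx$, for $0\le n<N$ the implicit-explicit method is $$U_i^{n+1}=U_i^n-\Delta t\,D_-F(U_i^n,U_{i+1}^n)+\Delta t\,g\langle U^{n+1}\rangle_i\qquad(\text{with each }U^n\text{ a bounded sequence}),$$ and the fully explicit method is $$U_i^{n+1}=U_i^n-\Delta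 t\,D_-F(U_i^n,U_{i+1}^n)+\Delta t\,g\langle U^{n}\rangle_i .$$ Let $\tilde u(x,t)=U_i^n$ for $(x,t)\in[x_i,x_{i+1})\times[t_n,t_{n+1})$, $0\le n\le N$. Let $u_0\in L^1(\mathbb R)\cap BV(\mathbb R)$ and let $u$ be a BV entropy solution. (a) There is a constant $c_T>0$, independent of $\Delta x$ and $\Delta t$, such that whenever $(F_1+F_2)\frac{\Delta t}{\Delta x}\le1$ and $\tilde u$ comes from the implicit-explicit method, $$\|u(\cdot,T)-\tilde u(\cdot,T)\|_{L^1(\mathbb R)}\le c_T\sqrt{\Delta x}.$$ (b) There is a constant $c_T>0$, independent of $\Delta x$ and $\Delta t$, such that whenever $(F_1+F_2)\frac{\Delta t}{\Delta x}+d_\lambda\frac{\Delta t}{\Delta x^{\lambda}}\le1$ and $\tilde u$ comes from the fully explicit method, $$\|u(\cdot,T)-\tilde u(\cdot,T)\|_{L^1(\mathbb R)}\le c_T\big(\sqrt{\Delta x}+\Delta x^{1-\lambda}\big).$$ -/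

import Mathlib

open MeasureTheory Set Filter Topology

noncomputable section

namespace FractalCL

/-- The nonlocal operator `g[w](x) = c ∫_{|z|>0} (w(x+z) - w(x)) / |z|^(1+lam) dz`. For the
appropriate normalising constant `c > 0` it is the fractional Laplacian `-(-∂ₓ²)^(lam/2)`. -/
def fracLap (c lam : ℝ) (w : ℝ → ℝ) (x : ℝ) : ℝ :=
  c * ∫ z in {z : ℝ | 0 < |z|}, (w (x + z) - w x) / |z| ^ (1 + lam)

/-- The constant `d = c (∫_{|z|<1} |z|^(-lam) dz + ∫_{|z|>1} |z|^(-1-lam) dz)`. -/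
def dConst (c lam : ℝ) : ℝ :=
  c * ((∫ z in {z : ℝ | |z| < 1}, 1 / |z| ^ lam) + ∫ z in {z : ℝ | 1 < |z|}, 1 / |z| ^ (1 + lam))

/-- The total variation of a (class modulo null sets of a) function on the line: the infimum of the
pointwise variations of its almost everywhere representatives. -/
def essVariation (w : ℝ → ℝ) : ENNReal :=
  ⨅ (v : ℝ → ℝ) (_ : v =ᵐ[volume] w), eVariationOn v univ

/-- Membership in `L¹(ℝ) ∩ BV(ℝ)`. -/
def MemL1BV (w : ℝ → ℝ) : Prop :=
  Integrable w volume ∧ essVariation w < ⊤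

/-- The open strip `ℝ × (0,T)`, points written `(x, t)`. -/
def strip (T : ℝ) : Set (ℝ × ℝ) := univ ×ˢ Ioo 0 T

/-- The entropy `|v - k|`. -/
def entropy (k v : ℝ) : ℝ := |v - k|

/-- The derivative `sgn(v - k)` of the entropy, with `sgn 0 = 0`. -/
def entropyDeriv (k v : ℝ) : ℝ := Real.sign (v - k)

/-- The entropy flux `sgn(v - k) (f(v) - f(k))`. -/
def entropyFlux (f : ℝ → ℝ) (k v : ℝ) : ℝ := entropyDeriv k v * (f v - f k)

/-- Nonnegative smooth test functions with compact support in the closed strip `ℝ × [0,T]`: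
restrictions of smooth compactly supported functions on the plane. -/
structure IsTestFunction (T : ℝ) (φ : ℝ → ℝ → ℝ) : Prop where
  smooth : ContDiff ℝ (⊤ : ℕ∞) (fun p : ℝ × ℝ => φ p.1 p.2)
  compact : HasCompactSupport (fun p : ℝ × ℝ => φ p.1 p.2)
  nonneg : ∀ x, ∀ t ∈ Icc 0 T, 0 ≤ φ x t

/-- `u = u(x,t)` is a BV entropy solution on `ℝ × (0,T)` of
`∂ₜ u + ∂ₓ f(u) = g[u]`, `u(x,0) = u₀(x)`. -/
structure IsBVEntropySolution (c lam T : ℝ) (f u₀ : ℝ → ℝ) (u : ℝ → ℝ → ℝ) : Prop where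
  /-- `u ∈ L^∞(ℝ × (0,T))` -/
  memLinfty : MemLp (fun p : ℝ × ℝ => u p.1 p.2) ⊤ (volume.restrict (strip T))
  /-- `u(·,t) ∈ L¹(ℝ)` for every `t ∈ [0,T]` -/
  memL1 : ∀ t ∈ Icc 0 T, Integrable (fun x => u x t) volume
  /-- `t ↦ u(·,t) ∈ L¹(ℝ)` is continuous on `[0,T]` -/
  continuousL1 : ∀ t ∈ Icc 0 T,
    Tendsto (fun s => eLpNorm (fun x => u x s - u x t) 1 volume) (𝓝[Icc 0 T] t) (𝓝 0)
  /-- `u ∈ L^∞(0,T; BV(ℝ))` -/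
  boundedBV : ∃ C : NNReal, ∀ᵐ t ∂(volume.restrict (Ioo 0 T)), essVariation (fun x => u x t) ≤ C
  /-- the entropy inequality -/
  entropyIneq : ∀ k : ℝ, ∀ φ : ℝ → ℝ → ℝ, IsTestFunction T φ →
    0 ≤ (∫ p in strip T,
          (entropy k (u p.1 p.2) * deriv (fun t => φ p.1 t) p.2
            + entropyFlux f k (u p.1 p.2) * deriv (fun x => φ x p.2) p.1
            + entropyDeriv k (u p.1 p.2) * fracLap c lam (fun x => u x p.2) p.1 * φ p.1 p.2))
        + (∫ x, entropy k (u₀ x) * φ x 0)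
        - ∫ x, entropy k (u x T) * φ x T

/-- `F` is a monotone numerical flux consistent with `f`, and `F₁`, `F₂` are Lipschitz constants of
`F` in its first and second variable (so that `F` is Lipschitz on `ℝ × ℝ`). -/
structure IsNumericalFlux (f : ℝ → ℝ) (F : ℝ → ℝ → ℝ) (F₁ F₂ : NNReal) : Prop where
  lipschitz_fst : ∀ b, LipschitzWith F₁ (fun a => F a b)
  lipschitz_snd : ∀ a, LipschitzWith F₂ (fun b => F a b)
  consistent : ∀ a, F a a = f a
  mono_fst : ∀ b, Monotone (fun a => F a b)
  anti_snd : ∀ a, Antitone (fun b => F a b)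

/-- The step function with value `V i` on `[i Δx, (i+1) Δx)`. -/
def stepFun (Δx : ℝ) (V : ℤ → ℝ) (x : ℝ) : ℝ := V ⌊x / Δx⌋

/-- The average of `w` over the cell `(i Δx, (i+1) Δx)`. -/
def cellAverage (Δx : ℝ) (w : ℝ → ℝ) (i : ℤ) : ℝ :=
  (1 / Δx) * ∫ x in Ioo ((i : ℝ) * Δx) (((i : ℝ) + 1) * Δx), w x

/-- The discrete nonlocal operator: the cell averages of `g` applied to the step function. -/
def discFracLap (c lam Δx : ℝ) (V : ℤ → ℝ) (i : ℤ) : ℝ :=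
  cellAverage Δx (fracLap c lam (stepFun Δx V)) i

/-- The backward difference of the numerical fluxes at cell `i`. -/
def fluxDiff (F : ℝ → ℝ → ℝ) (Δx : ℝ) (V : ℤ → ℝ) (i : ℤ) : ℝ :=
  (1 / Δx) * (F (V i) (V (i + 1)) - F (V (i - 1)) (V i))

/-- The grid values `U n i`, `n ≤ N`, are the solution of the implicit-explicit method. Solutions of
the implicit linear systems are taken among bounded sequences, where they are unique. -/
structure IsImplicitExplicitSolution (c lam : ℝ) (F : ℝ → ℝ → ℝ) (u₀ : ℝ → ℝ) (Δx Δt : ℝ) (N : ℕ)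
    (U : ℕ → ℤ → ℝ) : Prop where
  bounded : ∀ n ≤ N, ∃ C : ℝ, ∀ i, |U n i| ≤ C
  init : ∀ i, U 0 i = cellAverage Δx u₀ i
  step : ∀ n < N, ∀ i,
    U (n + 1) i = U n i - Δt * fluxDiff F Δx (U n) i + Δt * discFracLap c lam Δx (U (n + 1)) i

/-- The grid values `U n i`, `n ≤ N`, are the solution of the fully explicit method. -/
structure IsExplicitSolution (c lam : ℝ) (F : ℝ → ℝ → ℝ) (u₀ : ℝ → ℝ) (Δx Δt : ℝ) (N : ℕ)
    (U : ℕ → ℤ → ℝ) : Prop where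
  init : ∀ i, U 0 i = cellAverage Δx u₀ i
  step : ∀ n < N, ∀ i,
    U (n + 1) i = U n i - Δt * fluxDiff F Δx (U n) i + Δt * discFracLap c lam Δx (U n) i

/-- The numerical solution: `ũ(x,t) = U n i` for `x ∈ [i Δx, (i+1) Δx)`, `t ∈ [n Δt, (n+1) Δt)`. -/
def interpolant (Δx Δt : ℝ) (U : ℕ → ℤ → ℝ) (x t : ℝ) : ℝ := stepFun Δx (U ⌊t / Δt⌋₊) x

end FractalCL

end

/-!
The proof is Kuznetsov's comparison argument, with doubling of the space variable only.

For a mollifier `ω` of width `h`, the functional `smoothDist ω w v = ∬ |w(x) - v(y)| ω(x - y) dx dy`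
differs from `‖w - v‖` in `L¹` by at most `h` times the variation of `v` (`abs_smoothDist_sub_le`).
Let `smoothProd ω c lam f w v` be the rate at which the entropy inequality for `w` allows this
functional to grow while `v` is frozen. It consists of the Kružkov flux tested with `ω'` and of the
nonlocal term of `w` tested with `sgn(w(x) - v(y))`, and it is bounded independently of `h`
(`abs_smoothProd_le`).

*The solution.* Choosing `k = v(y)` and the test function `ω(x - y) η(t)` in the entropy inequality
and integrating over `y` gives, for every frozen `v` of bounded variation and every smooth weight
`η ≥ 0`, an inequality for `t ↦ smoothDist ω u(t) v` (`entropy_averaged`).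

*The scheme.* Monotonicity of the flux and the CFL condition make the convective update an `ℓ¹`
contraction and give a discrete entropy inequality. The discrete nonlocal operator is a sum of
differences with nonnegative weights of total mass at most `d_λ Δx^(-λ)`
(`hasSum_discFracLap`, `tsum_weight_le`), so that the implicit step is an `ℓ¹` contraction as well,
and so is the explicit one under its CFL condition. Hence both schemes obey `L¹`, `BV` and time
continuity bounds (`HasSchemeBounds`); the explicit scheme is the implicit-explicit one up to a
residual of size `Δx^(-λ) Δt = O(Δx^(1-λ))`. With `w` frozen, one time step changes `smoothDist` by
at most `-Δt · smoothProd + Δt · O(Δx / h + residual)` (`smoothDist_step_le`). Here the nonlocal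
terms of `w` and of the numerical solution are compared by Kato's inequality, and the error of
replacing the nonlocal term by its cell averages is of order `Δx / h` because the mollified sign is
Lipschitz in `y` with constant `O(1 / h)`.

*Combination.* The production terms cancel if the two evolutions are synchronized. To avoid any
time regularity of `u`, the distance at step `n` is averaged over `t` in the window
`[nΔt - h, nΔt]`; the averaged entropy inequality with a difference of two smooth steps as the
weight `η` moves the window forward by `Δt` (`final_le_of_averaged_of_step`). The initial and final
layers cost `O(h + Δt)`. All errors together are `O(h + Δx / h + Δt / h + residual)`, and
`h = √Δx` gives the rates. For `√Δx > min 1 T` the a priori `L¹` bounds suffice.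
-/

namespace FractalCL

/-! ### The nonlocal operator on functions of bounded variation -/

/-- The singular kernel `|z|^(-1-lam)` of the nonlocal operator (with value `0` at `z = 0`). -/
noncomputable def singKer (lam z : ℝ) : ℝ := 1 / |z| ^ (1 + lam)

lemma singKer_nonneg (lam z : ℝ) : 0 ≤ singKer lam z := by unfold singKer; positivity

lemma measurable_singKer (lam : ℝ) : Measurable (singKer lam) := by
  unfold singKer; fun_prop

/-- The set `{z | 0 < |z|}` may be replaced by the whole line. -/
lemma fracLap_eq (c lam : ℝ) (w : ℝ → ℝ) (x : ℝ) :
    fracLap c lam w x = c * ∫ z, (w (x + z) - w x) * singKer lam z := by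
  unfold fracLap
  congr 1
  rw [setIntegral_eq_integral_of_forall_compl_eq_zero]
  · simp [singKer, div_eq_mul_inv]
  · intro z hz
    have : z = 0 := by simpa using hz
    simp [this]

lemma min_mul_singKer_of_lt {lam : ℝ} (hlam : lam ∈ Ioo (0 : ℝ) 1) {z : ℝ} (hz : |z| < 1) :
    min 1 |z| * singKer lam z = 1 / |z| ^ lam := by
  rw [min_eq_right hz.le, singKer]
  rcases eq_or_lt_of_le (abs_nonneg z) with h | h
  · rw [← h, Real.zero_rpow hlam.1.ne']; simp
  · rw [Real.rpow_add h, Real.rpow_one]; field_simp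

/-- Integrability at `0` uses `lam < 1`, integrability at infinity uses `0 < lam`. -/
lemma integrable_min_mul_singKer {lam : ℝ} (hlam : lam ∈ Ioo (0 : ℝ) 1) :
    Integrable (fun z => min 1 |z| * singKer lam z) := by
  have h1 : IntegrableOn (fun z : ℝ => min 1 |z| * singKer lam z) (Ioi 0) := by
    rw [← Ioo_union_Ici_eq_Ioi (zero_lt_one (α := ℝ))]
    refine IntegrableOn.union ?_ ?_
    · have := (intervalIntegral.intervalIntegrable_rpow' (a := 0) (b := 1) (r := -lam)
        (by linarith [hlam.2]))
      rw [intervalIntegrable_iff_integrableOn_Ioo_of_le zero_le_one] at this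
      refine this.congr_fun (fun z hz => ?_) measurableSet_Ioo
      have : |z| < 1 := by rw [abs_of_pos hz.1]; exact hz.2
      simp only
      rw [min_mul_singKer_of_lt hlam this, abs_of_pos hz.1, Real.rpow_neg hz.1.le, one_div]
    · rw [integrableOn_Ici_iff_integrableOn_Ioi]
      have := integrableOn_Ioi_rpow_of_lt (a := -(1 + lam)) (by linarith [hlam.1]) zero_lt_one
      refine this.congr_fun (fun z hz => ?_) measurableSet_Ioi
      have hz : 1 < z := hz
      have h0 : 0 < z := by linarith
      simp only
      rw [abs_of_pos h0, min_eq_left hz.le, singKer, abs_of_pos h0, Real.rpow_neg h0.le]; simp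
  rw [← integrableOn_univ, ← Iic_union_Ioi (a := (0 : ℝ))]
  refine IntegrableOn.union ?_ h1
  rw [← neg_zero, ← integrableOn_Ici_iff_integrableOn_Ioi] at h1
  have := h1.comp_neg_Iic
  simpa [singKer] using this

/-- The constant `d_λ` is `c` times the integral of `min(1,|z|)` against the singular kernel. -/
lemma dConst_eq (c : ℝ) {lam : ℝ} (hlam : lam ∈ Ioo (0 : ℝ) 1) :
    dConst c lam = c * ∫ z, min 1 |z| * singKer lam z := by
  have hi := integrable_min_mul_singKer hlam
  have hm : MeasurableSet {z : ℝ | |z| < 1} := measurableSet_lt (by fun_prop) (by fun_prop)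
  have hm' : MeasurableSet {z : ℝ | 1 < |z|} := measurableSet_lt (by fun_prop) (by fun_prop)
  have e1 : ∫ z in {z : ℝ | |z| < 1}, 1 / |z| ^ lam
      = ∫ z in {z : ℝ | |z| < 1}, min 1 |z| * singKer lam z :=
    setIntegral_congr_fun hm fun z hz => (min_mul_singKer_of_lt hlam hz).symm
  have e2 : ∫ z in {z : ℝ | 1 < |z|}, 1 / |z| ^ (1 + lam)
      = ∫ z in {z : ℝ | |z| < 1}ᶜ, min 1 |z| * singKer lam z := by
    have h2 : {z : ℝ | |z| < 1}ᶜ = {z : ℝ | 1 < |z|} ∪ {1, -1} := by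
      ext z
      simp only [mem_compl_iff, mem_ofPred_eq, not_lt, mem_union, mem_insert_iff,
        mem_singleton_iff]
      rw [le_iff_lt_or_eq, eq_comm, abs_eq zero_le_one]
    have h3 : ({z : ℝ | |z| < 1}ᶜ : Set ℝ) =ᵐ[volume] {z : ℝ | 1 < |z|} := by
      rw [h2]
      exact union_ae_eq_left_of_ae_eq_empty (ae_eq_empty.2 ((Set.toFinite _).measure_zero _))
    rw [setIntegral_congr_set h3]
    refine setIntegral_congr_fun hm' fun z hz => ?_
    have hz : 1 < |z| := hz
    simp [min_eq_left hz.le, singKer]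
  rw [dConst, e1, e2, integral_add_compl hm hi]

lemma dConst_nonneg {c lam : ℝ} (hc : 0 < c) : 0 ≤ dConst c lam := by
  unfold dConst
  have h1 : 0 ≤ ∫ z in {z : ℝ | |z| < 1}, 1 / |z| ^ lam := integral_nonneg fun z => by positivity
  have h2 : 0 ≤ ∫ z in {z : ℝ | 1 < |z|}, 1 / |z| ^ (1 + lam) :=
    integral_nonneg fun z => by positivity
  positivity

/-- `w` is Lipschitz under translations in `L¹` with constant `C`; for integrable `w` this
is the quantitative content of `w` having total variation at most `C`. -/
def TransLip (C : ℝ) (w : ℝ → ℝ) : Prop := ∀ z, ∫ x, |w (x + z) - w x| ≤ C * |z|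

/-- Measurable integrable functions with `L¹` norm at most `M` which are Lipschitz under
translations with constant `C`. -/
structure L1BVWith (C M : ℝ) (w : ℝ → ℝ) : Prop where
  meas : Measurable w
  int : Integrable w
  norm_le : ∫ x, |w x| ≤ M
  trans : TransLip C w

namespace L1BVWith

variable {c lam C M C' M' : ℝ} {w v : ℝ → ℝ}

lemma C_nonneg (h : L1BVWith C M w) : 0 ≤ C := by
  have := (integral_nonneg (fun _ => abs_nonneg _)).trans (h.trans 1)
  simpa using this

lemma M_nonneg (h : L1BVWith C M w) : 0 ≤ M :=
  (integral_nonneg fun _ => abs_nonneg _).trans h.norm_le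

lemma integrable_sub (h : L1BVWith C M w) (z : ℝ) : Integrable (fun x => w (x + z) - w x) :=
  (h.int.comp_add_right z).sub h.int

lemma integral_abs_sub_le (h : L1BVWith C M w) (z : ℝ) :
    ∫ x, |w (x + z) - w x| ≤ (C + 2 * M) * min 1 |z| := by
  have hC := h.C_nonneg
  have hM0 := h.M_nonneg
  rcases le_total 1 |z| with hz | hz
  · rw [min_eq_left hz, mul_one]
    calc ∫ x, |w (x + z) - w x| ≤ ∫ x, (|w (x + z)| + |w x|) := by
          refine integral_mono (h.integrable_sub z).abs
            ((h.int.comp_add_right z).abs.add h.int.abs) fun x => abs_sub _ _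
      _ = (∫ x, |w x|) + ∫ x, |w x| := by
          rw [integral_add (h.int.comp_add_right z).abs h.int.abs,
            integral_add_right_eq_self (fun x => |w x|) z]
      _ ≤ C + 2 * M := by linarith [h.norm_le]
  · rw [min_eq_right hz]
    refine (h.trans z).trans ?_
    gcongr; linarith

lemma measurable_kernel (hw : Measurable w) :
    Measurable (fun p : ℝ × ℝ => (w (p.1 + p.2) - w p.1) * singKer lam p.2) := by
  have := measurable_singKer lam
  fun_prop

lemma integrable_kernel (h : L1BVWith C M w) (hlam : lam ∈ Ioo (0 : ℝ) 1) :
    Integrable (fun p : ℝ × ℝ => (w (p.1 + p.2) - w p.1) * singKer lam p.2)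
      (volume.prod volume) := by
  have hm := measurable_kernel (lam := lam) h.meas
  rw [integrable_prod_iff' hm.aestronglyMeasurable]
  refine ⟨ae_of_all _ fun z => (h.integrable_sub z).mul_const (singKer lam z), ?_⟩
  refine ((integrable_min_mul_singKer hlam).const_mul (C + 2 * M)).mono' ?_
    (ae_of_all _ fun z => ?_)
  · exact (hm.norm.stronglyMeasurable.integral_prod_left (μ := volume)
      (f := fun x z : ℝ => ‖(w (x + z) - w x) * singKer lam z‖)).aestronglyMeasurable
  · rw [Real.norm_of_nonneg (integral_nonneg fun _ => norm_nonneg _)]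
    simp only [Real.norm_eq_abs, abs_mul, abs_of_nonneg (singKer_nonneg lam z)]
    rw [integral_mul_const, ← mul_assoc]
    exact mul_le_mul_of_nonneg_right (h.integral_abs_sub_le z) (singKer_nonneg _ _)

lemma integrable_fracLap (h : L1BVWith C M w) (hlam : lam ∈ Ioo (0 : ℝ) 1) (c : ℝ) :
    Integrable (fracLap c lam w) := by
  have := ((h.integrable_kernel hlam).integral_prod_left).const_mul c
  exact this.congr (ae_of_all _ fun x => (fracLap_eq c lam w x).symm)

lemma measurable_fracLap (hw : Measurable w) : Measurable (fracLap c lam w) := by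
  have h1 := ((measurable_kernel (lam := lam) hw).stronglyMeasurable.integral_prod_right
    (ν := volume) (f := fun x z : ℝ => (w (x + z) - w x) * singKer lam z)).measurable.const_mul c
  have : fracLap c lam w = fun x => c * ∫ z, (w (x + z) - w x) * singKer lam z :=
    funext fun x => fracLap_eq c lam w x
  rwa [this]

/-- The jumps `|z| < 1` are controlled by the variation, the others by the `L¹` norm. -/
lemma integral_abs_fracLap_le (h : L1BVWith C M w) (hlam : lam ∈ Ioo (0 : ℝ) 1) (hc : 0 < c) :
    ∫ x, |fracLap c lam w x| ≤ (C + 2 * M) * dConst c lam := by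
  have hk := h.integrable_kernel hlam
  have hkn : Integrable (fun p : ℝ × ℝ => |(w (p.1 + p.2) - w p.1) * singKer lam p.2|)
    (volume.prod volume) := hk.abs
  calc ∫ x, |fracLap c lam w x|
      ≤ ∫ x, c * ∫ z, |(w (x + z) - w x) * singKer lam z| := by
        refine integral_mono (h.integrable_fracLap hlam c).abs
          (hkn.integral_prod_left.const_mul c) fun x => ?_
        simp only
        rw [fracLap_eq, abs_mul, abs_of_pos hc]
        exact mul_le_mul_of_nonneg_left abs_integral_le_integral_abs hc.le
    _ = c * ∫ z, ∫ x, |(w (x + z) - w x) * singKer lam z| := by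
        rw [integral_const_mul]
        congr 1
        exact integral_integral_swap hkn
    _ ≤ c * ∫ z, (C + 2 * M) * (min 1 |z| * singKer lam z) := by
        refine mul_le_mul_of_nonneg_left ?_ hc.le
        refine integral_mono hkn.integral_prod_right
          ((integrable_min_mul_singKer hlam).const_mul _) fun z => ?_
        simp only [abs_mul, abs_of_nonneg (singKer_nonneg lam z)]
        rw [integral_mul_const, ← mul_assoc]
        exact mul_le_mul_of_nonneg_right (h.integral_abs_sub_le z) (singKer_nonneg _ _)
    _ = (C + 2 * M) * dConst c lam := by
        rw [dConst_eq c hlam, integral_const_mul]; ring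

end L1BVWith

lemma measurable_sign : Measurable Real.sign := by
  have : Real.sign = fun r : ℝ => if r < 0 then (-1 : ℝ) else if 0 < r then 1 else 0 := rfl
  rw [this]
  exact Measurable.ite measurableSet_Iio measurable_const
    (Measurable.ite measurableSet_Ioi measurable_const measurable_const)

lemma abs_sign_le_one (r : ℝ) : |Real.sign r| ≤ 1 := by
  rcases Real.sign_apply_eq r with h | h | h <;> simp [h]

lemma sign_mul_le_abs (r a : ℝ) : Real.sign r * a ≤ |a| := by
  calc Real.sign r * a ≤ |Real.sign r * a| := le_abs_self _
    _ = |Real.sign r| * |a| := abs_mul _ _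
    _ ≤ 1 * |a| := by gcongr; exact abs_sign_le_one r
    _ = |a| := one_mul _

lemma sign_mul_self (r : ℝ) : Real.sign r * r = |r| := by
  rcases lt_trichotomy r 0 with h | h | h
  · rw [Real.sign_of_neg h, abs_of_neg h]; ring
  · simp [h]
  · rw [Real.sign_of_pos h, abs_of_pos h]; ring

/-- `g` is accretive in `L¹` (Kato's inequality): for each jump size `z`, the integral over `x` of
`sgn(w)(w(x+z) - w(x)) ≤ |w(x+z)| - |w(x)|` is nonpositive. -/
lemma integral_sign_mul_fracLap_sub_le {c lam C M C' M' : ℝ} {w v : ℝ → ℝ}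
    (hw : L1BVWith C M w) (hv : L1BVWith C' M' v) (hlam : lam ∈ Ioo (0 : ℝ) 1) (hc : 0 < c) :
    ∫ x, Real.sign (w x - v x) * (fracLap c lam w x - fracLap c lam v x) ≤ 0 := by
  have hs : Measurable (fun x => Real.sign (w x - v x)) :=
    measurable_sign.comp (hw.meas.sub hv.meas)
  have hkw := hw.integrable_kernel hlam
  have hkv := hv.integrable_kernel hlam
  set K : ℝ × ℝ → ℝ := fun p => Real.sign (w p.1 - v p.1) *
    ((w (p.1 + p.2) - w p.1) * singKer lam p.2 - (v (p.1 + p.2) - v p.1) * singKer lam p.2)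
    with hK
  have hKi : Integrable K (volume.prod volume) :=
    (hkw.sub hkv).bdd_mul (c := 1) (hs.comp measurable_fst).aestronglyMeasurable
      (ae_of_all _ fun p => abs_sign_le_one _)
  have e1 : ∫ x, Real.sign (w x - v x) * (fracLap c lam w x - fracLap c lam v x)
      = c * ∫ x, ∫ z, K (x, z) := by
    rw [← integral_const_mul]
    refine integral_congr_ae ?_
    filter_upwards [hkw.prod_right_ae, hkv.prod_right_ae] with x h1 h2
    simp only [hK]
    rw [fracLap_eq, fracLap_eq, integral_const_mul, integral_sub h1 h2]
    ring
  rw [e1, integral_integral_swap hKi]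
  refine mul_nonpos_of_nonneg_of_nonpos hc.le (integral_nonpos fun z => ?_)
  have e2 : ∀ x, K (x, z) ≤ (|w (x + z) - v (x + z)| - |w x - v x|) * singKer lam z := by
    intro x
    have h1 := sign_mul_le_abs (w x - v x) (w (x + z) - v (x + z))
    have h2 := sign_mul_self (w x - v x)
    have h3 := singKer_nonneg lam z
    simp only [hK]
    calc _ = (Real.sign (w x - v x) * (w (x + z) - v (x + z))
          - Real.sign (w x - v x) * (w x - v x)) * singKer lam z := by ring
      _ ≤ _ := by gcongr; linarith
  have hi : Integrable (fun x => |w x - v x|) := (hw.int.sub hv.int).abs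
  have hi2 : Integrable (fun x => |w (x + z) - v (x + z)|) := hi.comp_add_right z
  have hKz : Integrable (fun x => K (x, z)) := by
    have := (((hw.integrable_sub z).mul_const (singKer lam z)).sub
      ((hv.integrable_sub z).mul_const (singKer lam z))).bdd_mul (c := 1)
      hs.aestronglyMeasurable (ae_of_all _ fun p => abs_sign_le_one _)
    exact this
  calc ∫ x, K (x, z) ≤ ∫ x, (|w (x + z) - v (x + z)| - |w x - v x|) * singKer lam z :=
        integral_mono hKz ((hi2.sub hi).mul_const _) e2
    _ = 0 := by
        rw [integral_mul_const, integral_sub hi2 hi,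
          integral_add_right_eq_self (fun x => |w x - v x|) z, sub_self, zero_mul]

lemma fracLap_comp_sub (c lam : ℝ) (v : ℝ → ℝ) (z x : ℝ) :
    fracLap c lam (fun y => v (y - z)) x = fracLap c lam v (x - z) := by
  simp only [fracLap]
  congr 2
  ext y
  rw [add_sub_right_comm]

lemma L1BVWith.comp_sub {C M : ℝ} {v : ℝ → ℝ} (h : L1BVWith C M v) (z : ℝ) :
    L1BVWith C M (fun y => v (y - z)) where
  meas := h.meas.comp (measurable_id.sub_const z)
  int := h.int.comp_sub_right z
  norm_le := by rw [integral_sub_right_eq_self (fun x => |v x|) z]; exact h.norm_le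
  trans := fun y => by
    have := integral_sub_right_eq_self (fun x => |v (x + y) - v x|) (μ := volume) z
    simp only [add_sub_right_comm]
    rw [this]
    exact h.trans y

/-- The increments of `v` over the consecutive intervals `[x + kz, x + (k+1)z]`. -/
lemma tsum_edist_le_eVariationOn (v : ℝ → ℝ) {z : ℝ} (hz : 0 < z) (x : ℝ) :
    ∑' k : ℤ, edist (v (x + k • z + z)) (v (x + k • z)) ≤ eVariationOn v univ := by
  rw [ENNReal.tsum_eq_iSup_sum' (fun n : ℕ => Finset.Ico (-(n : ℤ)) n)]
  · refine iSup_le fun n => ?_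
    have := eVariationOn.sum_le (f := v) (s := univ) (n := 2 * n)
      (u := fun i : ℕ => x + ((i : ℤ) - (n : ℤ)) • z)
      (fun i j hij => by
        have : ((i : ℤ) - n) • z ≤ ((j : ℤ) - n) • z :=
          zsmul_le_zsmul_left hz.le (by simpa using hij)
        simpa using this) (fun _ => mem_univ _)
    refine le_trans (le_of_eq ?_) this
    symm
    refine Finset.sum_nbij (fun i : ℕ => (i : ℤ) - n) ?_ ?_ ?_ ?_
    · intro i hi; simp only [Finset.mem_range, Finset.mem_Ico] at hi ⊢; omega
    · intro i _ j _ hij; simp only at hij; omega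
    · intro k hk
      simp only [Finset.coe_Ico, mem_Ico] at hk
      refine ⟨(k + n).toNat, ?_, ?_⟩
      · simp only [Finset.coe_range, mem_Iio]; omega
      · simp only; omega
    · intro i _
      have : ((i : ℤ) + 1 - n) • z = ((i : ℤ) - n) • z + z := by
        rw [add_sub_right_comm, add_zsmul, one_zsmul]
      push_cast
      rw [this, add_assoc]
  · intro t
    refine ⟨t.sup Int.natAbs + 1, fun k hk => ?_⟩
    have := Finset.le_sup (f := Int.natAbs) hk
    simp only [Finset.mem_Ico]
    omega

/-- Cutting the line into intervals of length `z` turns the `L¹` modulus of continuity into an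
average of sums of consecutive increments. -/
lemma lintegral_edist_le_of_eVariationOn {v : ℝ → ℝ} (hv : AEStronglyMeasurable v volume)
    {z : ℝ} (hz : 0 < z) :
    ∫⁻ x, edist (v (x + z)) (v x) ≤ ENNReal.ofReal z * eVariationOn v univ := by
  have hva : ∀ y : ℝ, AEMeasurable (fun x => v (x + y)) volume := fun y =>
    hv.aemeasurable.comp_quasiMeasurePreserving
      (measurePreserving_add_right volume y).quasiMeasurePreserving
  have hh : ∀ y : ℝ, AEMeasurable (fun x => edist (v (x + y + z)) (v (x + y))) volume := fun y =>
    by simp_rw [add_assoc]; exact (hva _).edist (hva _)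
  calc ∫⁻ x, edist (v (x + z)) (v x)
      = ∑' k : ℤ, ∫⁻ x in Ioc (k • z) ((k + 1) • z), edist (v (x + z)) (v x) := by
        rw [← lintegral_iUnion (fun k => measurableSet_Ioc) (pairwise_disjoint_Ioc_zsmul z),
          iUnion_Ioc_zsmul hz, setLIntegral_univ]
    _ = ∑' k : ℤ, ∫⁻ x in Ioc 0 z, edist (v (x + k • z + z)) (v (x + k • z)) := by
        congr 1; ext k
        rw [← lintegral_indicator measurableSet_Ioc, ← lintegral_indicator measurableSet_Ioc,
          ← lintegral_add_right_eq_self _ (k • z)]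
        congr 1; ext x
        simp only [indicator, mem_Ioc, add_zsmul, one_zsmul]
        congr 1
        simp only [eq_iff_iff]
        constructor <;> rintro ⟨h1, h2⟩ <;> constructor <;> linarith
    _ = ∫⁻ x in Ioc 0 z, ∑' k : ℤ, edist (v (x + k • z + z)) (v (x + k • z)) :=
        (lintegral_tsum fun k => (hh _).restrict).symm
    _ ≤ ∫⁻ x in Ioc 0 z, eVariationOn v univ :=
        lintegral_mono fun x => tsum_edist_le_eVariationOn v hz x
    _ = ENNReal.ofReal z * eVariationOn v univ := by
        rw [setLIntegral_const, Real.volume_Ioc, sub_zero, mul_comm]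

/-- The additive `1` makes room for a representative whose variation is close to the infimum. -/
lemma transLip_of_essVariation_le {w : ℝ → ℝ} (hw : Integrable w) {C : NNReal}
    (hC : essVariation w ≤ C) : TransLip (C + 1) w := by
  have h1 : essVariation w < C + 1 :=
    hC.trans_lt (ENNReal.lt_add_right ENNReal.coe_ne_top one_ne_zero)
  simp only [essVariation, iInf_lt_iff] at h1
  obtain ⟨v, hvw, hv⟩ := h1
  have key : ∀ z : ℝ, 0 < z → ∫ x, |w (x + z) - w x| ≤ (C + 1) * z := by
    intro z hz
    have hs : (fun x => v (x + z)) =ᵐ[volume] fun x => w (x + z) :=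
      (measurePreserving_add_right volume z).quasiMeasurePreserving.ae_eq_comp hvw
    have h2 : ∫⁻ x, ENNReal.ofReal |w (x + z) - w x| ≤ ENNReal.ofReal ((C + 1) * z) := by
      calc ∫⁻ x, ENNReal.ofReal |w (x + z) - w x| = ∫⁻ x, edist (v (x + z)) (v x) := by
            refine lintegral_congr_ae ?_
            filter_upwards [hvw, hs] with x hx1 hx2
            rw [edist_dist, Real.dist_eq, hx1, hx2]
        _ ≤ ENNReal.ofReal z * eVariationOn v univ :=
            lintegral_edist_le_of_eVariationOn (hw.1.congr hvw.symm) hz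
        _ ≤ ENNReal.ofReal z * (C + 1) := by gcongr
        _ = ENNReal.ofReal ((C + 1) * z) := by
            rw [mul_comm, ENNReal.ofReal_mul (by positivity)]
            congr 1
            rw [ENNReal.ofReal_add C.coe_nonneg zero_le_one, ENNReal.ofReal_coe_nnreal,
              ENNReal.ofReal_one]
    have hi : Integrable (fun x => |w (x + z) - w x|) := ((hw.comp_add_right z).sub hw).abs
    rw [integral_eq_lintegral_of_nonneg_ae (ae_of_all _ fun x => abs_nonneg _) hi.1]
    exact ENNReal.toReal_le_of_le_ofReal (by positivity) h2
  intro z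
  rcases lt_trichotomy z 0 with hz | hz | hz
  · have := key (-z) (by linarith)
    rw [abs_of_neg hz]
    rw [← integral_add_right_eq_self _ z] at this
    simpa [abs_sub_comm] using this
  · simp [hz]
  · rw [abs_of_pos hz]; exact key z hz

/-! ### Step functions and cell averages -/

/-- The half-open grid cell `[i Δx, (i+1) Δx)`. -/
def cell (Δx : ℝ) (i : ℤ) : Set ℝ := Ico ((i : ℝ) * Δx) (((i : ℝ) + 1) * Δx)

section Grid

variable {Δx : ℝ}

lemma mem_cell_iff (hΔ : 0 < Δx) {x : ℝ} {i : ℤ} : x ∈ cell Δx i ↔ ⌊x / Δx⌋ = i := by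
  rw [Int.floor_eq_iff, cell, mem_Ico, le_div_iff₀ hΔ, div_lt_iff₀ hΔ]

lemma measurableSet_cell (i : ℤ) : MeasurableSet (cell Δx i) := measurableSet_Ico

lemma pairwise_disjoint_cell (hΔ : 0 < Δx) :
    Pairwise (Function.onFun Disjoint (cell Δx)) := by
  intro i j hij
  refine Set.disjoint_left.2 fun x hi hj => hij ?_
  rw [mem_cell_iff hΔ] at hi hj
  exact hi.symm.trans hj

lemma iUnion_cell (hΔ : 0 < Δx) : ⋃ i, cell Δx i = univ :=
  eq_univ_of_forall fun x => mem_iUnion.2 ⟨⌊x / Δx⌋, (mem_cell_iff hΔ).2 rfl⟩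

lemma volume_cell (i : ℤ) : volume (cell Δx i) = ENNReal.ofReal Δx := by
  rw [cell, Real.volume_Ico]; congr 1; ring

lemma volume_real_cell (hΔ : 0 < Δx) (i : ℤ) : volume.real (cell Δx i) = Δx := by
  rw [Measure.real, volume_cell, ENNReal.toReal_ofReal hΔ.le]

lemma lintegral_eq_tsum_cell (hΔ : 0 < Δx) (h : ℝ → ENNReal) :
    ∫⁻ x, h x = ∑' i, ∫⁻ x in cell Δx i, h x := by
  rw [← lintegral_iUnion measurableSet_cell (pairwise_disjoint_cell hΔ), iUnion_cell hΔ,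
    setLIntegral_univ]

lemma hasSum_integral_cell (hΔ : 0 < Δx) {h : ℝ → ℝ} (hh : Integrable h) :
    HasSum (fun i => ∫ x in cell Δx i, h x) (∫ x, h x) := by
  have := hasSum_integral_iUnion (measurableSet_cell (Δx := Δx)) (pairwise_disjoint_cell hΔ)
    (f := h) hh.integrableOn
  rwa [iUnion_cell hΔ, setIntegral_univ] at this

lemma stepFun_of_mem (hΔ : 0 < Δx) (V : ℤ → ℝ) {x : ℝ} {i : ℤ} (hx : x ∈ cell Δx i) :
    stepFun Δx V x = V i := by
  rw [stepFun, (mem_cell_iff hΔ).1 hx]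

lemma measurable_stepFun (Δx : ℝ) (V : ℤ → ℝ) : Measurable (stepFun Δx V) :=
  (measurable_of_countable V).comp (Int.measurable_floor.comp (measurable_id.div_const Δx))

lemma stepFun_add (hΔ : 0 < Δx) (V : ℤ → ℝ) (x : ℝ) :
    stepFun Δx V (x + Δx) = V (⌊x / Δx⌋ + 1) := by
  rw [stepFun, add_div, div_self hΔ.ne', Int.floor_add_one]

lemma stepFun_sub (hΔ : 0 < Δx) (V : ℤ → ℝ) (x : ℝ) :
    stepFun Δx V (x - Δx) = V (⌊x / Δx⌋ - 1) := by
  rw [stepFun, sub_div, div_self hΔ.ne', Int.floor_sub_one]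

lemma lintegral_stepFun (hΔ : 0 < Δx) (V : ℤ → ℝ) :
    ∫⁻ x, ENNReal.ofReal |stepFun Δx V x| = ENNReal.ofReal Δx * ∑' i, ENNReal.ofReal |V i| := by
  rw [lintegral_eq_tsum_cell hΔ, ← ENNReal.tsum_mul_left]
  congr 1; ext i
  rw [setLIntegral_congr_fun (measurableSet_cell i)
    (fun x hx => by rw [stepFun_of_mem hΔ V hx]), setLIntegral_const, volume_cell, mul_comm]

lemma integrable_stepFun (hΔ : 0 < Δx) {V : ℤ → ℝ} (hV : Summable fun i => |V i|) :
    Integrable (stepFun Δx V) := by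
  refine ⟨(measurable_stepFun Δx V).aestronglyMeasurable, ?_⟩
  rw [hasFiniteIntegral_iff_norm]
  simp only [Real.norm_eq_abs]
  rw [lintegral_stepFun hΔ]
  refine ENNReal.mul_lt_top ENNReal.ofReal_lt_top ?_
  rw [← ENNReal.ofReal_tsum_of_nonneg (fun i => abs_nonneg _) hV]
  exact ENNReal.ofReal_lt_top

lemma integral_abs_stepFun (hΔ : 0 < Δx) {V : ℤ → ℝ} (hV : Summable fun i => |V i|) :
    ∫ x, |stepFun Δx V x| = Δx * ∑' i, |V i| := by
  have hi := (integrable_stepFun hΔ hV).abs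
  rw [integral_eq_lintegral_of_nonneg_ae (ae_of_all _ fun x => abs_nonneg _) hi.1]
  rw [lintegral_stepFun hΔ, ← ENNReal.ofReal_tsum_of_nonneg (fun i => abs_nonneg _) hV,
    ← ENNReal.ofReal_mul hΔ.le, ENNReal.toReal_ofReal]
  exact mul_nonneg hΔ.le (tsum_nonneg fun i => abs_nonneg _)

/-- The telescoping bound, written as a sum over all of `ℤ` so that it can be integrated. -/
lemma edist_le_tsum_of_le (V : ℤ → ℝ) {a b : ℤ} (hab : a ≤ b) :
    edist (V a) (V b) ≤ ∑' i : ℤ, if a ≤ i ∧ i < b then edist (V i) (V (i + 1)) else 0 := by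
  obtain ⟨n, rfl⟩ := Int.le.dest hab
  have h1 := edist_le_range_sum_edist (fun j : ℕ => V (a + j)) n
  simp only [Nat.cast_zero, add_zero] at h1
  refine h1.trans ?_
  have hinj : Function.Injective (fun j : ℕ => a + (j : ℤ)) := fun i j h => by simpa using h
  have h2 := ENNReal.sum_le_tsum (f := fun i : ℤ => if a ≤ i ∧ i < a + n then
    edist (V i) (V (i + 1)) else 0)
    ((Finset.range n).image fun j : ℕ => a + (j : ℤ))
  refine le_trans (le_of_eq ?_) h2
  rw [Finset.sum_image hinj.injOn]
  refine Finset.sum_congr rfl fun j hj => ?_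
  have := Finset.mem_range.1 hj
  rw [if_pos ⟨by omega, by omega⟩]
  push_cast
  rw [add_assoc]

/-- The jump at the right end of cell `i` is seen exactly from the `x` in an interval of length
`z`. -/
lemma lintegral_edist_stepFun_le (hΔ : 0 < Δx) (V : ℤ → ℝ) {z : ℝ} (hz : 0 < z) :
    ∫⁻ x, edist (stepFun Δx V x) (stepFun Δx V (x + z))
      ≤ (∑' i, edist (V i) (V (i + 1))) * ENNReal.ofReal z := by
  have hpt : ∀ x, edist (stepFun Δx V x) (stepFun Δx V (x + z)) ≤ ∑' i : ℤ,
      (Ico (((i : ℝ) + 1) * Δx - z) (((i : ℝ) + 1) * Δx)).indicator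
        (fun _ => edist (V i) (V (i + 1))) x := by
    intro x
    refine (edist_le_tsum_of_le V (Int.floor_le_floor
      (by gcongr; linarith : x / Δx ≤ (x + z) / Δx))).trans ?_
    refine ENNReal.tsum_le_tsum fun i => ?_
    split_ifs with h
    · rw [indicator_of_mem]
      have h1 := Int.floor_le_iff.1 h.1
      have h2 := Int.le_floor.1 (Int.add_one_le_of_lt h.2)
      push_cast at h2
      rw [div_lt_iff₀ hΔ] at h1
      rw [le_div_iff₀ hΔ] at h2
      exact ⟨by linarith, h1⟩
    · exact zero_le
  refine (lintegral_mono hpt).trans ?_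
  rw [lintegral_tsum fun i => (measurable_const.indicator measurableSet_Ico).aemeasurable,
    ← ENNReal.tsum_mul_right]
  refine ENNReal.tsum_le_tsum fun i => ?_
  rw [lintegral_indicator measurableSet_Ico, setLIntegral_const, Real.volume_Ico]
  simp

lemma summable_diff {V : ℤ → ℝ} (hV : Summable fun i => |V i|) :
    Summable fun i => |V (i + 1) - V i| := by
  have h1 : Summable fun i => |V (i + 1)| := (Equiv.addRight (1 : ℤ)).summable_iff.2 hV
  exact Summable.of_nonneg_of_le (fun i => abs_nonneg _) (fun i => abs_sub _ _) (h1.add hV)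

lemma transLip_stepFun (hΔ : 0 < Δx) {V : ℤ → ℝ} (hV : Summable fun i => |V i|) :
    TransLip (∑' i, |V (i + 1) - V i|) (stepFun Δx V) := by
  have hint := integrable_stepFun hΔ hV
  have hd := summable_diff hV
  have key : ∀ z : ℝ, 0 < z → ∫ x, |stepFun Δx V (x + z) - stepFun Δx V x|
      ≤ (∑' i, |V (i + 1) - V i|) * z := by
    intro z hz
    have hi : Integrable (fun x => |stepFun Δx V (x + z) - stepFun Δx V x|) :=
      ((hint.comp_add_right z).sub hint).abs
    rw [integral_eq_lintegral_of_nonneg_ae (ae_of_all _ fun x => abs_nonneg _) hi.1]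
    have h0 : 0 ≤ ∑' i, |V (i + 1) - V i| := tsum_nonneg fun i => abs_nonneg _
    refine ENNReal.toReal_le_of_le_ofReal (by positivity) ?_
    have := lintegral_edist_stepFun_le hΔ V hz
    simp only [edist_dist, Real.dist_eq] at this
    rw [ENNReal.ofReal_mul h0, ENNReal.ofReal_tsum_of_nonneg (fun i => abs_nonneg _) hd]
    simpa only [abs_sub_comm] using this
  intro z
  rcases lt_trichotomy z 0 with hz | hz | hz
  · have := key (-z) (by linarith)
    rw [abs_of_neg hz]
    rw [← integral_add_right_eq_self _ z] at this
    simpa [abs_sub_comm] using this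
  · simp [hz]
  · rw [abs_of_pos hz]; exact key z hz

lemma l1BVWith_stepFun (hΔ : 0 < Δx) {V : ℤ → ℝ} (hV : Summable fun i => |V i|) {C M : ℝ}
    (hC : ∑' i, |V (i + 1) - V i| ≤ C) (hM : Δx * ∑' i, |V i| ≤ M) :
    L1BVWith C M (stepFun Δx V) where
  meas := measurable_stepFun Δx V
  int := integrable_stepFun hΔ hV
  norm_le := by rwa [integral_abs_stepFun hΔ hV]
  trans := fun z => (transLip_stepFun hΔ hV z).trans (by gcongr)

lemma cellAverage_eq (Δx : ℝ) (w : ℝ → ℝ) (i : ℤ) :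
    cellAverage Δx w i = (1 / Δx) * ∫ x in cell Δx i, w x := by
  rw [cellAverage, cell, integral_Ico_eq_integral_Ioo]

lemma abs_cellAverage_le (hΔ : 0 < Δx) (w : ℝ → ℝ) (i : ℤ) :
    |cellAverage Δx w i| ≤ (1 / Δx) * ∫ x in cell Δx i, |w x| := by
  rw [cellAverage_eq, abs_mul, abs_of_pos (by positivity : 0 < 1 / Δx)]
  gcongr
  exact abs_integral_le_integral_abs

lemma summable_cellAverage (hΔ : 0 < Δx) {w : ℝ → ℝ} (hw : Integrable w) :
    Summable (fun i => |cellAverage Δx w i|) ∧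
      Δx * ∑' i, |cellAverage Δx w i| ≤ ∫ x, |w x| := by
  have h1 := (hasSum_integral_cell hΔ hw.abs).mul_left (1 / Δx)
  have h2 := Summable.of_nonneg_of_le (fun i => abs_nonneg _)
    (fun i => abs_cellAverage_le hΔ w i) h1.summable
  refine ⟨h2, ?_⟩
  calc Δx * ∑' i, |cellAverage Δx w i| ≤ Δx * ((1 / Δx) * ∫ x, |w x|) := by
        gcongr
        rw [← h1.tsum_eq]
        exact h2.tsum_le_tsum (fun i => abs_cellAverage_le hΔ w i) h1.summable
    _ = ∫ x, |w x| := by field_simp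

lemma cellAverage_sub {w v : ℝ → ℝ} (hw : Integrable w) (hv : Integrable v)
    (i : ℤ) : cellAverage Δx (fun x => w x - v x) i = cellAverage Δx w i - cellAverage Δx v i := by
  rw [cellAverage_eq, cellAverage_eq, cellAverage_eq, integral_sub hw.integrableOn hv.integrableOn]
  ring

lemma cellAverage_comp_add (hΔ : 0 < Δx) (w : ℝ → ℝ) (i : ℤ) :
    cellAverage Δx (fun x => w (x + Δx)) i = cellAverage Δx w (i + 1) := by
  rw [cellAverage_eq, cellAverage_eq]
  congr 1
  rw [← integral_indicator (measurableSet_cell _), ← integral_indicator (measurableSet_cell _),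
    ← integral_add_right_eq_self ((cell Δx (i + 1)).indicator w) Δx]
  congr 1; ext x
  have : x ∈ cell Δx i ↔ x + Δx ∈ cell Δx (i + 1) := by
    rw [mem_cell_iff hΔ, mem_cell_iff hΔ, add_div, div_self hΔ.ne', Int.floor_add_one,
      add_left_inj]
  by_cases h : x ∈ cell Δx i
  · rw [indicator_of_mem h, indicator_of_mem (this.1 h)]
  · rw [indicator_of_notMem h, indicator_of_notMem (mt this.2 h)]

lemma tsum_abs_cellAverage_diff_le (hΔ : 0 < Δx) {w : ℝ → ℝ} {C M : ℝ} (hw : L1BVWith C M w) :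
    ∑' i, |cellAverage Δx w (i + 1) - cellAverage Δx w i| ≤ C := by
  have h1 := (summable_cellAverage hΔ (hw.integrable_sub Δx)).2
  have h2 : ∀ i, cellAverage Δx (fun x => w (x + Δx) - w x) i
      = cellAverage Δx w (i + 1) - cellAverage Δx w i := fun i => by
    rw [cellAverage_sub (hw.int.comp_add_right Δx) hw.int, cellAverage_comp_add hΔ]
  simp only [h2] at h1
  have h3 := h1.trans (hw.trans Δx)
  rw [abs_of_pos hΔ, mul_comm C] at h3
  exact le_of_mul_le_mul_left h3 hΔ

/-- The cell averages of `G` have the same integral as `G` against bounded functions that are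
constant on cells. -/
lemma integral_sub_cellAverage_mul (hΔ : 0 < Δx) {G : ℝ → ℝ} (hG : Integrable G) {b : ℤ → ℝ}
    {B : ℝ} (hb : ∀ i, |b i| ≤ B) :
    ∫ x, (G x - stepFun Δx (cellAverage Δx G) x) * stepFun Δx b x = 0 := by
  have hs := integrable_stepFun hΔ (summable_cellAverage hΔ hG).1
  have hi : Integrable
      (fun x => (G x - stepFun Δx (cellAverage Δx G) x) * stepFun Δx b x) :=
    (hG.sub hs).mul_bdd (c := B) (measurable_stepFun Δx b).aestronglyMeasurable
      (ae_of_all _ fun x => hb _)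
  have := hasSum_integral_cell hΔ hi
  refine this.unique ?_
  convert! hasSum_zero with i
  rw [setIntegral_congr_fun (measurableSet_cell i)
    (g := fun x => (G x - cellAverage Δx G i) * b i)
    (fun x hx => by simp only [stepFun_of_mem hΔ _ hx]), integral_mul_const,
    integral_sub hG.integrableOn (integrableOn_const (by simp [volume_cell])),
    setIntegral_const, volume_real_cell hΔ, cellAverage_eq]
  simp only [smul_eq_mul]
  field_simp
  ring

/-- Cells have length `Δx`, so a cell average only sees translates by at most `Δx`. -/
lemma abs_sub_cellAverage_le (hΔ : 0 < Δx) {w : ℝ → ℝ} (hw : Integrable w) (x : ℝ) :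
    |w x - stepFun Δx (cellAverage Δx w) x|
      ≤ (1 / Δx) * ∫ z in Icc (-Δx) Δx, |w (x + z) - w x| := by
  set i := ⌊x / Δx⌋ with hi
  have hx : x ∈ cell Δx i := (mem_cell_iff hΔ).2 rfl
  have hc : IntegrableOn (fun _ : ℝ => w x) (cell Δx i) :=
    integrableOn_const (by simp [volume_cell])
  have e1 : w x - stepFun Δx (cellAverage Δx w) x
      = (1 / Δx) * ∫ y in cell Δx i, (w x - w y) := by
    rw [stepFun_of_mem hΔ _ hx, cellAverage_eq, integral_sub hc hw.integrableOn,
      setIntegral_const, volume_real_cell hΔ, smul_eq_mul]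
    field_simp
  rw [e1, abs_mul, abs_of_pos (by positivity : 0 < 1 / Δx)]
  gcongr
  calc |∫ y in cell Δx i, (w x - w y)| ≤ ∫ y in cell Δx i, |w y - w x| := by
        refine abs_integral_le_integral_abs.trans (le_of_eq ?_)
        simp only [abs_sub_comm]
    _ ≤ ∫ y in Icc (x - Δx) (x + Δx), |w y - w x| := by
        refine setIntegral_mono_set ?_ (ae_of_all _ fun y => abs_nonneg _) ?_
        · exact (hw.integrableOn.sub (integrableOn_const (by simp))).abs
        · refine (LE.le.eventuallyLE ?_)
          intro y hy
          simp only [cell, mem_Ico] at hx hy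
          constructor <;> nlinarith [hx.1, hx.2, hy.1, hy.2]
    _ = ∫ z in Icc (-Δx) Δx, |w (x + z) - w x| := by
        rw [← integral_indicator measurableSet_Icc, ← integral_indicator measurableSet_Icc,
          ← integral_add_left_eq_self _ x]
        congr 1; ext y
        simp only [indicator, mem_Icc]
        congr 1
        simp only [eq_iff_iff]
        constructor <;> rintro ⟨h1, h2⟩ <;> constructor <;> linarith

lemma integral_abs_sub_cellAverage_le (hΔ : 0 < Δx) {w : ℝ → ℝ} {C M : ℝ}
    (hw : L1BVWith C M w) :
    ∫ x, |w x - stepFun Δx (cellAverage Δx w) x| ≤ 2 * C * Δx := by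
  have hC := hw.C_nonneg
  have hs := integrable_stepFun hΔ (summable_cellAverage hΔ hw.int).1
  have hm : Measurable (fun p : ℝ × ℝ => |w (p.1 + p.2) - w p.1|) := by
    have := hw.meas; fun_prop
  have hb : ∀ z, ∫ x, |w (x + z) - w x| ≤ C * |z| := hw.trans
  have hP : Integrable (fun p : ℝ × ℝ => |w (p.1 + p.2) - w p.1|)
      (volume.prod (volume.restrict (Icc (-Δx) Δx))) := by
    rw [integrable_prod_iff' hm.aestronglyMeasurable]
    refine ⟨ae_of_all _ fun z => (hw.integrable_sub z).abs, ?_⟩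
    refine Integrable.mono' (g := fun _ => C * Δx) (integrable_const _) ?_ ?_
    · exact (hm.norm.stronglyMeasurable.integral_prod_left (μ := volume)
        (f := fun x z : ℝ => ‖|w (x + z) - w x|‖)).aestronglyMeasurable
    · filter_upwards [ae_restrict_mem measurableSet_Icc] with z hz
      rw [Real.norm_of_nonneg (integral_nonneg fun x => norm_nonneg _)]
      simp only [Real.norm_eq_abs, abs_abs]
      exact (hb z).trans (by gcongr; exact abs_le.2 hz)
  calc ∫ x, |w x - stepFun Δx (cellAverage Δx w) x|
      ≤ ∫ x, (1 / Δx) * ∫ z in Icc (-Δx) Δx, |w (x + z) - w x| :=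
        integral_mono (hw.int.sub hs).abs (hP.integral_prod_left.const_mul _)
          fun x => abs_sub_cellAverage_le hΔ hw.int x
    _ = (1 / Δx) * ∫ z in Icc (-Δx) Δx, ∫ x, |w (x + z) - w x| := by
        rw [integral_const_mul]
        congr 1
        exact integral_integral_swap hP
    _ ≤ (1 / Δx) * ∫ z in Icc (-Δx) Δx, C * Δx := by
        refine mul_le_mul_of_nonneg_left ?_ (by positivity)
        refine setIntegral_mono_on hP.integral_prod_right (integrableOn_const (by simp))
          measurableSet_Icc fun z hz => ?_
        exact (hb z).trans (by gcongr; exact abs_le.2 hz)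
    _ = 2 * C * Δx := by
        rw [setIntegral_const]
        simp only [Measure.real, Real.volume_Icc, smul_eq_mul]
        rw [ENNReal.toReal_ofReal (by linarith)]
        field_simp
        ring

end Grid

/-! ### The discrete nonlocal operator as a weighted sum of differences -/

/-- The index of the cell reached from `x` by a jump of size `z`. -/
noncomputable def jumpIndex (Δx : ℝ) (p : ℝ × ℝ) : ℤ := ⌊(p.1 + p.2) / Δx⌋

/-- The kernel of the nonlocal operator restricted to the jumps `z` from `x` out of the cell
`[0, Δx)`. -/
noncomputable def exitKer (lam Δx : ℝ) (p : ℝ × ℝ) : ℝ :=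
  if jumpIndex Δx p = 0 then 0 else singKer lam p.2

/-- The weight of the value in cell `i + j` in the discrete operator at cell `i`. -/
noncomputable def weight (c lam Δx : ℝ) (j : ℤ) : ℝ :=
  c / Δx * ∫ p in {p | jumpIndex Δx p = j}, exitKer lam Δx p
    ∂((volume.restrict (cell Δx 0)).prod volume)

section Weights

variable {c lam Δx : ℝ}

lemma measurable_jumpIndex (Δx : ℝ) : Measurable (jumpIndex Δx) :=
  Int.measurable_floor.comp ((measurable_fst.add measurable_snd).div_const Δx)

lemma measurableSet_jumpIndex (Δx : ℝ) (j : ℤ) : MeasurableSet {p | jumpIndex Δx p = j} :=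
  measurable_jumpIndex Δx (measurableSet_singleton j)

lemma measurable_exitKer (lam Δx : ℝ) : Measurable (exitKer lam Δx) :=
  Measurable.ite (measurableSet_jumpIndex Δx 0) measurable_const
    ((measurable_singKer lam).comp measurable_snd)

lemma exitKer_nonneg (lam Δx : ℝ) (p : ℝ × ℝ) : 0 ≤ exitKer lam Δx p := by
  unfold exitKer; split_ifs
  · exact le_rfl
  · exact singKer_nonneg _ _

/-- Scaling of the truncated kernel, the source of the power `Δx ^ (-lam)`. -/
lemma min_mul_singKer_scale (hΔ : 0 < Δx) (z : ℝ) :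
    min Δx |z| * singKer lam z = Δx ^ (-lam) * (min 1 |Δx⁻¹ * z| * singKer lam (Δx⁻¹ * z)) := by
  have h1 : min 1 |Δx⁻¹ * z| = Δx⁻¹ * min Δx |z| := by
    rw [abs_mul, abs_of_pos (inv_pos.2 hΔ), mul_min_of_nonneg _ _ (inv_pos.2 hΔ).le,
      inv_mul_cancel₀ hΔ.ne']
  have h2 : singKer lam (Δx⁻¹ * z) = Δx ^ (1 + lam) * singKer lam z := by
    rw [singKer, singKer, abs_mul, abs_of_pos (inv_pos.2 hΔ),
      Real.mul_rpow (inv_pos.2 hΔ).le (abs_nonneg z), Real.inv_rpow hΔ.le]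
    field_simp
  rw [h1, h2, Real.rpow_add hΔ, Real.rpow_one, Real.rpow_neg hΔ.le]
  have : Δx ^ lam ≠ 0 := (Real.rpow_pos_of_pos hΔ lam).ne'
  field_simp

lemma integrable_min_mul_singKer' (hlam : lam ∈ Ioo (0 : ℝ) 1) (hΔ : 0 < Δx) :
    Integrable (fun z => min Δx |z| * singKer lam z) := by
  simp_rw [min_mul_singKer_scale hΔ]
  exact ((integrable_min_mul_singKer hlam).comp_mul_left' (inv_ne_zero hΔ.ne')).const_mul _

lemma integral_min_mul_singKer (hΔ : 0 < Δx) :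
    ∫ z, min Δx |z| * singKer lam z
      = Δx * Δx ^ (-lam) * ∫ z, min 1 |z| * singKer lam z := by
  simp_rw [min_mul_singKer_scale hΔ]
  rw [integral_const_mul,
    Measure.integral_comp_mul_left (fun z => min 1 |z| * singKer lam z), inv_inv,
    abs_of_pos hΔ, smul_eq_mul]
  ring

/-- A jump of size `z` leaves the cell only from a boundary layer of width `|z|`. -/
lemma volume_real_exit_le (hΔ : 0 < Δx) (z : ℝ) :
    (volume.restrict (cell Δx 0)).real {x | jumpIndex Δx (x, z) ≠ 0} ≤ min Δx |z| := by
  have hm : MeasurableSet {x | jumpIndex Δx (x, z) ≠ 0} :=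
    ((measurable_jumpIndex Δx).comp (measurable_id.prodMk measurable_const))
      (measurableSet_singleton 0).compl
  rw [measureReal_restrict_apply hm]
  refine le_min ?_ ?_
  · refine (measureReal_mono inter_subset_right (by simp [volume_cell])).trans ?_
    rw [volume_real_cell hΔ]
  · rcases le_total 0 z with hz | hz
    · refine (measureReal_mono (s₂ := Ico (Δx - z) Δx) ?_ (by simp)).trans ?_
      · rintro x ⟨hx1, hx2⟩
        have h1 : x + z ∉ cell Δx 0 := mt (mem_cell_iff hΔ).1 hx1
        simp only [cell, mem_Ico, Int.cast_zero, zero_mul, zero_add, one_mul, not_and,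
          not_lt] at h1 hx2
        exact ⟨by linarith [h1 (by linarith)], hx2.2⟩
      · rw [Real.volume_real_Ico_of_le (by linarith), abs_of_nonneg hz]; linarith
    · refine (measureReal_mono (s₂ := Ico 0 (-z)) ?_ (by simp)).trans ?_
      · rintro x ⟨hx1, hx2⟩
        have h1 : x + z ∉ cell Δx 0 := mt (mem_cell_iff hΔ).1 hx1
        simp only [cell, mem_Ico, Int.cast_zero, zero_mul, zero_add, one_mul, not_and,
          not_lt] at h1 hx2
        refine ⟨hx2.1, ?_⟩
        by_contra h
        linarith [h1 (by linarith)]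
      · rw [Real.volume_real_Ico_of_le (by linarith), abs_of_nonpos hz]; linarith

lemma integral_exitKer_le (hΔ : 0 < Δx) (z : ℝ) :
    ∫ x in cell Δx 0, exitKer lam Δx (x, z) ≤ min Δx |z| * singKer lam z := by
  have hm : MeasurableSet {x | jumpIndex Δx (x, z) ≠ 0} :=
    ((measurable_jumpIndex Δx).comp (measurable_id.prodMk measurable_const))
      (measurableSet_singleton 0).compl
  have : (fun x => exitKer lam Δx (x, z))
      = {x | jumpIndex Δx (x, z) ≠ 0}.indicator (fun _ => singKer lam z) := by
    ext x
    by_cases h : jumpIndex Δx (x, z) = 0 <;> simp [exitKer, h]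
  rw [this, integral_indicator_const _ hm, smul_eq_mul]
  exact mul_le_mul_of_nonneg_right (volume_real_exit_le hΔ z) (singKer_nonneg _ _)

lemma integrable_exitKer (hlam : lam ∈ Ioo (0 : ℝ) 1) (hΔ : 0 < Δx) :
    Integrable (exitKer lam Δx) ((volume.restrict (cell Δx 0)).prod volume) := by
  have hm := measurable_exitKer lam Δx
  have : IsFiniteMeasure (volume.restrict (cell Δx 0)) := ⟨by simp [volume_cell]⟩
  rw [integrable_prod_iff' hm.aestronglyMeasurable]
  constructor
  · refine ae_of_all _ fun z => ?_
    refine Integrable.mono' (g := fun _ => singKer lam z) (integrable_const _)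
      (hm.comp (measurable_id.prodMk measurable_const)).aestronglyMeasurable
      (ae_of_all _ fun x => ?_)
    rw [Real.norm_of_nonneg (exitKer_nonneg _ _ _)]
    unfold exitKer; split_ifs
    · exact singKer_nonneg _ _
    · exact le_rfl
  · refine (integrable_min_mul_singKer' hlam hΔ).mono' ?_ (ae_of_all _ fun z => ?_)
    · exact (hm.norm.stronglyMeasurable.integral_prod_left (μ := volume.restrict (cell Δx 0))
        (f := fun x z : ℝ => ‖exitKer lam Δx (x, z)‖)).aestronglyMeasurable
    · rw [Real.norm_of_nonneg (integral_nonneg fun x => norm_nonneg _)]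
      simp only [Real.norm_of_nonneg (exitKer_nonneg lam Δx _)]
      exact integral_exitKer_le hΔ z

lemma weight_nonneg (hc : 0 < c) (hΔ : 0 < Δx) (j : ℤ) : 0 ≤ weight c lam Δx j :=
  mul_nonneg (by positivity) (integral_nonneg fun _ => exitKer_nonneg _ _ _)

lemma pairwise_disjoint_jumpIndex (Δx : ℝ) :
    Pairwise (Function.onFun Disjoint fun j : ℤ => {p | jumpIndex Δx p = j}) := by
  intro i j hij
  exact Set.disjoint_left.2 fun _ (hi : _ = i) (hj : _ = j) => hij (hi.symm.trans hj)

lemma iUnion_jumpIndex (Δx : ℝ) : ⋃ j : ℤ, {p | jumpIndex Δx p = j} = univ :=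
  eq_univ_of_forall fun p => mem_iUnion.2 ⟨_, rfl⟩

/-- Sum over the target cells of the jumps. -/
lemma hasSum_weight_mul (hlam : lam ∈ Ioo (0 : ℝ) 1) (hΔ : 0 < Δx) {b : ℤ → ℝ} {B : ℝ}
    (hb : ∀ j, |b j| ≤ B) :
    HasSum (fun j => weight c lam Δx j * b j)
      (c / Δx * ∫ p, b (jumpIndex Δx p) * exitKer lam Δx p
        ∂((volume.restrict (cell Δx 0)).prod volume)) := by
  have hk := integrable_exitKer hlam hΔ
  have hi : Integrable (fun p => b (jumpIndex Δx p) * exitKer lam Δx p)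
      ((volume.restrict (cell Δx 0)).prod volume) :=
    hk.bdd_mul (c := B) ((measurable_of_countable b).comp
      (measurable_jumpIndex Δx)).aestronglyMeasurable (ae_of_all _ fun p => hb _)
  have := hasSum_integral_iUnion (measurableSet_jumpIndex Δx) (pairwise_disjoint_jumpIndex Δx)
    hi.integrableOn
  rw [iUnion_jumpIndex, setIntegral_univ] at this
  convert! this.mul_left (c / Δx) using 1
  ext j
  rw [weight, mul_assoc, ← integral_mul_const]
  congr 1
  refine setIntegral_congr_fun (measurableSet_jumpIndex Δx j) fun p hp => ?_
  have hp : jumpIndex Δx p = j := hp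
  simp only [hp, mul_comm]

lemma summable_weight (hlam : lam ∈ Ioo (0 : ℝ) 1) (hΔ : 0 < Δx) :
    Summable (weight c lam Δx) := by
  simpa using (hasSum_weight_mul (c := c) hlam hΔ (b := fun _ => 1) (B := 1) (by simp)).summable

/-- The total jump rate out of a cell, which is what the CFL condition of the explicit method has to
beat. -/
lemma tsum_weight_le (hc : 0 < c) (hlam : lam ∈ Ioo (0 : ℝ) 1) (hΔ : 0 < Δx) :
    ∑' j, weight c lam Δx j ≤ dConst c lam / Δx ^ lam := by
  have h := (hasSum_weight_mul (c := c) hlam hΔ (b := fun _ => 1) (B := 1) (by simp)).tsum_eq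
  simp only [mul_one, one_mul] at h
  rw [h]
  have hk := integrable_exitKer hlam hΔ
  have : IsFiniteMeasure (volume.restrict (cell Δx 0)) := ⟨by simp [volume_cell]⟩
  have h2 : ∫ p, exitKer lam Δx p ∂((volume.restrict (cell Δx 0)).prod volume)
      ≤ ∫ z, min Δx |z| * singKer lam z := by
    rw [integral_prod_symm _ hk]
    exact integral_mono hk.integral_prod_right (integrable_min_mul_singKer' hlam hΔ)
      fun z => integral_exitKer_le hΔ z
  calc _ ≤ c / Δx * ∫ z, min Δx |z| * singKer lam z := by gcongr
    _ = dConst c lam / Δx ^ lam := by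
      rw [integral_min_mul_singKer hΔ, dConst_eq c hlam, Real.rpow_neg hΔ.le]
      field_simp

/-- Jumps that stay inside the cell do not contribute, which removes the singularity of the
kernel. -/
lemma discFracLap_eq_integral (hlam : lam ∈ Ioo (0 : ℝ) 1) (hΔ : 0 < Δx) {V : ℤ → ℝ} {B : ℝ}
    (hV : ∀ i, |V i| ≤ B) (i : ℤ) :
    discFracLap c lam Δx V i = c / Δx * ∫ p, (V (i + jumpIndex Δx p) - V i) * exitKer lam Δx p
        ∂((volume.restrict (cell Δx 0)).prod volume) := by
  have hk := integrable_exitKer hlam hΔ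
  have : IsFiniteMeasure (volume.restrict (cell Δx 0)) := ⟨by simp [volume_cell]⟩
  have hi : Integrable (fun p => (V (i + jumpIndex Δx p) - V i) * exitKer lam Δx p)
      ((volume.restrict (cell Δx 0)).prod volume) :=
    hk.bdd_mul (c := B + B) ((measurable_of_countable fun j => V (i + j) - V i).comp
      (measurable_jumpIndex Δx)).aestronglyMeasurable
      (ae_of_all _ fun p => (abs_sub _ _).trans (add_le_add (hV _) (hV _)))
  have hfl : ∀ x, (x + i * Δx) / Δx = x / Δx + i := fun x => by field_simp
  rw [discFracLap, cellAverage_eq, integral_prod _ hi]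
  have e1 : ∫ x in cell Δx i, fracLap c lam (stepFun Δx V) x
      = ∫ x in cell Δx 0, fracLap c lam (stepFun Δx V) (x + i * Δx) := by
    rw [← integral_indicator (measurableSet_cell _), ← integral_indicator (measurableSet_cell _),
      ← integral_add_right_eq_self _ ((i : ℝ) * Δx)]
    congr 1; ext x
    have : x ∈ cell Δx 0 ↔ x + i * Δx ∈ cell Δx i := by
      rw [mem_cell_iff hΔ, mem_cell_iff hΔ, hfl, Int.floor_add_intCast]
      simp
    by_cases h : x ∈ cell Δx 0
    · rw [indicator_of_mem h, indicator_of_mem (this.1 h)]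
    · rw [indicator_of_notMem h, indicator_of_notMem (mt this.2 h)]
  rw [e1, div_eq_mul_one_div c, mul_comm c, mul_assoc]
  congr 1
  rw [← integral_const_mul]
  refine setIntegral_congr_fun (measurableSet_cell 0) fun x hx => ?_
  rw [fracLap_eq]
  congr 2
  ext z
  have h1 : stepFun Δx V (x + i * Δx) = V i := by
    rw [stepFun, hfl, Int.floor_add_intCast, (mem_cell_iff hΔ).1 hx, zero_add]
  have h2 : stepFun Δx V (x + i * Δx + z) = V (i + jumpIndex Δx (x, z)) := by
    rw [stepFun, add_right_comm, hfl, Int.floor_add_intCast, add_comm, jumpIndex]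
  rw [h1, h2]
  unfold exitKer
  split_ifs with h
  · simp [h]
  · rfl

/-- The discrete nonlocal operator is a weighted sum of differences, with nonnegative summable
weights. -/
lemma hasSum_discFracLap (hlam : lam ∈ Ioo (0 : ℝ) 1) (hΔ : 0 < Δx) {V : ℤ → ℝ}
    {B : ℝ} (hV : ∀ i, |V i| ≤ B) (i : ℤ) :
    HasSum (fun j => weight c lam Δx j * (V (i + j) - V i)) (discFracLap c lam Δx V i) := by
  rw [discFracLap_eq_integral hlam hΔ hV]
  exact hasSum_weight_mul hlam hΔ (b := fun j => V (i + j) - V i) (B := B + B)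
    fun j => (abs_sub _ _).trans (add_le_add (hV _) (hV _))

end Weights

/-! ### Contraction in `ℓ¹`: resolvents of jump operators and monotone fluxes -/

section Sequences

lemma summable_shift {e : ℤ → ℝ} (he : Summable e) (j : ℤ) : Summable fun i => e (i + j) :=
  (Equiv.addRight j).summable_iff.2 he

lemma tsum_shift (e : ℤ → ℝ) (j : ℤ) : ∑' i, e (i + j) = ∑' i, e i :=
  (Equiv.addRight j).tsum_eq e

/-- The operator `V ↦ ∑ⱼ pⱼ (V (i + j) - V i)` with jump weights `p`. -/
noncomputable def jumpOp (p : ℤ → ℝ) (V : ℤ → ℝ) (i : ℤ) : ℝ := ∑' j, p j * (V (i + j) - V i)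

variable {p : ℤ → ℝ} {V W : ℤ → ℝ} {B : ℝ}

lemma summable_weight_mul (hp0 : ∀ j, 0 ≤ p j) (hp : Summable p) (hV : ∀ i, |V i| ≤ B) :
    Summable fun j => p j * V j := by
  refine Summable.of_norm_bounded (hp.mul_right B) fun j => ?_
  rw [Real.norm_eq_abs, abs_mul, abs_of_nonneg (hp0 j)]
  exact mul_le_mul_of_nonneg_left (hV j) (hp0 j)

lemma jumpOp_eq (hp0 : ∀ j, 0 ≤ p j) (hp : Summable p) (hV : ∀ i, |V i| ≤ B) (i : ℤ) :
    jumpOp p V i = ∑' j, p j * V (i + j) - (∑' j, p j) * V i := by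
  have h1 := summable_weight_mul hp0 hp (V := fun j => V (i + j)) fun j => hV (i + j)
  rw [jumpOp, ← tsum_mul_right, ← h1.tsum_sub (hp.mul_right (V i))]
  simp only [mul_sub]

lemma jumpOp_sub (hp0 : ∀ j, 0 ≤ p j) (hp : Summable p) {B' : ℝ} (hV : ∀ i, |V i| ≤ B)
    (hW : ∀ i, |W i| ≤ B') (i : ℤ) :
    jumpOp p (fun i => V i - W i) i = jumpOp p V i - jumpOp p W i := by
  have h : ∀ {X : ℤ → ℝ} {b : ℝ}, (∀ i, |X i| ≤ b) →
      Summable fun j => p j * (X (i + j) - X i) := fun {X b} hX =>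
    summable_weight_mul hp0 hp (V := fun j => X (i + j) - X i) (B := b + b)
      fun j => (abs_sub _ _).trans (add_le_add (hX _) (hX _))
  rw [jumpOp, jumpOp, jumpOp, ← (h hV).tsum_sub (h hW)]
  congr 1; ext j; ring

/-- Mass is preserved by convolution with the weights. -/
lemma summable_weight_conv (hp0 : ∀ j, 0 ≤ p j) (hp : Summable p) {e : ℤ → ℝ}
    (he0 : ∀ i, 0 ≤ e i) (he : Summable e) :
    Summable (fun i => ∑' j, p j * e (i + j)) ∧
      ∑' i, ∑' j, p j * e (i + j) = (∑' j, p j) * ∑' i, e i := by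
  have h1 : Summable fun x : ℤ × ℤ => p x.1 * e x.2 :=
    hp.mul_of_nonneg he hp0 he0
  let φ : ℤ × ℤ ≃ ℤ × ℤ :=
    ⟨fun x => (x.2, x.1 + x.2), fun x => (x.2 - x.1, x.1), fun x => by simp, fun x => by simp⟩
  have h2 : Summable fun x : ℤ × ℤ => p x.2 * e (x.1 + x.2) := φ.summable_iff.2 h1
  refine ⟨h2.prod, ?_⟩
  rw [← Summable.tsum_comm (f := fun i j => p j * e (i + j)) h2, ← tsum_mul_right]
  congr 1; ext j
  rw [tsum_mul_left, tsum_shift]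

lemma abs_le_tsum_abs {e : ℤ → ℝ} (he : Summable fun i => |e i|) (i : ℤ) :
    |e i| ≤ ∑' i, |e i| :=
  he.le_tsum i fun _ _ => abs_nonneg _

lemma abs_tsum_weight_mul_le (hp0 : ∀ j, 0 ≤ p j) (hp : Summable p) (hV : ∀ i, |V i| ≤ B)
    (i : ℤ) : |∑' j, p j * V (i + j)| ≤ ∑' j, p j * |V (i + j)| := by
  have h2 := summable_weight_mul hp0 hp (V := fun j => |V (i + j)|) (B := B)
    (fun j => by rw [abs_abs]; exact hV _)
  have := norm_tsum_le_tsum_norm (f := fun j => p j * V (i + j)) (by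
    simpa only [Real.norm_eq_abs, abs_mul, abs_of_nonneg (hp0 _)] using h2)
  simpa only [Real.norm_eq_abs, abs_mul, abs_of_nonneg (hp0 _)] using this

/-- Resolvent estimate: a bounded solution of `D - τ · jumpOp p D = h` with summable right-hand
side is summable, with no larger `ℓ¹` norm than `h`. The inequality
`(1 + τ a)|Dᵢ| ≤ |hᵢ| + τ ∑ⱼ pⱼ |Dᵢ₊ⱼ|` is iterated, which gains a factor `q = τ a / (1 + τ a) < 1`
in front of the `ℓ^∞` bound in each round. -/
lemma tsum_abs_le_of_sub_jumpOp (hp0 : ∀ j, 0 ≤ p j) (hp : Summable p) {τ : ℝ} (hτ : 0 ≤ τ)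
    {D h : ℤ → ℝ} (hD : ∀ i, |D i| ≤ B) (hh : Summable fun i => |h i|)
    (heq : ∀ i, D i - τ * jumpOp p D i = h i) :
    (Summable fun i => |D i|) ∧ ∑' i, |D i| ≤ ∑' i, |h i| := by
  set a := ∑' j, p j with ha
  have ha0 : 0 ≤ a := tsum_nonneg hp0
  have hB : 0 ≤ B := (abs_nonneg _).trans (hD 0)
  have hden : 0 < 1 + τ * a := by positivity
  have hpt : ∀ i, (1 + τ * a) * |D i| ≤ |h i| + τ * ∑' j, p j * |D (i + j)| := by
    intro i
    have h1 : (1 + τ * a) * D i = h i + τ * ∑' j, p j * D (i + j) := by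
      rw [← heq i, jumpOp_eq hp0 hp hD]; ring
    calc (1 + τ * a) * |D i| = |(1 + τ * a) * D i| := by rw [abs_mul, abs_of_pos hden]
      _ ≤ |h i| + |τ * ∑' j, p j * D (i + j)| := by rw [h1]; exact abs_add_le _ _
      _ ≤ _ := by
        rw [abs_mul, abs_of_nonneg hτ]
        gcongr
        exact abs_tsum_weight_mul_le hp0 hp hD i
  set q := τ * a / (1 + τ * a) with hq
  have hq0 : 0 ≤ q := by positivity
  have hq1 : q < 1 := by rw [hq, div_lt_one hden]; linarith
  -- `H` collects the contributions of `h` after `K` rounds; its mass never exceeds that of `h`.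
  have iter : ∀ K : ℕ, ∃ H : ℤ → ℝ, (∀ i, 0 ≤ H i) ∧ Summable H ∧ ∑' i, H i ≤ ∑' i, |h i| ∧
      ∀ i, |D i| ≤ H i + q ^ K * B := by
    intro K
    induction K with
    | zero =>
      refine ⟨fun _ => 0, fun _ => le_rfl, summable_zero, ?_, fun i => by simpa using hD i⟩
      rw [tsum_zero]; exact tsum_nonneg fun i => abs_nonneg _
    | succ K ih =>
      obtain ⟨H, H0, Hs, Hle, hDH⟩ := ih
      obtain ⟨c1, c2⟩ := summable_weight_conv hp0 hp H0 Hs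
      refine ⟨fun i => (|h i| + τ * ∑' j, p j * H (i + j)) / (1 + τ * a), fun i => ?_,
        (hh.add (c1.mul_left τ)).div_const _, ?_, fun i => ?_⟩
      · have : 0 ≤ ∑' j, p j * H (i + j) := tsum_nonneg fun j => mul_nonneg (hp0 j) (H0 _)
        positivity
      · rw [tsum_div_const, hh.tsum_add (c1.mul_left τ), tsum_mul_left, c2, div_le_iff₀ hden]
        have : τ * (a * ∑' i, H i) ≤ τ * (a * ∑' i, |h i|) := by gcongr
        linarith
      · have hHs : Summable fun j => p j * H (i + j) :=
          summable_weight_mul hp0 hp (V := fun j => H (i + j)) (B := ∑' i, H i)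
            fun j => by
              rw [abs_of_nonneg (H0 _)]; exact Hs.le_tsum _ fun _ _ => H0 _
        have h3 : ∑' j, p j * |D (i + j)| ≤ ∑' j, p j * H (i + j) + a * (q ^ K * B) := by
          rw [ha, ← tsum_mul_right, ← hHs.tsum_add (hp.mul_right _)]
          refine Summable.tsum_le_tsum (fun j => ?_) ?_ (hHs.add (hp.mul_right _))
          · rw [← mul_add]; exact mul_le_mul_of_nonneg_left (hDH _) (hp0 j)
          · exact summable_weight_mul hp0 hp (V := fun j => |D (i + j)|) (B := B)
              (fun j => by rw [abs_abs]; exact hD _)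
        have h4 : q ^ (K + 1) * B = τ * (a * (q ^ K * B)) / (1 + τ * a) := by
          rw [pow_succ, hq]; ring
        rw [h4, ← add_div, le_div_iff₀ hden, mul_comm]
        refine (hpt i).trans ?_
        have := mul_le_mul_of_nonneg_left h3 hτ
        linarith
  -- On a finite set the constant term disappears as `K → ∞`.
  have hfin : ∀ s : Finset ℤ, ∑ i ∈ s, |D i| ≤ ∑' i, |h i| := by
    intro s
    have hlim : Tendsto (fun K : ℕ => ∑' i, |h i| + s.card * (q ^ K * B)) atTop
        (𝓝 (∑' i, |h i| + s.card * (0 * B))) :=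
      (((tendsto_pow_atTop_nhds_zero_of_lt_one hq0 hq1).mul_const B).const_mul _).const_add _
    rw [zero_mul, mul_zero, add_zero] at hlim
    refine ge_of_tendsto' hlim fun K => ?_
    obtain ⟨H, H0, Hs, Hle, hDH⟩ := iter K
    calc ∑ i ∈ s, |D i| ≤ ∑ i ∈ s, (H i + q ^ K * B) := Finset.sum_le_sum fun i _ => hDH i
      _ = ∑ i ∈ s, H i + s.card * (q ^ K * B) := by
        rw [Finset.sum_add_distrib, Finset.sum_const, nsmul_eq_mul]
      _ ≤ _ := by
        gcongr
        exact (Hs.sum_le_tsum s fun i _ => H0 i).trans Hle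
  exact ⟨summable_of_sum_le (fun i => abs_nonneg _) hfin,
    Real.tsum_le_of_sum_le (fun i => abs_nonneg _) hfin⟩

end Sequences

section Flux

variable {f : ℝ → ℝ} {F : ℝ → ℝ → ℝ} {F₁ F₂ : NNReal}

/-- The conservative update `Vᵢ - r (F(Vᵢ, Vᵢ₊₁) - F(Vᵢ₋₁, Vᵢ))` with mesh ratio `r`. -/
def convStep (F : ℝ → ℝ → ℝ) (r : ℝ) (V : ℤ → ℝ) (i : ℤ) : ℝ :=
  V i - r * (F (V i) (V (i + 1)) - F (V (i - 1)) (V i))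

/-- Since `α` and `β` are increments of monotone functions across `D`, subtracting them from `D`
only removes mass. -/
lemma abs_sub_sub_eq {D α β m r : ℝ} (hr : 0 ≤ r) (F₁ F₂ : ℝ)
    (hcfl : r * (F₁ + F₂) + m ≤ 1) (hα : |α| ≤ F₁ * |D|) (hβ : |β| ≤ F₂ * |D|)
    (hpos : 0 ≤ D → 0 ≤ α ∧ 0 ≤ β) (hneg : D ≤ 0 → α ≤ 0 ∧ β ≤ 0) :
    |(1 - m) * D - r * α - r * β| = (1 - m) * |D| - r * |α| - r * |β| := by
  have hD := abs_nonneg D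
  have h1 : 0 ≤ (1 - m) * |D| - r * |α| - r * |β| := by
    nlinarith [mul_le_mul_of_nonneg_left hα hr, mul_le_mul_of_nonneg_left hβ hr]
  rcases le_total 0 D with h | h
  · obtain ⟨ha, hb⟩ := hpos h
    rw [abs_of_nonneg h, abs_of_nonneg ha, abs_of_nonneg hb] at h1 ⊢
    exact abs_of_nonneg h1
  · obtain ⟨ha, hb⟩ := hneg h
    rw [abs_of_nonpos h, abs_of_nonpos ha, abs_of_nonpos hb] at h1 ⊢
    rw [abs_of_nonpos (by linarith)]; ring

lemma IsNumericalFlux.abs_fst_le (hF : IsNumericalFlux f F F₁ F₂) (a a' b : ℝ) :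
    |F a b - F a' b| ≤ F₁ * |a - a'| := by
  simpa [Real.dist_eq] using (hF.lipschitz_fst b).dist_le_mul a a'

lemma IsNumericalFlux.abs_snd_le (hF : IsNumericalFlux f F F₁ F₂) (a b b' : ℝ) :
    |F a b - F a b'| ≤ F₂ * |b - b'| := by
  simpa [Real.dist_eq] using (hF.lipschitz_snd a).dist_le_mul b b'

/-- Crandall–Tartar type bound for the convective update, with the share `m` of the diagonal set
aside for an explicit jump term. The four flux increments telescope under summation over `i`. -/
lemma IsNumericalFlux.abs_convStep_sub_le (hF : IsNumericalFlux f F F₁ F₂) {r m : ℝ} (hr : 0 ≤ r)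
    (hcfl : r * (F₁ + F₂) + m ≤ 1) (U W : ℤ → ℝ) (i : ℤ) :
    |convStep F r U i - convStep F r W i - m * (U i - W i)| ≤ (1 - m) * |U i - W i|
      - r * |F (U i) (U (i + 1)) - F (W i) (U (i + 1))|
      - r * |F (W (i - 1)) (U i) - F (W (i - 1)) (W i)|
      + r * |F (W i) (U (i + 1)) - F (W i) (W (i + 1))|
      + r * |F (U (i - 1)) (U i) - F (W (i - 1)) (U i)| := by
  have h := abs_sub_sub_eq (D := U i - W i) (α := F (U i) (U (i + 1)) - F (W i) (U (i + 1)))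
    (β := F (W (i - 1)) (W i) - F (W (i - 1)) (U i)) (m := m) hr F₁ F₂ hcfl
    (hF.abs_fst_le _ _ _) (by rw [abs_sub_comm]; exact hF.abs_snd_le _ _ _)
    (fun hD => ⟨sub_nonneg.2 (hF.mono_fst _ (by linarith)),
      sub_nonneg.2 (hF.anti_snd _ (by linarith))⟩)
    (fun hD => ⟨sub_nonpos.2 (hF.mono_fst _ (by linarith)),
      sub_nonpos.2 (hF.anti_snd _ (by linarith))⟩)
  rw [abs_sub_comm (F (W (i - 1)) (W i))] at h
  have e : convStep F r U i - convStep F r W i - m * (U i - W i)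
      = ((1 - m) * (U i - W i) - r * (F (U i) (U (i + 1)) - F (W i) (U (i + 1)))
          - r * (F (W (i - 1)) (W i) - F (W (i - 1)) (U i)))
        + (-(r * (F (W i) (U (i + 1)) - F (W i) (W (i + 1))))
          + r * (F (U (i - 1)) (U i) - F (W (i - 1)) (U i))) := by
    unfold convStep; ring
  rw [e]
  refine (abs_add_le _ _).trans ?_
  rw [h]
  have h2 := abs_add_le (-(r * (F (W i) (U (i + 1)) - F (W i) (W (i + 1)))))
    (r * (F (U (i - 1)) (U i) - F (W (i - 1)) (U i)))
  rw [abs_neg, abs_mul, abs_mul, abs_of_nonneg hr] at h2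
  linarith

/-- The numerical entropy flux belonging to the entropy `|v - k|`. -/
def numEntropyFlux (F : ℝ → ℝ → ℝ) (k a b : ℝ) : ℝ := |F a b - F k b| - |F k b - F k k|

/-- Comparison with a constant state, which is a fixed point of the convective update. -/
lemma IsNumericalFlux.abs_convStep_sub_const_le (hF : IsNumericalFlux f F F₁ F₂) {r : ℝ}
    (hr : 0 ≤ r) (hcfl : r * (F₁ + F₂) ≤ 1) (V : ℤ → ℝ) (k : ℝ) (i : ℤ) :
    |convStep F r V i - k| ≤ |V i - k| - r * (numEntropyFlux F k (V i) (V (i + 1))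
      - numEntropyFlux F k (V (i - 1)) (V i)) := by
  have h := hF.abs_convStep_sub_le hr (m := 0) (by linarith) V (fun _ => k) i
  have e : convStep F r (fun _ => k) i = k := by simp [convStep]
  rw [e] at h
  simp only [zero_mul, sub_zero, one_mul] at h
  refine h.trans (le_of_eq ?_)
  unfold numEntropyFlux
  ring

/-- `ℓ¹` contraction of the conservative update, possibly with an explicit jump term whose
strength `τ` is admitted by the CFL condition. -/
lemma IsNumericalFlux.tsum_abs_convStep_sub_le (hF : IsNumericalFlux f F F₁ F₂) {r τ : ℝ}
    (hr : 0 ≤ r) (hτ : 0 ≤ τ) {p : ℤ → ℝ} (hp0 : ∀ j, 0 ≤ p j) (hp : Summable p)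
    (hcfl : r * (F₁ + F₂) + τ * ∑' j, p j ≤ 1) {U W : ℤ → ℝ}
    (hD : Summable fun i => |U i - W i|) :
    (Summable fun i => |convStep F r U i - convStep F r W i
        + τ * jumpOp p (fun i => U i - W i) i|) ∧
      ∑' i, |convStep F r U i - convStep F r W i + τ * jumpOp p (fun i => U i - W i) i|
        ≤ ∑' i, |U i - W i| := by
  set a := ∑' j, p j with ha
  set A : ℤ → ℝ := fun i => |F (U i) (U (i + 1)) - F (W i) (U (i + 1))| with hA
  set b : ℤ → ℝ := fun i => |F (W (i - 1)) (U i) - F (W (i - 1)) (W i)| with hb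
  have hAs : Summable A := Summable.of_nonneg_of_le (fun i => abs_nonneg _)
    (fun i => hF.abs_fst_le _ _ _) (hD.mul_left _)
  have hbs : Summable b := Summable.of_nonneg_of_le (fun i => abs_nonneg _)
    (fun i => hF.abs_snd_le _ _ _) (hD.mul_left _)
  have hA' : Summable fun i => A (i + -1) := summable_shift hAs (-1)
  have hb' : Summable fun i => b (i + 1) := summable_shift hbs 1
  obtain ⟨hcs, hct⟩ := summable_weight_conv hp0 hp (fun i => abs_nonneg (U i - W i)) hD
  have hDb : ∀ i, |U i - W i| ≤ ∑' i, |U i - W i| := fun i =>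
    abs_le_tsum_abs (e := fun i => U i - W i) hD i
  have hpt : ∀ i, |convStep F r U i - convStep F r W i + τ * jumpOp p (fun i => U i - W i) i|
      ≤ (1 - τ * a) * |U i - W i| - r * A i - r * b i + r * b (i + 1) + r * A (i + -1)
        + τ * ∑' j, p j * |U (i + j) - W (i + j)| := by
    intro i
    have h1 := hF.abs_convStep_sub_le hr hcfl U W i
    have h2 := abs_tsum_weight_mul_le hp0 hp hDb i
    rw [jumpOp_eq hp0 hp hDb i]
    have e : convStep F r U i - convStep F r W i
        + τ * (∑' j, p j * (U (i + j) - W (i + j)) - (∑' j, p j) * (U i - W i))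
        = (convStep F r U i - convStep F r W i - τ * a * (U i - W i))
          + τ * ∑' j, p j * (U (i + j) - W (i + j)) := by rw [ha]; ring
    rw [e]
    refine (abs_add_le _ _).trans (add_le_add ?_ ?_)
    · simp only [hA, hb, add_sub_cancel_right]
      have e2 : i + -1 + 1 = i := by ring
      rw [e2, ← sub_eq_add_neg]
      exact h1
    · rw [abs_mul, abs_of_nonneg hτ]
      exact mul_le_mul_of_nonneg_left h2 hτ
  have s1 := (((hD.mul_left (1 - τ * a)).sub (hAs.mul_left r)).sub (hbs.mul_left r)).add
    (hb'.mul_left r)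
  have s2 := (s1.add (hA'.mul_left r)).add (hcs.mul_left τ)
  have hs := Summable.of_nonneg_of_le (fun i => abs_nonneg _) hpt s2
  refine ⟨hs, (hs.tsum_le_tsum hpt s2).trans (le_of_eq ?_)⟩
  rw [(s1.add (hA'.mul_left r)).tsum_add (hcs.mul_left τ), s1.tsum_add (hA'.mul_left r),
    (((hD.mul_left (1 - τ * a)).sub (hAs.mul_left r)).sub (hbs.mul_left r)).tsum_add
      (hb'.mul_left r),
    ((hD.mul_left (1 - τ * a)).sub (hAs.mul_left r)).tsum_sub (hbs.mul_left r),
    (hD.mul_left (1 - τ * a)).tsum_sub (hAs.mul_left r)]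
  simp only [tsum_mul_left, hct, tsum_shift]
  ring

end Flux

/-! ### A priori bounds for the two schemes -/

/-- What the error analysis uses of a scheme: uniform `L¹`, total variation and time continuity
bounds, and the implicit-explicit update up to a residual of `L¹` size `ρ`. -/
structure HasSchemeBounds (c lam : ℝ) (F : ℝ → ℝ → ℝ) (Δx Δt : ℝ) (N : ℕ) (U : ℕ → ℤ → ℝ)
    (C M L ρ : ℝ) : Prop where
  summable : ∀ n ≤ N, Summable fun i => |U n i|
  norm_le : ∀ n ≤ N, Δx * ∑' i, |U n i| ≤ M
  variation_le : ∀ n ≤ N, ∑' i, |U n (i + 1) - U n i| ≤ C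
  time_le : ∀ n < N, Δx * ∑' i, |U (n + 1) i - U n i| ≤ Δt * L
  step : ∀ n < N, ∃ r : ℤ → ℝ, (Summable fun i => |r i|) ∧ Δx * ∑' i, |r i| ≤ ρ ∧
    ∀ i, U (n + 1) i = convStep F (Δt / Δx) (U n) i + Δt * discFracLap c lam Δx (U (n + 1)) i
      + Δt * r i

section Scheme

variable {c lam Δx Δt : ℝ} {f : ℝ → ℝ} {F : ℝ → ℝ → ℝ} {F₁ F₂ : NNReal} {C M : ℝ}

lemma discFracLap_eq_jumpOp (hlam : lam ∈ Ioo (0 : ℝ) 1) (hΔ : 0 < Δx) {V : ℤ → ℝ}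
    {B : ℝ} (hV : ∀ i, |V i| ≤ B) (i : ℤ) :
    discFracLap c lam Δx V i = jumpOp (weight c lam Δx) V i :=
  (hasSum_discFracLap hlam hΔ hV i).tsum_eq.symm

lemma discFracLap_sub (hc : 0 < c) (hlam : lam ∈ Ioo (0 : ℝ) 1) (hΔ : 0 < Δx) {V W : ℤ → ℝ}
    {B B' : ℝ} (hV : ∀ i, |V i| ≤ B) (hW : ∀ i, |W i| ≤ B') (i : ℤ) :
    jumpOp (weight c lam Δx) (fun i => V i - W i) i
      = discFracLap c lam Δx V i - discFracLap c lam Δx W i := by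
  rw [jumpOp_sub (weight_nonneg hc hΔ) (summable_weight hlam hΔ) hV hW,
    discFracLap_eq_jumpOp hlam hΔ hV, discFracLap_eq_jumpOp hlam hΔ hW]

/-- The `ℓ¹` bound is inherited from the `L¹` bound of the nonlocal operator, as averaging over
cells does not increase it; in contrast to `tsum_abs_jumpOp_weight_le` it does not degenerate as
`Δx → 0`. -/
lemma summable_discFracLap (hc : 0 < c) (hlam : lam ∈ Ioo (0 : ℝ) 1) (hΔ : 0 < Δx) {V : ℤ → ℝ}
    (hV : L1BVWith C M (stepFun Δx V)) :
    (Summable fun i => |discFracLap c lam Δx V i|) ∧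
      Δx * ∑' i, |discFracLap c lam Δx V i| ≤ (C + 2 * M) * dConst c lam := by
  obtain ⟨h1, h2⟩ := summable_cellAverage hΔ (hV.integrable_fracLap hlam c)
  exact ⟨h1, h2.trans (hV.integral_abs_fracLap_le hlam hc)⟩

/-- The discrete operator has `ℓ¹` operator norm of order `Δx ^ (-lam)`. -/
lemma tsum_abs_jumpOp_weight_le (hc : 0 < c) (hlam : lam ∈ Ioo (0 : ℝ) 1) (hΔ : 0 < Δx)
    {D : ℤ → ℝ} (hD : Summable fun i => |D i|) :
    (Summable fun i => |jumpOp (weight c lam Δx) D i|) ∧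
      ∑' i, |jumpOp (weight c lam Δx) D i| ≤ 2 * (dConst c lam / Δx ^ lam) * ∑' i, |D i| := by
  have hp0 := weight_nonneg (lam := lam) hc hΔ
  have hp := summable_weight (c := c) hlam hΔ
  have hDb := abs_le_tsum_abs hD
  obtain ⟨hcs, hct⟩ := summable_weight_conv hp0 hp (fun i => abs_nonneg (D i)) hD
  have hpt : ∀ i, |jumpOp (weight c lam Δx) D i|
      ≤ ∑' j, weight c lam Δx j * |D (i + j)| + (∑' j, weight c lam Δx j) * |D i| := fun i => by
    rw [jumpOp_eq hp0 hp hDb]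
    refine (abs_sub _ _).trans (add_le_add (abs_tsum_weight_mul_le hp0 hp hDb i) ?_)
    rw [abs_mul, abs_of_nonneg (tsum_nonneg hp0)]
  have hs2 := hcs.add (hD.mul_left (∑' j, weight c lam Δx j))
  have hs := Summable.of_nonneg_of_le (fun i => abs_nonneg _) hpt hs2
  refine ⟨hs, (hs.tsum_le_tsum hpt hs2).trans ?_⟩
  rw [hcs.tsum_add (hD.mul_left _), hct, tsum_mul_left]
  have h0 : 0 ≤ ∑' i, |D i| := tsum_nonneg fun i => abs_nonneg _
  have := mul_le_mul_of_nonneg_right (tsum_weight_le (lam := lam) hc hlam hΔ) h0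
  linarith

/-- One convective step moves the solution by at most the mesh ratio times its variation. -/
lemma IsNumericalFlux.tsum_abs_convStep_sub_self_le (hF : IsNumericalFlux f F F₁ F₂) {r : ℝ}
    (hr : 0 ≤ r) {V : ℤ → ℝ} (hV : Summable fun i => |V (i + 1) - V i|) :
    (Summable fun i => |convStep F r V i - V i|) ∧
      ∑' i, |convStep F r V i - V i| ≤ r * (F₁ + F₂) * ∑' i, |V (i + 1) - V i| := by
  have hV' : Summable fun i => |V (i + -1 + 1) - V (i + -1)| :=
    summable_shift (e := fun i => |V (i + 1) - V i|) hV (-1)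
  have hpt : ∀ i, |convStep F r V i - V i|
      ≤ r * F₂ * |V (i + 1) - V i| + r * F₁ * |V (i + -1 + 1) - V (i + -1)| := by
    intro i
    have e : convStep F r V i - V i = -(r * (F (V i) (V (i + 1)) - F (V i) (V i)))
        + -(r * (F (V i) (V i) - F (V (i - 1)) (V i))) := by unfold convStep; ring
    rw [e]
    refine (abs_add_le _ _).trans ?_
    rw [abs_neg, abs_neg, abs_mul, abs_mul, abs_of_nonneg hr, mul_assoc, mul_assoc]
    have e2 : i + -1 + 1 = i := by ring
    rw [e2, ← sub_eq_add_neg]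
    gcongr
    · exact hF.abs_snd_le _ _ _
    · exact hF.abs_fst_le _ _ _
  have hs2 := (hV.mul_left (r * F₂)).add (hV'.mul_left (r * F₁))
  have hs := Summable.of_nonneg_of_le (fun i => abs_nonneg _) hpt hs2
  refine ⟨hs, (hs.tsum_le_tsum hpt hs2).trans (le_of_eq ?_)⟩
  rw [(hV.mul_left _).tsum_add (hV'.mul_left _), tsum_mul_left, tsum_mul_left,
    tsum_shift (fun i => |V (i + 1) - V i|)]
  ring

lemma convStep_eq (F : ℝ → ℝ → ℝ) (V : ℤ → ℝ) (i : ℤ) :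
    V i - Δt * fluxDiff F Δx V i = convStep F (Δt / Δx) V i := by
  unfold fluxDiff convStep; ring

lemma convStep_zero (F : ℝ → ℝ → ℝ) (r : ℝ) (i : ℤ) : convStep F r (fun _ => 0) i = 0 := by
  simp [convStep]

lemma convStep_shift (F : ℝ → ℝ → ℝ) (r : ℝ) (V : ℤ → ℝ) (i : ℤ) :
    convStep F r (fun i => V (i + 1)) i = convStep F r V (i + 1) := by
  simp only [convStep]
  rw [show i - 1 + 1 = i + 1 - 1 by ring]

lemma discFracLap_shift (hlam : lam ∈ Ioo (0 : ℝ) 1) (hΔ : 0 < Δx)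
    {V : ℤ → ℝ} {B : ℝ} (hV : ∀ i, |V i| ≤ B) (i : ℤ) :
    discFracLap c lam Δx (fun i => V (i + 1)) i = discFracLap c lam Δx V (i + 1) := by
  rw [discFracLap_eq_jumpOp hlam hΔ hV, discFracLap_eq_jumpOp hlam hΔ fun i => hV (i + 1)]
  simp only [jumpOp, add_right_comm]

/-- The `L¹` bound compares with the zero state, the variation bound with the translate by one cell,
and the time continuity bound compares `U^{n+1}` with `U^n` in the implicit equation. Boundedness
of `U^{n+1}` enters through the resolvent estimate. -/
lemma IsImplicitExplicitSolution.hasSchemeBounds (hc : 0 < c) (hlam : lam ∈ Ioo (0 : ℝ) 1)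
    (hF : IsNumericalFlux f F F₁ F₂) {u₀ : ℝ → ℝ} (hu₀ : L1BVWith C M u₀) (hΔ : 0 < Δx)
    (hΔt : 0 < Δt) (hcfl : ((F₁ : ℝ) + F₂) * (Δt / Δx) ≤ 1) {N : ℕ} {U : ℕ → ℤ → ℝ}
    (hU : IsImplicitExplicitSolution c lam F u₀ Δx Δt N U) :
    HasSchemeBounds c lam F Δx Δt N U C M ((F₁ + F₂) * C + (C + 2 * M) * dConst c lam) 0 := by
  have hr : 0 ≤ Δt / Δx := by positivity
  have hp0 := weight_nonneg (lam := lam) hc hΔ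
  have hp := summable_weight (c := c) hlam hΔ
  have hstep : ∀ n < N, ∀ i, U (n + 1) i
      = convStep F (Δt / Δx) (U n) i + Δt * discFracLap c lam Δx (U (n + 1)) i := fun n hn i => by
    rw [← convStep_eq]; exact hU.step n hn i
  have hcontr : ∀ {V W : ℤ → ℝ}, (Summable fun i => |V i - W i|) →
      (Summable fun i => |convStep F (Δt / Δx) V i - convStep F (Δt / Δx) W i|) ∧
      ∑' i, |convStep F (Δt / Δx) V i - convStep F (Δt / Δx) W i| ≤ ∑' i, |V i - W i| := by
    intro V W hVW
    have := hF.tsum_abs_convStep_sub_le hr (le_refl (0 : ℝ)) hp0 hp (by linarith) hVW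
    simpa only [zero_mul, add_zero] using this
  have main : ∀ n ≤ N, (Summable fun i => |U n i|) ∧ Δx * ∑' i, |U n i| ≤ M ∧
      ∑' i, |U n (i + 1) - U n i| ≤ C := by
    intro n
    induction n with
    | zero =>
      intro _
      have h0 : U 0 = cellAverage Δx u₀ := funext hU.init
      rw [h0]
      exact ⟨(summable_cellAverage hΔ hu₀.int).1,
        (summable_cellAverage hΔ hu₀.int).2.trans hu₀.norm_le,
        tsum_abs_cellAverage_diff_le hΔ hu₀⟩
    | succ n ih =>
      intro hn
      obtain ⟨hs, hM, hC⟩ := ih (by omega)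
      obtain ⟨B, hB⟩ := hU.bounded (n + 1) hn
      -- comparison with the zero state
      have c1 := hcontr (V := U n) (W := fun _ => 0) (by simpa using hs)
      simp only [convStep_zero, sub_zero] at c1
      have e1 := tsum_abs_le_of_sub_jumpOp hp0 hp hΔt.le hB c1.1 fun i => by
        rw [← discFracLap_eq_jumpOp hlam hΔ hB, hstep n (by omega) i]; ring
      -- comparison with the translate by one cell
      have c2 := hcontr (V := fun i => U n (i + 1)) (W := U n) (summable_diff hs)
      simp only [convStep_shift] at c2
      have e2 := tsum_abs_le_of_sub_jumpOp hp0 hp hΔt.le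
        (D := fun i => U (n + 1) (i + 1) - U (n + 1) i) (B := B + B)
        (fun i => (abs_sub _ _).trans (add_le_add (hB _) (hB _))) c2.1 fun i => by
          rw [discFracLap_sub hc hlam hΔ (V := fun i => U (n + 1) (i + 1)) (fun i => hB (i + 1)) hB,
            discFracLap_shift hlam hΔ hB, hstep n (by omega) i, hstep n (by omega) (i + 1)]
          ring
      exact ⟨e1.1, (mul_le_mul_of_nonneg_left (e1.2.trans c1.2) hΔ.le).trans hM,
        (e2.2.trans c2.2).trans hC⟩
  refine ⟨fun n hn => (main n hn).1, fun n hn => (main n hn).2.1, fun n hn => (main n hn).2.2,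
    fun n hn => ?_, fun n hn => ⟨fun _ => 0, by simp, by simp, fun i => ?_⟩⟩
  · obtain ⟨hs, hM, hC⟩ := main n hn.le
    obtain ⟨g1, g2⟩ := summable_discFracLap hc hlam hΔ (l1BVWith_stepFun hΔ hs hC hM)
    obtain ⟨k1, k2⟩ := hF.tsum_abs_convStep_sub_self_le hr (summable_diff hs)
    have hB := abs_le_tsum_abs hs
    have hB' := abs_le_tsum_abs (main (n + 1) hn).1
    have ht : ∀ i, |convStep F (Δt / Δx) (U n) i - U n i + Δt * discFracLap c lam Δx (U n) i|
        ≤ |convStep F (Δt / Δx) (U n) i - U n i| + Δt * |discFracLap c lam Δx (U n) i| := by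
      intro i
      refine (abs_add_le _ _).trans ?_
      rw [abs_mul, abs_of_pos hΔt]
    have hsum := Summable.of_nonneg_of_le (fun i => abs_nonneg _) ht (k1.add (g1.mul_left Δt))
    have e := tsum_abs_le_of_sub_jumpOp hp0 hp hΔt.le (D := fun i => U (n + 1) i - U n i)
      (fun i => (abs_sub _ _).trans (add_le_add (hB' _) (hB _))) hsum fun i => by
        rw [discFracLap_sub hc hlam hΔ hB' hB, hstep n hn i]; ring
    calc Δx * ∑' i, |U (n + 1) i - U n i|
        ≤ Δx * (Δt / Δx * (F₁ + F₂) * C + Δt * ∑' i, |discFracLap c lam Δx (U n) i|) := by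
          refine mul_le_mul_of_nonneg_left ?_ hΔ.le
          refine e.2.trans ((hsum.tsum_le_tsum ht (k1.add (g1.mul_left Δt))).trans ?_)
          rw [k1.tsum_add (g1.mul_left Δt), tsum_mul_left]
          refine add_le_add (k2.trans ?_) le_rfl
          gcongr
      _ = Δt * ((F₁ + F₂) * C + Δx * ∑' i, |discFracLap c lam Δx (U n) i|) := by
          field_simp
      _ ≤ _ := by gcongr
  · rw [mul_zero, add_zero]; exact hstep n hn i

/-- The explicit scheme is viewed as the implicit-explicit one with residual `g⟨U^n - U^{n+1}⟩`,
whose size is the operator norm `2 d_λ Δx^(-lam)` times the time continuity bound. -/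
lemma IsExplicitSolution.hasSchemeBounds (hc : 0 < c) (hlam : lam ∈ Ioo (0 : ℝ) 1)
    (hF : IsNumericalFlux f F F₁ F₂) {u₀ : ℝ → ℝ} (hu₀ : L1BVWith C M u₀) (hΔ : 0 < Δx)
    (hΔt : 0 < Δt)
    (hcfl : ((F₁ : ℝ) + F₂) * (Δt / Δx) + dConst c lam * (Δt / Δx ^ lam) ≤ 1)
    {N : ℕ} {U : ℕ → ℤ → ℝ} (hU : IsExplicitSolution c lam F u₀ Δx Δt N U) :
    HasSchemeBounds c lam F Δx Δt N U C M ((F₁ + F₂) * C + (C + 2 * M) * dConst c lam)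
      (2 * (dConst c lam / Δx ^ lam)
        * (Δt * ((F₁ + F₂) * C + (C + 2 * M) * dConst c lam))) := by
  have hr : 0 ≤ Δt / Δx := by positivity
  have hp0 := weight_nonneg (lam := lam) hc hΔ
  have hp := summable_weight (c := c) hlam hΔ
  have hd := dConst_nonneg (lam := lam) hc
  have hcfl' : Δt / Δx * (F₁ + F₂) + Δt * ∑' j, weight c lam Δx j ≤ 1 := by
    have := mul_le_mul_of_nonneg_left (tsum_weight_le (lam := lam) hc hlam hΔ) hΔt.le
    have e : dConst c lam * (Δt / Δx ^ lam) = Δt * (dConst c lam / Δx ^ lam) := by ring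
    linarith
  have hstep : ∀ n < N, ∀ i, U (n + 1) i
      = convStep F (Δt / Δx) (U n) i + Δt * discFracLap c lam Δx (U n) i := fun n hn i => by
    rw [← convStep_eq]; exact hU.step n hn i
  have main : ∀ n ≤ N, (Summable fun i => |U n i|) ∧ Δx * ∑' i, |U n i| ≤ M ∧
      ∑' i, |U n (i + 1) - U n i| ≤ C := by
    intro n
    induction n with
    | zero =>
      intro _
      have h0 : U 0 = cellAverage Δx u₀ := funext hU.init
      rw [h0]
      exact ⟨(summable_cellAverage hΔ hu₀.int).1,
        (summable_cellAverage hΔ hu₀.int).2.trans hu₀.norm_le,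
        tsum_abs_cellAverage_diff_le hΔ hu₀⟩
    | succ n ih =>
      intro hn
      obtain ⟨hs, hM, hC⟩ := ih (by omega)
      have hB := abs_le_tsum_abs hs
      -- comparison with the zero state
      have e1 := hF.tsum_abs_convStep_sub_le hr hΔt.le hp0 hp hcfl' (U := U n) (W := fun _ => 0)
        (by simpa using hs)
      simp only [convStep_zero, sub_zero, ← discFracLap_eq_jumpOp hlam hΔ hB,
        ← hstep n (show n < N by omega)] at e1
      -- comparison with the translate by one cell
      have e2 := hF.tsum_abs_convStep_sub_le hr hΔt.le hp0 hp hcfl'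
        (U := fun i => U n (i + 1)) (W := U n) (summable_diff hs)
      have e3 : ∀ i, convStep F (Δt / Δx) (fun i => U n (i + 1)) i - convStep F (Δt / Δx) (U n) i
          + Δt * jumpOp (weight c lam Δx) (fun i => U n (i + 1) - U n i) i
          = U (n + 1) (i + 1) - U (n + 1) i := fun i => by
        rw [discFracLap_sub hc hlam hΔ (V := fun i => U n (i + 1)) (fun i => hB (i + 1)) hB,
            discFracLap_shift hlam hΔ hB, hstep n (by omega) i, hstep n (by omega) (i + 1),
            convStep_shift]
        ring
      simp only [e3] at e2
      exact ⟨e1.1, (mul_le_mul_of_nonneg_left e1.2 hΔ.le).trans hM, e2.2.trans hC⟩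
  have htime : ∀ n < N, Δx * ∑' i, |U (n + 1) i - U n i|
      ≤ Δt * ((F₁ + F₂) * C + (C + 2 * M) * dConst c lam) := by
    intro n hn
    obtain ⟨hs, hM, hC⟩ := main n hn.le
    obtain ⟨g1, g2⟩ := summable_discFracLap hc hlam hΔ (l1BVWith_stepFun hΔ hs hC hM)
    obtain ⟨k1, k2⟩ := hF.tsum_abs_convStep_sub_self_le hr (summable_diff hs)
    have ht : ∀ i, |U (n + 1) i - U n i|
        ≤ |convStep F (Δt / Δx) (U n) i - U n i| + Δt * |discFracLap c lam Δx (U n) i| := by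
      intro i
      rw [hstep n hn i, add_sub_right_comm]
      refine (abs_add_le _ _).trans ?_
      rw [abs_mul, abs_of_pos hΔt]
    have hsum := Summable.of_nonneg_of_le (fun i => abs_nonneg _) ht (k1.add (g1.mul_left Δt))
    calc Δx * ∑' i, |U (n + 1) i - U n i|
        ≤ Δx * (Δt / Δx * (F₁ + F₂) * C + Δt * ∑' i, |discFracLap c lam Δx (U n) i|) := by
          refine mul_le_mul_of_nonneg_left ?_ hΔ.le
          refine (hsum.tsum_le_tsum ht (k1.add (g1.mul_left Δt))).trans ?_
          rw [k1.tsum_add (g1.mul_left Δt), tsum_mul_left]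
          refine add_le_add (k2.trans ?_) le_rfl
          gcongr
      _ = Δt * ((F₁ + F₂) * C + Δx * ∑' i, |discFracLap c lam Δx (U n) i|) := by
          field_simp
      _ ≤ _ := by gcongr
  refine ⟨fun n hn => (main n hn).1, fun n hn => (main n hn).2.1, fun n hn => (main n hn).2.2,
    htime, fun n hn => ?_⟩
  have hsn := (main n hn.le).1
  have hsn' := (main (n + 1) hn).1
  have hB := abs_le_tsum_abs hsn
  have hB' := abs_le_tsum_abs hsn'
  have hD : Summable fun i => |U n i - U (n + 1) i| :=
    Summable.of_nonneg_of_le (fun i => abs_nonneg _) (fun i => abs_sub _ _) (hsn.add hsn')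
  obtain ⟨j1, j2⟩ := tsum_abs_jumpOp_weight_le (c := c) hc hlam hΔ hD
  refine ⟨jumpOp (weight c lam Δx) (fun i => U n i - U (n + 1) i), j1, ?_, fun i => ?_⟩
  · have h1 := htime n hn
    simp only [abs_sub_comm (U (n + 1) _)] at h1
    have h0 : 0 ≤ 2 * (dConst c lam / Δx ^ lam) := by positivity
    calc _ ≤ Δx * (2 * (dConst c lam / Δx ^ lam) * ∑' i, |U n i - U (n + 1) i|) := by gcongr
      _ = 2 * (dConst c lam / Δx ^ lam) * (Δx * ∑' i, |U n i - U (n + 1) i|) := by ring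
      _ ≤ _ := by gcongr
  · rw [discFracLap_sub hc hlam hΔ hB hB']
    nth_rewrite 1 [hstep n hn i]
    ring

end Scheme

/-! ### Mollifiers -/

/-- Smooth nonnegative averaging kernels of width `h`; the constant `K` controls the first two
derivatives at the scaling of `z ↦ h⁻¹ ω (h⁻¹ z)`. -/
structure IsMollifier (ω : ℝ → ℝ) (h K : ℝ) : Prop where
  smooth : ContDiff ℝ (⊤ : ℕ∞) ω
  nonneg : ∀ z, 0 ≤ ω z
  integral_eq : ∫ z, ω z = 1
  eq_zero : ∀ z, h ≤ |z| → ω z = 0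
  deriv_eq_zero : ∀ z, h ≤ |z| → deriv ω z = 0
  deriv_le : ∀ z, |deriv ω z| ≤ K / h ^ 2
  deriv_sub_le : ∀ z z', |deriv ω z - deriv ω z'| ≤ K / h ^ 3 * |z - z'|

/-- Rescaled bump functions; the constant `K` does not depend on the width. -/
lemma exists_isMollifier : ∃ K : ℝ, 0 ≤ K ∧ ∀ h : ℝ, 0 < h → ∃ ω, IsMollifier ω h K := by
  let b : ContDiffBump (0 : ℝ) := ⟨1 / 2, 1, by norm_num, by norm_num⟩
  set φ := b.normed volume with hφ
  have hs : ContDiff ℝ (⊤ : ℕ∞) φ := b.contDiff_normed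
  have hc : HasCompactSupport φ := b.hasCompactSupport_normed
  have hs' : ContDiff ℝ (⊤ : ℕ∞) (deriv φ) := (contDiff_infty_iff_deriv.1 hs).2
  obtain ⟨K₁, hK₁⟩ := ContDiff.lipschitzWith_of_hasCompactSupport hc hs (by simp)
  obtain ⟨K₂, hK₂⟩ := ContDiff.lipschitzWith_of_hasCompactSupport hc.deriv hs' (by simp)
  have hz : ∀ z, 1 ≤ |z| → φ z = 0 := fun z hz => by
    have : z ∉ Function.support φ := by
      rw [hφ, b.support_normed_eq, Metric.mem_ball, dist_zero_right, Real.norm_eq_abs]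
      exact not_lt.2 hz
    simpa using this
  have hz' : ∀ z, 1 ≤ |z| → deriv φ z = 0 := fun z hzz => by
    have hmin : IsLocalMin φ z := Filter.Eventually.of_forall fun y => by
      rw [hz z hzz]; exact b.nonneg_normed y
    exact hmin.deriv_eq_zero
  refine ⟨max (K₁ : ℝ) K₂, le_max_of_le_left K₁.coe_nonneg, fun h hh => ?_⟩
  have hd : ∀ z, deriv (fun z => h⁻¹ * φ (h⁻¹ * z)) z = h⁻¹ * (h⁻¹ * deriv φ (h⁻¹ * z)) := by
    intro z
    rw [deriv_const_mul_field, deriv_comp_mul_left, smul_eq_mul]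
  have hone : ∀ z, h ≤ |z| → 1 ≤ |h⁻¹ * z| := fun z hz => by
    rw [abs_mul, abs_of_pos (inv_pos.2 hh), inv_mul_eq_div, le_div_iff₀ hh, one_mul]; exact hz
  refine ⟨fun z => h⁻¹ * φ (h⁻¹ * z), ⟨?_, fun z => ?_, ?_, fun z hzz => ?_, fun z hzz => ?_,
    fun z => ?_, fun z z' => ?_⟩⟩
  · exact contDiff_const.mul (hs.comp (contDiff_const.mul contDiff_id))
  · exact mul_nonneg (inv_pos.2 hh).le (b.nonneg_normed _)
  · rw [integral_const_mul, Measure.integral_comp_inv_mul_left φ, abs_of_pos hh, hφ,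
      b.integral_normed]
    simp [hh.ne']
  · rw [hz _ (hone z hzz), mul_zero]
  · rw [hd, hz' _ (hone z hzz), mul_zero, mul_zero]
  · rw [hd, abs_mul, abs_mul, abs_of_pos (inv_pos.2 hh)]
    have : |deriv φ (h⁻¹ * z)| ≤ max (K₁ : ℝ) K₂ :=
      (norm_deriv_le_of_lipschitz hK₁).trans (le_max_left _ _)
    calc _ ≤ h⁻¹ * (h⁻¹ * max (K₁ : ℝ) K₂) := by gcongr
      _ = _ := by field_simp
  · rw [hd, hd, ← mul_sub, ← mul_sub, abs_mul, abs_mul, abs_of_pos (inv_pos.2 hh)]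
    have h1 := hK₂.dist_le_mul (h⁻¹ * z) (h⁻¹ * z')
    rw [Real.dist_eq, Real.dist_eq, ← mul_sub, abs_mul, abs_of_pos (inv_pos.2 hh)] at h1
    calc _ ≤ h⁻¹ * (h⁻¹ * (K₂ * (h⁻¹ * |z - z'|))) := by gcongr
      _ ≤ h⁻¹ * (h⁻¹ * (max (K₁ : ℝ) K₂ * (h⁻¹ * |z - z'|))) := by gcongr; exact le_max_right _ _
      _ = _ := by field_simp

/-- Bound for the integral against a kernel supported in `[-R, R]`. -/
lemma abs_integral_mul_le {φ ψ : ℝ → ℝ} {R b s : ℝ} (hR : 0 ≤ R) (hb : 0 ≤ b)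
    (hφ : ∀ z, |φ z| ≤ b) (hφ0 : ∀ z, R < |z| → φ z = 0) (hψ : ∀ z, |z| ≤ R → |ψ z| ≤ s) :
    |∫ z, φ z * ψ z| ≤ 2 * R * b * s := by
  rw [← setIntegral_eq_integral_of_forall_compl_eq_zero (s := Icc (-R) R)]
  · have := norm_setIntegral_le_of_norm_le_const (μ := volume) (s := Icc (-R) R)
      (f := fun z => φ z * ψ z) (C := b * s) (by simp) fun z hz => by
        rw [Real.norm_eq_abs, abs_mul]
        exact mul_le_mul (hφ z) (hψ z (abs_le.2 hz)) (abs_nonneg _) hb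
    rw [Real.volume_real_Icc_of_le (by linarith), Real.norm_eq_abs] at this
    linarith
  · intro z hz
    rw [hφ0 z, zero_mul]
    by_contra h
    exact hz (abs_le.1 (not_lt.1 h))

namespace IsMollifier

variable {ω : ℝ → ℝ} {h K : ℝ}

lemma continuous (hω : IsMollifier ω h K) : Continuous ω := hω.smooth.continuous

lemma differentiable (hω : IsMollifier ω h K) : Differentiable ℝ ω :=
  (contDiff_infty_iff_deriv.1 hω.smooth).1

lemma continuous_deriv (hω : IsMollifier ω h K) : Continuous (deriv ω) :=
  (contDiff_infty_iff_deriv.1 hω.smooth).2.continuous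

lemma hasCompactSupport (hω : IsMollifier ω h K) : HasCompactSupport ω := by
  refine HasCompactSupport.of_support_subset_isCompact (isCompact_Icc (a := -h) (b := h)) ?_
  intro z hz
  by_contra hcon
  exact hz (hω.eq_zero z (not_lt.1 fun hlt => hcon (abs_le.1 hlt.le)))

lemma integrable (hω : IsMollifier ω h K) : Integrable ω :=
  hω.continuous.integrable_of_hasCompactSupport hω.hasCompactSupport

lemma integrable_deriv (hω : IsMollifier ω h K) : Integrable (deriv ω) :=
  hω.continuous_deriv.integrable_of_hasCompactSupport hω.hasCompactSupport.deriv

lemma integral_deriv (hω : IsMollifier ω h K) : ∫ z, deriv ω z = 0 :=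
  integral_eq_zero_of_hasDerivAt_of_integrable (fun x => (hω.differentiable x).hasDerivAt)
    hω.integrable_deriv hω.integrable

lemma integrable_sub_comp (hω : IsMollifier ω h K) (a : ℝ) :
    Integrable (fun z => ω z - ω (z - a)) :=
  hω.integrable.sub (hω.integrable.comp_sub_right a)

lemma abs_sub_le (hω : IsMollifier ω h K) (z z' : ℝ) : |ω z - ω z'| ≤ K / h ^ 2 * |z - z'| := by
  have := Convex.norm_image_sub_le_of_norm_deriv_le (f := ω) (s := univ) (x := z') (y := z)
    (fun x _ => hω.differentiable x) (fun x _ => hω.deriv_le x) convex_univ (mem_univ _)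
    (mem_univ _)
  simpa using this

lemma sub_comp_eq_zero (hω : IsMollifier ω h K) (hh : 0 < h) {a : ℝ} (ha : |a| ≤ h) {z : ℝ}
    (hz : 2 * h < |z|) : ω z - ω (z - a) = 0 := by
  have h1 : |z| - |a| ≤ |z - a| := abs_sub_abs_le_abs_sub z a
  rw [hω.eq_zero z (by linarith), hω.eq_zero (z - a) (by linarith), sub_zero]

lemma K_nonneg (hω : IsMollifier ω h K) (hh : 0 < h) : 0 ≤ K := by
  have := (abs_nonneg _).trans (hω.deriv_le 0)
  by_contra hcon
  have h2 : K / h ^ 2 < 0 := div_neg_of_neg_of_pos (not_le.1 hcon) (by positivity)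
  linarith

lemma abs_integral_sub_comp_mul_le (hω : IsMollifier ω h K) (hh : 0 < h) {a : ℝ} (ha : |a| ≤ h)
    {ψ : ℝ → ℝ} {s : ℝ} (hψ : ∀ z, |ψ z| ≤ s) :
    |∫ z, (ω z - ω (z - a)) * ψ z| ≤ 4 * K * |a| / h * s := by
  have hK := hω.K_nonneg hh
  refine (abs_integral_mul_le (R := 2 * h) (b := K / h ^ 2 * |a|) (by linarith) (by positivity)
    (fun z => ?_) (fun z hz => hω.sub_comp_eq_zero hh ha hz) fun z _ => hψ z).trans (le_of_eq ?_)
  · simpa using hω.abs_sub_le z (z - a)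
  · field_simp; ring

/-- Testing a Lipschitz function with the derivative of the kernel costs no power of `h`. -/
lemma abs_integral_deriv_mul_le (hω : IsMollifier ω h K) (hh : 0 < h) {J : ℝ → ℝ} {l : ℝ}
    (hl : 0 ≤ l) (hJ : ∀ z z', |J z - J z'| ≤ l * |z - z'|) (hJc : Continuous J) :
    |∫ z, deriv ω z * J z| ≤ 2 * K * l := by
  have hK := hω.K_nonneg hh
  have hi : Integrable fun z => deriv ω z * J z :=
    (hω.continuous_deriv.mul hJc).integrable_of_hasCompactSupport
      hω.hasCompactSupport.deriv.mul_right
  -- `deriv ω` has integral zero, so `J 0` may be subtracted.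
  have e : ∫ z, deriv ω z * J z = ∫ z, deriv ω z * (J z - J 0) := by
    simp only [mul_sub]
    rw [integral_sub hi (hω.integrable_deriv.mul_const _), integral_mul_const, hω.integral_deriv]
    ring
  rw [e]
  refine (abs_integral_mul_le (R := h) (b := K / h ^ 2) (s := l * h) hh.le (by positivity)
    hω.deriv_le (fun z hz => hω.deriv_eq_zero z hz.le) fun z hz => ?_).trans (le_of_eq ?_)
  · refine (hJ z 0).trans ?_
    rw [sub_zero]; gcongr
  · field_simp

lemma abs_taylor_le (hω : IsMollifier ω h K) (hh : 0 < h) (a z : ℝ) :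
    |ω z - ω (z - a) - a * deriv ω z| ≤ K / h ^ 3 * a ^ 2 := by
  have hK := hω.K_nonneg hh
  have hd : ∀ y, HasDerivAt (fun y => ω y - y * deriv ω z) (deriv ω y - deriv ω z) y := fun y => by
    have := (hω.differentiable y).hasDerivAt.sub ((hasDerivAt_id y).mul_const (deriv ω z))
    rw [one_mul] at this
    exact this
  have hmem : ∀ y ∈ uIcc z (z - a), |y - z| ≤ |a| := fun y hy => by
    have := abs_sub_left_of_mem_uIcc hy
    simpa using this
  have := Convex.norm_image_sub_le_of_norm_hasDerivWithin_le
    (f := fun y => ω y - y * deriv ω z) (s := uIcc z (z - a)) (x := z - a) (y := z)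
    (C := K / h ^ 3 * |a|)
    (fun y _ => (hd y).hasDerivWithinAt) (fun y hy => by
      refine (hω.deriv_sub_le y z).trans ?_
      exact mul_le_mul_of_nonneg_left (hmem y hy) (by positivity)) (convex_uIcc _ _)
    right_mem_uIcc left_mem_uIcc
  have e : ω z - ω (z - a) - a * deriv ω z
      = (ω z - z * deriv ω z) - (ω (z - a) - (z - a) * deriv ω z) := by ring
  rw [e]
  refine this.trans (le_of_eq ?_)
  rw [Real.norm_eq_abs, sub_sub_cancel, mul_assoc, ← sq, sq_abs]

/-- The first order Taylor remainder of the kernel has integral zero, so a Lipschitz function may be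
reduced by a constant before the pointwise bounds are used. -/
lemma abs_integral_taylor_mul_le (hω : IsMollifier ω h K) (hh : 0 < h) {a : ℝ} (ha : |a| ≤ h)
    {J : ℝ → ℝ} {l : ℝ} (hl : 0 ≤ l) (hJ : ∀ z z', |J z - J z'| ≤ l * |z - z'|)
    (hJc : Continuous J) :
    |∫ z, (ω z - ω (z - a) - a * deriv ω z) * J z| ≤ 8 * K * l * (a ^ 2 / h) := by
  have hK := hω.K_nonneg hh
  have hcont : Continuous fun z => ω z - ω (z - a) - a * deriv ω z :=
    ((hω.continuous.sub (hω.continuous.comp (continuous_id.sub continuous_const)))).sub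
      (continuous_const.mul hω.continuous_deriv)
  have hz : ∀ z, 2 * h < |z| → ω z - ω (z - a) - a * deriv ω z = 0 := fun z hz => by
    rw [hω.sub_comp_eq_zero hh ha hz, hω.deriv_eq_zero z (by linarith)]; ring
  have hcs : HasCompactSupport fun z => ω z - ω (z - a) - a * deriv ω z := by
    refine HasCompactSupport.of_support_subset_isCompact
      (isCompact_Icc (a := -(2 * h)) (b := 2 * h)) fun z hzz => ?_
    by_contra hcon
    exact hzz (hz z (not_le.1 fun hle => hcon (abs_le.1 hle)))
  have hi0 := hcont.integrable_of_hasCompactSupport (μ := volume) hcs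
  have hi : Integrable fun z => (ω z - ω (z - a) - a * deriv ω z) * J z :=
    (hcont.mul hJc).integrable_of_hasCompactSupport hcs.mul_right
  have e0 : ∫ z, (ω z - ω (z - a) - a * deriv ω z) = 0 := by
    rw [integral_sub (hω.integrable_sub_comp a) (hω.integrable_deriv.const_mul a),
      integral_sub hω.integrable (hω.integrable.comp_sub_right a),
      integral_sub_right_eq_self ω a, integral_const_mul, hω.integral_deriv]
    ring
  have e : ∫ z, (ω z - ω (z - a) - a * deriv ω z) * J z
      = ∫ z, (ω z - ω (z - a) - a * deriv ω z) * (J z - J 0) := by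
    simp only [mul_sub _ _ (J 0)]
    rw [integral_sub hi (hi0.mul_const _), integral_mul_const, e0]
    ring
  rw [e]
  refine (abs_integral_mul_le (R := 2 * h) (b := K / h ^ 3 * a ^ 2) (s := l * (2 * h))
    (by linarith) (by positivity) (fun z => hω.abs_taylor_le hh a z) hz
    fun z hz => ?_).trans (le_of_eq ?_)
  · refine (hJ z 0).trans ?_
    rw [sub_zero]; gcongr
  · field_simp; ring

lemma integral_mul_le (hω : IsMollifier ω h K) {ψ : ℝ → ℝ} {s : ℝ}
    (hi : Integrable fun z => ω z * ψ z) (hψ : ∀ z, |z| ≤ h → ψ z ≤ s) :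
    ∫ z, ω z * ψ z ≤ s := by
  calc ∫ z, ω z * ψ z ≤ ∫ z, ω z * s := by
        refine integral_mono hi (hω.integrable.mul_const s) fun z => ?_
        rcases lt_or_ge |z| h with hz | hz
        · exact mul_le_mul_of_nonneg_left (hψ z hz.le) (hω.nonneg z)
        · simp [hω.eq_zero z hz]
    _ = s := by rw [integral_mul_const, hω.integral_eq, one_mul]

lemma abs_integral_mul_le (hω : IsMollifier ω h K) {ψ : ℝ → ℝ} {s : ℝ}
    (hi : Integrable fun z => ω z * ψ z) (hψ : ∀ z, |z| ≤ h → |ψ z| ≤ s) :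
    |∫ z, ω z * ψ z| ≤ s := by
  refine abs_le.2 ⟨?_, hω.integral_mul_le hi fun z hz => (abs_le.1 (hψ z hz)).2⟩
  have hi' : Integrable fun z => ω z * -ψ z := by simpa [mul_neg] using hi.neg
  have := hω.integral_mul_le (ψ := fun z => -ψ z) hi' fun z hz => by
    have := (abs_le.1 (hψ z hz)).1; linarith
  simp only [mul_neg, integral_neg] at this
  linarith

end IsMollifier

/-! ### Kružkov fluxes and the Kuznetsov functional -/

/-- The Kružkov entropy flux `sgn(a - k) (f(a) - f(k))`, written symmetrically in `a` and `k`. -/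
def kruzkovFlux (f : ℝ → ℝ) (a k : ℝ) : ℝ := f (max a k) - f (min a k)

lemma entropyFlux_eq (f : ℝ → ℝ) (k a : ℝ) : entropyFlux f k a = kruzkovFlux f a k := by
  unfold entropyFlux entropyDeriv kruzkovFlux
  rcases lt_trichotomy a k with h | h | h
  · rw [Real.sign_of_neg (by linarith), max_eq_right h.le, min_eq_left h.le]; ring
  · simp [h]
  · rw [Real.sign_of_pos (by linarith), max_eq_left h.le, min_eq_right h.le]; ring

/-- The Kružkov flux is Lipschitz in the constant `k`, although `sgn(a - k)` is discontinuous. -/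
lemma abs_kruzkovFlux_sub_le {f : ℝ → ℝ} {L : NNReal} (hf : LipschitzWith L f) (a k k' : ℝ) :
    |kruzkovFlux f a k - kruzkovFlux f a k'| ≤ 2 * L * |k - k'| := by
  have h1 := hf.dist_le_mul (max a k) (max a k')
  have h2 := hf.dist_le_mul (min a k) (min a k')
  rw [Real.dist_eq, Real.dist_eq] at h1 h2
  have h3 : |max a k - max a k'| ≤ |k - k'| := by
    simpa using abs_max_sub_max_le_max a k a k'
  have h4 : |min a k - min a k'| ≤ |k - k'| := by
    simpa using abs_min_sub_min_le_max a k a k'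
  have h5 : (0 : ℝ) ≤ L := L.coe_nonneg
  unfold kruzkovFlux
  calc _ = |(f (max a k) - f (max a k')) - (f (min a k) - f (min a k'))| := by congr 1; ring
    _ ≤ _ := abs_sub _ _
    _ ≤ L * |k - k'| + L * |k - k'| := by
      refine add_le_add (h1.trans ?_) (h2.trans ?_) <;> gcongr
    _ = _ := by ring

lemma abs_kruzkovFlux_le {f : ℝ → ℝ} {L : NNReal} (hf : LipschitzWith L f) (a k : ℝ) :
    |kruzkovFlux f a k| ≤ 2 * L * (|a| + |k|) := by
  have := abs_kruzkovFlux_sub_le hf a k a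
  have e : kruzkovFlux f a a = 0 := by simp [kruzkovFlux]
  rw [e, sub_zero, abs_sub_comm] at this
  refine this.trans ?_
  gcongr
  exact abs_sub _ _

/-- By consistency the flux `f` inherits the Lipschitz constant `F₁ + F₂`. -/
lemma IsNumericalFlux.lipschitzWith {f : ℝ → ℝ} {F : ℝ → ℝ → ℝ} {F₁ F₂ : NNReal}
    (hF : IsNumericalFlux f F F₁ F₂) : LipschitzWith (F₁ + F₂) f := by
  refine LipschitzWith.of_dist_le_mul fun a b => ?_
  rw [← hF.consistent a, ← hF.consistent b, Real.dist_eq, Real.dist_eq]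
  calc |F a a - F b b| = |(F a a - F b a) + (F b a - F b b)| := by congr 1; ring
    _ ≤ |F a a - F b a| + |F b a - F b b| := abs_add_le _ _
    _ ≤ F₁ * |a - b| + F₂ * |a - b| := add_le_add (hF.abs_fst_le _ _ _) (hF.abs_snd_le _ _ _)
    _ = _ := by push_cast; ring

lemma IsNumericalFlux.continuous {f : ℝ → ℝ} {F : ℝ → ℝ → ℝ} {F₁ F₂ : NNReal}
    (hF : IsNumericalFlux f F F₁ F₂) : Continuous (Function.uncurry F) :=
  (LipschitzWith.uncurry hF.lipschitz_fst hF.lipschitz_snd).continuous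

/-- The numerical entropy flux is consistent with the Kružkov entropy flux. -/
lemma IsNumericalFlux.abs_numEntropyFlux_sub_le {f : ℝ → ℝ} {F : ℝ → ℝ → ℝ} {F₁ F₂ : NNReal}
    (hF : IsNumericalFlux f F F₁ F₂) (a b k : ℝ) :
    |numEntropyFlux F k a b - kruzkovFlux f k a| ≤ 3 * F₂ * |b - a| := by
  have e : kruzkovFlux f k a = |F a a - F k a| - |F k a - F k k| := by
    unfold kruzkovFlux
    rcases le_total a k with h | h
    · rw [max_eq_left h, min_eq_right h, abs_of_nonpos (sub_nonpos.2 (hF.mono_fst a h)),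
        abs_of_nonneg (sub_nonneg.2 (hF.anti_snd k h)), ← hF.consistent, ← hF.consistent]
      ring
    · rw [max_eq_right h, min_eq_left h, abs_of_nonneg (sub_nonneg.2 (hF.mono_fst a h)),
        abs_of_nonpos (sub_nonpos.2 (hF.anti_snd k h)), ← hF.consistent, ← hF.consistent]
      ring
  have h1 := abs_abs_sub_abs_le_abs_sub (F a b - F k b) (F a a - F k a)
  have h2 := abs_abs_sub_abs_le_abs_sub (F k b - F k k) (F k a - F k k)
  have h3 := hF.abs_snd_le a b a
  have h4 := hF.abs_snd_le k b a
  have h5 : |F a b - F k b - (F a a - F k a)| ≤ |F a b - F a a| + |F k b - F k a| := by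
    rw [show F a b - F k b - (F a a - F k a) = (F a b - F a a) - (F k b - F k a) by ring]
    exact abs_sub _ _
  rw [sub_sub_sub_cancel_right] at h2
  rw [e]
  unfold numEntropyFlux
  calc _ = |(|F a b - F k b| - |F a a - F k a|) - (|F k b - F k k| - |F k a - F k k|)| := by
        congr 1; ring
    _ ≤ |(|F a b - F k b| - |F a a - F k a|)| + |(|F k b - F k k| - |F k a - F k k|)| := abs_sub _ _
    _ ≤ _ := by linarith

section Pair

/-- The `L¹` distance between `w` and the translate of `v` by `z`. -/
noncomputable def pairDist (w v : ℝ → ℝ) (z : ℝ) : ℝ := ∫ x, |w x - v (x - z)|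

/-- The integrated Kružkov flux between `w` and the translate of `v` by `z`. -/
noncomputable def pairFlux (f : ℝ → ℝ) (w v : ℝ → ℝ) (z : ℝ) : ℝ :=
  ∫ x, kruzkovFlux f (w x) (v (x - z))

/-- The contribution of the nonlocal term of `w` to the entropy balance between `w` and the
translate of `v` by `z`. -/
noncomputable def pairJump (c lam : ℝ) (w v : ℝ → ℝ) (z : ℝ) : ℝ :=
  ∫ x, Real.sign (w x - v (x - z)) * fracLap c lam w x

/-- The Kuznetsov functional `∬ |w(x) - v(y)| ω(x - y) dx dy`. -/
noncomputable def smoothDist (ω w v : ℝ → ℝ) : ℝ := ∫ z, ω z * pairDist w v z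

/-- The entropy production bounding the time derivative of the Kuznetsov functional when `w`
evolves by the conservation law and `v` is frozen. -/
noncomputable def smoothProd (ω : ℝ → ℝ) (c lam : ℝ) (f w v : ℝ → ℝ) : ℝ :=
  (∫ z, deriv ω z * pairFlux f w v z) + ∫ z, ω z * pairJump c lam w v z

variable {ω : ℝ → ℝ} {h K c lam : ℝ} {f : ℝ → ℝ} {w v : ℝ → ℝ} {C M C' M' : ℝ}

lemma L1BVWith.integrable_translate_sub (hv : L1BVWith C M v) (z z' : ℝ) :
    Integrable fun x => v (x - z) - v (x - z') :=
  (hv.int.comp_sub_right z).sub (hv.int.comp_sub_right z')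

lemma L1BVWith.integral_translate_sub_le (hv : L1BVWith C M v) (z z' : ℝ) :
    ∫ x, |v (x - z) - v (x - z')| ≤ C * |z - z'| := by
  rw [← integral_add_right_eq_self _ z']
  have := hv.trans (z' - z)
  rw [abs_sub_comm z' z] at this
  refine le_trans (le_of_eq ?_) this
  congr 1; ext x
  rw [add_sub_cancel_right, add_sub_assoc]

lemma integrable_sub_translate (hw : Integrable w) (hv : L1BVWith C M v) (z : ℝ) :
    Integrable fun x => w x - v (x - z) := hw.sub (hv.int.comp_sub_right z)

lemma abs_pairDist_sub_le (hw : Integrable w) (hv : L1BVWith C M v) (z z' : ℝ) :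
    |pairDist w v z - pairDist w v z'| ≤ C * |z - z'| := by
  have h1 := (integrable_sub_translate hw hv z).abs
  have h2 := (integrable_sub_translate hw hv z').abs
  rw [pairDist, pairDist, ← integral_sub h1 h2]
  refine abs_integral_le_integral_abs.trans ((integral_mono (h1.sub h2).abs
    (hv.integrable_translate_sub z z').abs fun x => ?_).trans (hv.integral_translate_sub_le z z'))
  refine (abs_abs_sub_abs_le_abs_sub _ _).trans (le_of_eq ?_)
  rw [sub_sub_sub_cancel_left, abs_sub_comm]

lemma continuous_of_abs_sub_le {J : ℝ → ℝ} {l : ℝ} (hJ : ∀ z z', |J z - J z'| ≤ l * |z - z'|) :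
    Continuous J := by
  have hl : 0 ≤ l := by simpa using (abs_nonneg _).trans (hJ 1 0)
  exact (LipschitzWith.of_dist_le_mul (K := ⟨l, hl⟩) fun x y => hJ x y).continuous

lemma IsMollifier.integrable_mul (hω : IsMollifier ω h K) {J : ℝ → ℝ} (hJ : Continuous J) :
    Integrable fun z => ω z * J z :=
  (hω.continuous.mul hJ).integrable_of_hasCompactSupport hω.hasCompactSupport.mul_right

lemma integrable_mul_pairDist (hω : IsMollifier ω h K) (hw : Integrable w)
    (hv : L1BVWith C M v) : Integrable fun z => ω z * pairDist w v z :=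
  hω.integrable_mul (continuous_of_abs_sub_le (abs_pairDist_sub_le hw hv))

/-- The Kuznetsov functional approximates the `L¹` distance up to the variation times `h`. -/
lemma abs_smoothDist_sub_le (hω : IsMollifier ω h K) (hw : Integrable w)
    (hv : L1BVWith C M v) : |smoothDist ω w v - (∫ x, |w x - v x|)| ≤ C * h := by
  have e0 : pairDist w v 0 = ∫ x, |w x - v x| := by simp [pairDist]
  have hi := integrable_mul_pairDist hω hw hv
  have hi0 := hω.integrable.mul_const (pairDist w v 0)
  have e : smoothDist ω w v - ∫ x, |w x - v x|
      = ∫ z, ω z * (pairDist w v z - pairDist w v 0) := by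
    simp only [mul_sub]
    rw [integral_sub hi hi0, integral_mul_const, hω.integral_eq, one_mul, e0, smoothDist]
  rw [e]
  refine hω.abs_integral_mul_le ?_ fun z hz => ?_
  · simp only [mul_sub]; exact hi.sub hi0
  · refine (abs_pairDist_sub_le hw hv z 0).trans ?_
    rw [sub_zero]
    exact mul_le_mul_of_nonneg_left hz hv.C_nonneg

lemma measurable_kruzkovFlux (hf : Continuous f) :
    Measurable fun p : ℝ × ℝ => kruzkovFlux f p.1 p.2 := by
  have : Continuous fun p : ℝ × ℝ => kruzkovFlux f p.1 p.2 := by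
    unfold kruzkovFlux; fun_prop
  exact this.measurable

lemma integrable_kruzkovFlux {L : NNReal} (hf : LipschitzWith L f) (hw : L1BVWith C M w)
    (hv : L1BVWith C' M' v) (z : ℝ) : Integrable fun x => kruzkovFlux f (w x) (v (x - z)) := by
  have hvz := hv.comp_sub z
  refine ((hw.int.abs.add hvz.int.abs).const_mul (2 * (L : ℝ))).mono'
    ((measurable_kruzkovFlux hf.continuous).comp
      (hw.meas.prodMk hvz.meas)).aestronglyMeasurable (ae_of_all _ fun x => ?_)
  exact abs_kruzkovFlux_le hf _ _

lemma abs_pairFlux_sub_le' {L : NNReal} (hf : LipschitzWith L f) (hw : L1BVWith C M w)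
    {v' : ℝ → ℝ} {C'' M'' : ℝ} (hv : L1BVWith C' M' v) (hv' : L1BVWith C'' M'' v') (z z' : ℝ) :
    |pairFlux f w v z - pairFlux f w v' z'| ≤ 2 * L * ∫ x, |v (x - z) - v' (x - z')| := by
  have h1 := integrable_kruzkovFlux hf hw hv z
  have h2 := integrable_kruzkovFlux hf hw hv' z'
  have h3 : Integrable fun x => v (x - z) - v' (x - z') :=
    (hv.comp_sub z).int.sub (hv'.comp_sub z').int
  rw [pairFlux, pairFlux, ← integral_sub h1 h2, ← integral_const_mul]
  exact abs_integral_le_integral_abs.trans (integral_mono (h1.sub h2).abs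
    (h3.abs.const_mul _) fun x => abs_kruzkovFlux_sub_le hf _ _ _)

lemma abs_pairFlux_sub_le {L : NNReal} (hf : LipschitzWith L f) (hw : L1BVWith C M w)
    (hv : L1BVWith C' M' v) (z z' : ℝ) :
    |pairFlux f w v z - pairFlux f w v z'| ≤ 2 * L * C' * |z - z'| := by
  refine (abs_pairFlux_sub_le' hf hw hv hv z z').trans ?_
  exact (mul_le_mul_of_nonneg_left (hv.integral_translate_sub_le z z')
    (by positivity)).trans_eq (by ring)

lemma measurable_pairJump (hw : Measurable w) (hv : Measurable v) :
    Measurable (pairJump c lam w v) := by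
  have hg := L1BVWith.measurable_fracLap (c := c) (lam := lam) hw
  have hs := measurable_sign
  have : Measurable fun p : ℝ × ℝ =>
      Real.sign (w p.2 - v (p.2 - p.1)) * fracLap c lam w p.2 := by fun_prop
  exact (this.stronglyMeasurable.integral_prod_right (ν := volume) (f := fun z x : ℝ =>
    Real.sign (w x - v (x - z)) * fracLap c lam w x)).measurable

lemma integrable_sign_mul {G : ℝ → ℝ} (hG : Integrable G) {s : ℝ → ℝ} (hs : Measurable s) :
    Integrable fun x => Real.sign (s x) * G x :=
  hG.bdd_mul (c := 1) (measurable_sign.comp hs).aestronglyMeasurable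
    (ae_of_all _ fun _ => abs_sign_le_one _)

lemma abs_sign_mul_le (r a : ℝ) : |Real.sign r * a| ≤ |a| := by
  rw [abs_mul]
  exact (mul_le_mul_of_nonneg_right (abs_sign_le_one r) (abs_nonneg a)).trans_eq (one_mul _)

lemma abs_integral_sign_mul_le {G : ℝ → ℝ} (hG : Integrable G) {s : ℝ → ℝ} (hs : Measurable s) :
    |∫ x, Real.sign (s x) * G x| ≤ ∫ x, |G x| :=
  abs_integral_le_integral_abs.trans (integral_mono (integrable_sign_mul hG hs).abs hG.abs
    fun _ => abs_sign_mul_le _ _)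

lemma IsMollifier.integrable_mul_of_bdd (hω : IsMollifier ω h K) {J : ℝ → ℝ} (hJ : Measurable J)
    {B : ℝ} (hB : ∀ z, |J z| ≤ B) : Integrable fun z => ω z * J z :=
  hω.integrable.mul_bdd (c := B) hJ.aestronglyMeasurable (ae_of_all _ hB)

lemma abs_pairJump_le (hlam : lam ∈ Ioo (0 : ℝ) 1) (hc : 0 < c) (hw : L1BVWith C M w)
    (hv : Measurable v) (z : ℝ) : |pairJump c lam w v z| ≤ (C + 2 * M) * dConst c lam :=
  (abs_integral_sign_mul_le (hw.integrable_fracLap hlam c)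
    (hw.meas.sub (hv.comp (measurable_id.sub_const z)))).trans
    (hw.integral_abs_fracLap_le hlam hc)

/-- The bound does not deteriorate as `h → 0`. -/
lemma abs_smoothProd_le (hω : IsMollifier ω h K) (hh : 0 < h) (hlam : lam ∈ Ioo (0 : ℝ) 1)
    (hc : 0 < c) {L : NNReal} (hf : LipschitzWith L f) (hw : L1BVWith C M w)
    (hv : L1BVWith C' M' v) :
    |smoothProd ω c lam f w v| ≤ 4 * K * L * C' + (C + 2 * M) * dConst c lam := by
  have hC' := hv.C_nonneg
  have hJ := abs_pairFlux_sub_le hf hw hv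
  refine (abs_add_le _ _).trans (add_le_add ?_ ?_)
  · refine (hω.abs_integral_deriv_mul_le hh (by positivity) hJ
      (continuous_of_abs_sub_le hJ)).trans (le_of_eq (by ring))
  · exact hω.abs_integral_mul_le (hω.integrable_mul_of_bdd
      (measurable_pairJump hw.meas hv.meas) (abs_pairJump_le hlam hc hw hv.meas))
      fun z _ => abs_pairJump_le hlam hc hw hv.meas z

end Pair

/-! ### Discrete entropy inequality and cell averaging against smoothed signs -/

section OneStep

variable {ω : ℝ → ℝ} {h K c lam Δx Δt : ℝ} {f : ℝ → ℝ} {F : ℝ → ℝ → ℝ} {F₁ F₂ : NNReal}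
  {w v : ℝ → ℝ} {C M C' M' : ℝ}

/-- The mollified sign is Lipschitz in `y` with constant `O(1 / h)`, however rough `w` is. -/
lemma abs_smoothed_sign_sub_le (hω : IsMollifier ω h K) (hh : 0 < h) (hw : Measurable w)
    (k y y' : ℝ) (hy : |y' - y| ≤ h) :
    |(∫ z, ω z * Real.sign (w (y + z) - k)) - ∫ z, ω z * Real.sign (w (y' + z) - k)|
      ≤ 4 * K * |y' - y| / h := by
  have hs := measurable_sign
  have hb : ∀ r : ℝ, ∀ z, |Real.sign (w (r + z) - k)| ≤ 1 := fun r z => abs_sign_le_one _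
  have hm : ∀ r : ℝ, Measurable fun z => Real.sign (w (r + z) - k) := fun r => by fun_prop
  have i1 : Integrable fun z => ω z * Real.sign (w (y + z) - k) :=
    hω.integrable_mul_of_bdd (hm y) (hb y)
  have i2 : Integrable fun z => ω (z - (y' - y)) * Real.sign (w (y + z) - k) :=
    (hω.integrable.comp_sub_right (y' - y)).mul_bdd (c := 1) (hm y).aestronglyMeasurable
      (ae_of_all _ (hb y))
  have e : ∫ z, ω z * Real.sign (w (y' + z) - k)
      = ∫ z, ω (z - (y' - y)) * Real.sign (w (y + z) - k) := by
    rw [← integral_sub_right_eq_self (fun z => ω z * Real.sign (w (y' + z) - k)) (y' - y)]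
    congr 1; ext z
    rw [show y' + (z - (y' - y)) = y + z by ring]
  rw [e, ← integral_sub i1 i2]
  have := hω.abs_integral_sub_comp_mul_le hh hy (hb y)
  simpa only [sub_mul, mul_one] using this

/-- Replacing `G` by its cell averages changes its pairing with the smoothed sign only by
`O(Δx / h)`, since the sign of `w(x) - W̄(y)` depends on `y` through the cell of `y` alone. -/
lemma abs_integral_sign_mul_sub_cellAverage_le (hω : IsMollifier ω h K) (hh : 0 < h)
    (hΔ : 0 < Δx) (hΔh : Δx ≤ h) (hw : Measurable w) (W : ℤ → ℝ) {G : ℝ → ℝ}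
    (hG : Integrable G) :
    |∫ z, ω z * ∫ x, Real.sign (w x - stepFun Δx W (x - z))
        * (G (x - z) - stepFun Δx (cellAverage Δx G) (x - z))|
      ≤ 8 * K * Δx / h * ∫ x, |G x| := by
  have hs := measurable_sign
  have hWm := measurable_stepFun Δx W
  obtain ⟨hcs, hcn⟩ := summable_cellAverage hΔ hG
  set D : ℝ → ℝ := fun y => G y - stepFun Δx (cellAverage Δx G) y with hD
  have hDi : Integrable D := hG.sub (integrable_stepFun hΔ hcs)
  have hDn : ∫ y, |D y| ≤ 2 * ∫ x, |G x| := by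
    calc ∫ y, |D y| ≤ ∫ y, (|G y| + |stepFun Δx (cellAverage Δx G) y|) :=
          integral_mono hDi.abs (hG.abs.add (integrable_stepFun hΔ hcs).abs) fun y => abs_sub _ _
      _ ≤ _ := by
          rw [integral_add hG.abs (integrable_stepFun hΔ hcs).abs, integral_abs_stepFun hΔ hcs]
          linarith
  set m : ℝ → ℝ → ℝ := fun y k => ∫ z, ω z * Real.sign (w (y + z) - k) with hm
  have hsm : Measurable fun p : ℝ × ℝ => Real.sign (w (p.2 + p.1) - stepFun Δx W p.2) := by
    fun_prop
  have hP : Integrable (fun p : ℝ × ℝ => ω p.1 * (Real.sign (w (p.2 + p.1) - stepFun Δx W p.2)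
      * D p.2)) (volume.prod volume) := by
    have := (hω.integrable.mul_prod hDi).bdd_mul (c := 1) hsm.aestronglyMeasurable
      (ae_of_all _ fun p => abs_sign_le_one _)
    refine this.congr (ae_of_all _ fun p => ?_)
    ring
  have e1 : ∫ z, ω z * ∫ x, Real.sign (w x - stepFun Δx W (x - z)) * D (x - z)
      = ∫ y, D y * m y (stepFun Δx W y) := by
    have e2 : ∀ z, ω z * ∫ x, Real.sign (w x - stepFun Δx W (x - z)) * D (x - z)
        = ∫ y, ω z * (Real.sign (w (y + z) - stepFun Δx W y) * D y) := fun z => by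
      rw [← integral_add_right_eq_self _ z, integral_const_mul]
      simp only [add_sub_cancel_right]
    simp only [e2]
    rw [integral_integral_swap hP]
    congr 1; ext y
    rw [hm, ← integral_const_mul]
    congr 1; ext z; ring
  have hmi : Integrable fun y => D y * m y (stepFun Δx W y) := by
    refine hP.integral_prod_right.congr (ae_of_all _ fun y => ?_)
    simp only [hm]
    rw [← integral_const_mul]
    congr 1; ext z; ring
  -- Freezing `y` at the left end of its cell gives a step function, against which `D` integrates
  -- to zero.
  set b : ℤ → ℝ := fun i => m (i * Δx) (W i) with hb
  have hb1 : ∀ i, |b i| ≤ 1 := fun i => by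
    refine hω.abs_integral_mul_le (hω.integrable_mul_of_bdd (B := 1) ?_ fun z => ?_) fun z _ => ?_
    · fun_prop
    · exact abs_sign_le_one _
    · exact abs_sign_le_one _
  have e3 := integral_sub_cellAverage_mul hΔ hG hb1
  have hbi : Integrable fun y => D y * stepFun Δx b y :=
    hDi.mul_bdd (c := 1) (measurable_stepFun Δx b).aestronglyMeasurable
      (ae_of_all _ fun x => hb1 _)
  change |∫ z, ω z * ∫ x, Real.sign (w x - stepFun Δx W (x - z)) * D (x - z)| ≤ _
  have e4 : ∫ y, D y * m y (stepFun Δx W y)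
      = ∫ y, (D y * m y (stepFun Δx W y) - D y * stepFun Δx b y) := by
    rw [integral_sub hmi hbi, e3, sub_zero]
  rw [e1, e4]
  have hK := hω.K_nonneg hh
  calc _ ≤ ∫ y, |D y * m y (stepFun Δx W y) - D y * stepFun Δx b y| :=
        abs_integral_le_integral_abs
    _ ≤ ∫ y, |D y| * (4 * K * Δx / h) := by
        refine integral_mono (hmi.sub hbi).abs (hDi.abs.mul_const _) fun y => ?_
        simp only
        rw [← mul_sub, abs_mul]
        refine mul_le_mul_of_nonneg_left ?_ (abs_nonneg _)
        have hfl : |(⌊y / Δx⌋ : ℝ) * Δx - y| ≤ Δx := by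
          have h1 := Int.floor_le (y / Δx)
          have h2 := Int.lt_floor_add_one (y / Δx)
          rw [le_div_iff₀ hΔ] at h1
          rw [div_lt_iff₀ hΔ] at h2
          rw [abs_le]; constructor <;> linarith
        have := abs_smoothed_sign_sub_le hω hh hw (stepFun Δx W y) y (⌊y / Δx⌋ * Δx)
          (hfl.trans hΔh)
        refine this.trans ?_
        gcongr
    _ ≤ _ := by
        rw [integral_mul_const]
        calc _ ≤ (2 * ∫ x, |G x|) * (4 * K * Δx / h) := by gcongr
          _ = _ := by ring

lemma integrable_numEntropyFlux (hF : IsNumericalFlux f F F₁ F₂) (hw : L1BVWith C M w)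
    (hv : L1BVWith C' M' v) (z : ℝ) :
    Integrable fun x => numEntropyFlux F (w x) (v (x - z)) (v (x - z + Δx)) := by
  have hvz := hv.comp_sub z
  have hFc := hF.continuous
  have hmeas : Measurable fun p : ℝ × ℝ × ℝ => numEntropyFlux F p.1 p.2.1 p.2.2 := by
    have : Continuous fun p : ℝ × ℝ × ℝ => numEntropyFlux F p.1 p.2.1 p.2.2 := by
      have hF' : ∀ g k : ℝ × ℝ × ℝ → ℝ, Continuous g → Continuous k →
        Continuous fun p => F (g p) (k p) := fun g k hg hk => hFc.comp (hg.prodMk hk)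
      unfold numEntropyFlux
      refine ((hF' _ _ ?_ ?_).sub (hF' _ _ ?_ ?_)).abs.sub ((hF' _ _ ?_ ?_).sub
        (hF' _ _ ?_ ?_)).abs <;> fun_prop
    exact this.measurable
  have h1 : Integrable fun x => v (x - z + Δx) - v (x - z) :=
    (hv.integrable_sub Δx).comp_sub_right z
  have h2 : Integrable fun x => kruzkovFlux f (w x) (v (x - z)) :=
    integrable_kruzkovFlux hF.lipschitzWith hw hv z
  refine ((h1.abs.const_mul (3 * (F₂ : ℝ))).add h2.abs).mono'
    (hmeas.comp (hw.meas.prodMk (hvz.meas.prodMk (hvz.meas.comp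
      (measurable_id.add_const Δx)))) |>.aestronglyMeasurable.congr
        (ae_of_all _ fun x => ?_)) (ae_of_all _ fun x => ?_)
  · simp [add_sub_right_comm]
  · have := hF.abs_numEntropyFlux_sub_le (v (x - z)) (v (x - z + Δx)) (w x)
    have h3 := abs_sub_abs_le_abs_sub (numEntropyFlux F (w x) (v (x - z)) (v (x - z + Δx)))
      (kruzkovFlux f (w x) (v (x - z)))
    simp only [Real.norm_eq_abs, Pi.add_apply]
    linarith

/-- The integrated numerical entropy flux between `w` and the translate of `v` by `z`. -/
noncomputable def pairNumFlux (F : ℝ → ℝ → ℝ) (Δx : ℝ) (w v : ℝ → ℝ) (z : ℝ) : ℝ :=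
  ∫ x, numEntropyFlux F (w x) (v (x - z)) (v (x - z + Δx))

/-- Consistency of the numerical entropy flux, in integrated form. -/
lemma abs_pairNumFlux_sub_le (hF : IsNumericalFlux f F F₁ F₂) (hw : L1BVWith C M w)
    (hv : L1BVWith C' M' v) (hΔ : 0 < Δx) (z : ℝ) :
    |pairNumFlux F Δx w v z - pairFlux f w v z| ≤ 3 * F₂ * (C' * Δx) := by
  have h1 : Integrable fun x => v (x - z + Δx) - v (x - z) :=
    (hv.integrable_sub Δx).comp_sub_right z
  have h2 := integrable_kruzkovFlux hF.lipschitzWith hw hv z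
  have h3 := integrable_numEntropyFlux (Δx := Δx) hF hw hv z
  rw [pairNumFlux, pairFlux, ← integral_sub h3 h2]
  refine abs_integral_le_integral_abs.trans ((integral_mono (h3.sub h2).abs
    (h1.abs.const_mul (3 * (F₂ : ℝ))) fun x => hF.abs_numEntropyFlux_sub_le _ _ _).trans ?_)
  rw [integral_const_mul, integral_sub_right_eq_self (fun x => |v (x + Δx) - v x|) z]
  have := hv.trans Δx
  rw [abs_of_pos hΔ] at this
  gcongr

lemma measurable_pairNumFlux (hF : IsNumericalFlux f F F₁ F₂) (hw : Measurable w)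
    (hv : Measurable v) : Measurable (pairNumFlux F Δx w v) := by
  have hFm : ∀ g k : ℝ × ℝ → ℝ, Measurable g → Measurable k →
      Measurable fun p => F (g p) (k p) := fun g k hg hk =>
    hF.continuous.measurable.comp (hg.prodMk hk)
  have : Measurable fun p : ℝ × ℝ =>
      numEntropyFlux F (w p.2) (v (p.2 - p.1)) (v (p.2 - p.1 + Δx)) := by
    unfold numEntropyFlux
    have habs : Measurable fun x : ℝ => |x| := continuous_abs.measurable
    refine (habs.comp ((hFm _ _ ?_ ?_).sub (hFm _ _ ?_ ?_))).sub
      (habs.comp ((hFm _ _ ?_ ?_).sub (hFm _ _ ?_ ?_))) <;> fun_prop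
  exact (this.stronglyMeasurable.integral_prod_right (ν := volume) (f := fun z x : ℝ =>
    numEntropyFlux F (w x) (v (x - z)) (v (x - z + Δx)))).measurable

/-- Discrete entropy inequality in cell `i` for the entropy `|v - k|`. -/
lemma discrete_entropy_le (hF : IsNumericalFlux f F F₁ F₂) (hΔ : 0 < Δx) (hΔt : 0 < Δt)
    (hcfl : Δt / Δx * (F₁ + F₂) ≤ 1) {V W g r : ℤ → ℝ}
    (hstep : ∀ i, W i = convStep F (Δt / Δx) V i + Δt * g i + Δt * r i) (k : ℝ) (i : ℤ) :
    |k - W i| - |k - V i| ≤ -(Δt / Δx) * (numEntropyFlux F k (V i) (V (i + 1))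
      - numEntropyFlux F k (V (i - 1)) (V i)) - Δt * (Real.sign (k - W i) * g i) + Δt * |r i| := by
  have h1 := hF.abs_convStep_sub_const_le (by positivity) hcfl V k i
  have h2 := sign_mul_self (k - W i)
  have e : k - W i = (k - convStep F (Δt / Δx) V i) - Δt * g i - Δt * r i := by
    rw [hstep i]; ring
  have h3 := sign_mul_le_abs (k - W i) (k - convStep F (Δt / Δx) V i)
  have h4 := neg_le_of_abs_le (abs_sign_mul_le (k - W i) (r i))
  have h5 : |k - W i| = Real.sign (k - W i) * (k - convStep F (Δt / Δx) V i)
      - Δt * (Real.sign (k - W i) * g i) - Δt * (Real.sign (k - W i) * r i) := by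
    rw [← h2]; nth_rewrite 2 [e]; ring
  rw [abs_sub_comm k (convStep F (Δt / Δx) V i)] at h3
  rw [abs_sub_comm k (V i), h5]
  nlinarith

end OneStep

/-! ### One time step of the scheme -/

section Step

variable {ω : ℝ → ℝ} {h K c lam Δx Δt : ℝ} {f : ℝ → ℝ} {F : ℝ → ℝ → ℝ} {F₁ F₂ : NNReal}
  {w : ℝ → ℝ} {C M L ρ Cw Mw : ℝ} {N n : ℕ} {U : ℕ → ℤ → ℝ}

lemma HasSchemeBounds.l1BVWith (hU : HasSchemeBounds c lam F Δx Δt N U C M L ρ) (hΔ : 0 < Δx)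
    (hn : n ≤ N) : L1BVWith C M (stepFun Δx (U n)) :=
  l1BVWith_stepFun hΔ (hU.summable n hn) (hU.variation_le n hn) (hU.norm_le n hn)

lemma HasSchemeBounds.summable_sub (hU : HasSchemeBounds c lam F Δx Δt N U C M L ρ)
    {m : ℕ} (hm : m ≤ N) (hn : n ≤ N) : Summable fun i => |U m i - U n i| :=
  Summable.of_nonneg_of_le (fun _ => abs_nonneg _) (fun _ => abs_sub _ _)
    ((hU.summable m hm).add (hU.summable n hn))

lemma HasSchemeBounds.integral_abs_sub_le (hU : HasSchemeBounds c lam F Δx Δt N U C M L ρ)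
    (hΔ : 0 < Δx) (hn : n < N) :
    ∫ x, |stepFun Δx (U (n + 1)) x - stepFun Δx (U n) x| ≤ Δt * L := by
  have h1 := integral_abs_stepFun hΔ (V := fun i => U (n + 1) i - U n i)
    (hU.summable_sub hn hn.le)
  exact h1.trans_le (hU.time_le n hn)

/-- The average of the discrete nonlocal term against `sgn(w(x) - v(x - z))`. -/
noncomputable def pairDiscJump (c lam Δx : ℝ) (w : ℝ → ℝ) (W : ℤ → ℝ) (z : ℝ) : ℝ :=
  ∫ x, Real.sign (w x - stepFun Δx W (x - z)) * stepFun Δx (discFracLap c lam Δx W) (x - z)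

lemma measurable_pairDiscJump (hw : Measurable w) (W : ℤ → ℝ) :
    Measurable (pairDiscJump c lam Δx w W) := by
  have hs := measurable_sign
  have h1 := measurable_stepFun Δx W
  have h2 := measurable_stepFun Δx (discFracLap c lam Δx W)
  have : Measurable fun p : ℝ × ℝ => Real.sign (w p.2 - stepFun Δx W (p.2 - p.1))
      * stepFun Δx (discFracLap c lam Δx W) (p.2 - p.1) := by fun_prop
  exact (this.stronglyMeasurable.integral_prod_right (ν := volume) (f := fun z x : ℝ =>
    Real.sign (w x - stepFun Δx W (x - z))
      * stepFun Δx (discFracLap c lam Δx W) (x - z))).measurable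

lemma abs_pairDiscJump_le (hlam : lam ∈ Ioo (0 : ℝ) 1) (hc : 0 < c) (hΔ : 0 < Δx)
    (hw : Measurable w) {W : ℤ → ℝ} (hW : L1BVWith C M (stepFun Δx W)) (z : ℝ) :
    |pairDiscJump c lam Δx w W z| ≤ (C + 2 * M) * dConst c lam := by
  obtain ⟨g1, g2⟩ := summable_discFracLap hc hlam hΔ hW
  have hi := integrable_stepFun hΔ g1
  refine (abs_integral_sign_mul_le (G := fun x => stepFun Δx (discFracLap c lam Δx W) (x - z))
    (s := fun x => w x - stepFun Δx W (x - z)) (hi.comp_sub_right z)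
    (hw.sub ((measurable_stepFun Δx W).comp (measurable_id.sub_const z)))).trans ?_
  rw [integral_sub_right_eq_self (fun x => |stepFun Δx (discFracLap c lam Δx W) x|) z,
    integral_abs_stepFun hΔ g1]
  exact g2

/-- The nonlocal terms of `w` and of the numerical solution nearly balance: by Kato's inequality
up to the error made by averaging over cells. -/
lemma integral_mul_pairJump_sub_le (hω : IsMollifier ω h K) (hh : 0 < h) (hΔ : 0 < Δx)
    (hΔh : Δx ≤ h) (hlam : lam ∈ Ioo (0 : ℝ) 1) (hc : 0 < c) (hw : L1BVWith Cw Mw w)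
    {W : ℤ → ℝ} (hW : L1BVWith C M (stepFun Δx W)) :
    (∫ z, ω z * pairJump c lam w (stepFun Δx W) z) - ∫ z, ω z * pairDiscJump c lam Δx w W z
      ≤ 8 * K * Δx / h * ((C + 2 * M) * dConst c lam) := by
  have hK := hω.K_nonneg hh
  set G := fracLap c lam (stepFun Δx W) with hG
  have hGi : Integrable G := hW.integrable_fracLap hlam c
  have hĝ : discFracLap c lam Δx W = cellAverage Δx G := rfl
  have hs1 := integrable_stepFun hΔ (summable_cellAverage hΔ hGi).1
  have i1 : Integrable fun z => ω z * pairJump c lam w (stepFun Δx W) z :=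
    hω.integrable_mul_of_bdd (measurable_pairJump hw.meas hW.meas)
      (abs_pairJump_le hlam hc hw hW.meas)
  have i2 : Integrable fun z => ω z * pairDiscJump c lam Δx w W z :=
    hω.integrable_mul_of_bdd (measurable_pairDiscJump hw.meas W)
      (abs_pairDiscJump_le hlam hc hΔ hw.meas hW)
  set D : ℝ → ℝ := fun z => ∫ x, Real.sign (w x - stepFun Δx W (x - z))
        * (G (x - z) - stepFun Δx (cellAverage Δx G) (x - z)) with hD
  have hsm : ∀ z, Measurable fun x => w x - stepFun Δx W (x - z) := fun z =>
    hw.meas.sub (hW.meas.comp (measurable_id.sub_const z))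
  have hkey : ∀ z, pairJump c lam w (stepFun Δx W) z - pairDiscJump c lam Δx w W z ≤ D z := by
    intro z
    have k1 := integrable_sign_mul (hw.integrable_fracLap hlam c) (hsm z)
    have k2 := integrable_sign_mul (hGi.comp_sub_right z) (hsm z)
    have k3 := integrable_sign_mul (hs1.comp_sub_right z) (hsm z)
    have kato := integral_sign_mul_fracLap_sub_le hw (hW.comp_sub z) hlam hc
    simp only [fracLap_comp_sub, ← hG, mul_sub] at kato
    rw [integral_sub k1 k2] at kato
    have eD : D z = (∫ x, Real.sign (w x - stepFun Δx W (x - z)) * G (x - z))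
        - pairDiscJump c lam Δx w W z := by
      simp only [hD, mul_sub]
      rw [integral_sub k2 k3, pairDiscJump, hĝ]
    rw [eD, pairJump]
    linarith
  have hDm : Measurable D := by
    have hs := measurable_sign
    have h1 := measurable_stepFun Δx W
    have h2 := measurable_stepFun Δx (cellAverage Δx G)
    have h3 : Measurable G := L1BVWith.measurable_fracLap hW.meas
    have hw' := hw.meas
    have : Measurable fun p : ℝ × ℝ => Real.sign (w p.2 - stepFun Δx W (p.2 - p.1))
        * (G (p.2 - p.1) - stepFun Δx (cellAverage Δx G) (p.2 - p.1)) := by fun_prop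
    exact (this.stronglyMeasurable.integral_prod_right (ν := volume) (f := fun z x : ℝ =>
      Real.sign (w x - stepFun Δx W (x - z))
        * (G (x - z) - stepFun Δx (cellAverage Δx G) (x - z)))).measurable
  have hDb : ∀ z, |D z| ≤ ∫ x, |G x - stepFun Δx (cellAverage Δx G) x| := fun z => by
    refine (abs_integral_sign_mul_le
      (G := fun x => G (x - z) - stepFun Δx (cellAverage Δx G) (x - z))
      ((hGi.sub hs1).comp_sub_right z) (hsm z)).trans (le_of_eq ?_)
    exact integral_sub_right_eq_self (fun x => |G x - stepFun Δx (cellAverage Δx G) x|) z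
  rw [← integral_sub i1 i2]
  calc _ ≤ ∫ z, ω z * D z := by
        refine integral_mono (i1.sub i2) (hω.integrable_mul_of_bdd hDm hDb) fun z => ?_
        simp only
        rw [← mul_sub]
        exact mul_le_mul_of_nonneg_left (hkey z) (hω.nonneg z)
    _ ≤ 8 * K * Δx / h * ∫ x, |G x| :=
        (le_abs_self _).trans
          (abs_integral_sign_mul_sub_cellAverage_le hω hh hΔ hΔh hw.meas W hGi)
    _ ≤ _ := mul_le_mul_of_nonneg_left (hW.integral_abs_fracLap_le hlam hc) (by positivity)

/-- The convective terms of `w` and of the numerical solution nearly balance: the difference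
quotient of the kernel is moved onto the total variation of the numerical solution. -/
lemma neg_integral_mul_pairNumFlux_sub_le (hω : IsMollifier ω h K) (hh : 0 < h) (hΔ : 0 < Δx)
    (hΔh : Δx ≤ h) (hF : IsNumericalFlux f F F₁ F₂) (hw : L1BVWith Cw Mw w)
    {v v' : ℝ → ℝ} {C' M' δ : ℝ} (hv : L1BVWith C M v) (hv' : L1BVWith C' M' v')
    (hδ : ∫ x, |v x - v' x| ≤ δ) :
    -(∫ z, ω z * (pairNumFlux F Δx w v z - pairNumFlux F Δx w v (z + Δx)))
      ≤ -(Δx * ∫ z, deriv ω z * pairFlux f w v' z)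
        + (4 * K * Δx / h * (3 * F₂ * (C * Δx) + 2 * (F₁ + F₂) * δ)
          + 16 * K * (F₁ + F₂) * C' * (Δx ^ 2 / h)) := by
  have hf := hF.lipschitzWith
  set R := pairNumFlux F Δx w v with hR
  set J := pairFlux f w v' with hJ
  have ha : |Δx| ≤ h := by rwa [abs_of_pos hΔ]
  have hJl := abs_pairFlux_sub_le hf hw hv'
  have hJc := continuous_of_abs_sub_le hJl
  have hRm : Measurable R := measurable_pairNumFlux hF hw.meas hv.meas
  have hRJ : ∀ z, |R z - J z| ≤ 3 * F₂ * (C * Δx) + 2 * (F₁ + F₂) * δ := by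
    intro z
    have h1 := abs_pairNumFlux_sub_le hF hw hv hΔ z
    have h2 := abs_pairFlux_sub_le' hf hw hv hv' z z
    have e := integral_sub_right_eq_self (fun x => |v x - v' x|) (μ := volume) z
    rw [e] at h2
    have h3 : 2 * ((F₁ + F₂ : NNReal) : ℝ) * ∫ x, |v x - v' x| ≤ 2 * (F₁ + F₂) * δ := by
      push_cast; gcongr
    have h4 := abs_add_le (R z - pairFlux f w v z) (pairFlux f w v z - J z)
    rw [sub_add_sub_cancel] at h4
    linarith
  have iJ : Integrable fun z => ω z * J z := hω.integrable_mul hJc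
  have iJd : Integrable fun z => deriv ω z * J z :=
    (hω.continuous_deriv.mul hJc).integrable_of_hasCompactSupport
      hω.hasCompactSupport.deriv.mul_right
  have iJs : Integrable fun z => ω (z - Δx) * J z := by
    have : Integrable fun z => ω z * J (z + Δx) :=
      hω.integrable_mul (hJc.comp (continuous_id.add continuous_const))
    simpa using this.comp_sub_right Δx
  have hRJm : Measurable fun z => R z - J z := hRm.sub hJc.measurable
  have iD : ∀ a, Integrable fun z => ω (z - a) * (R z - J z) := fun a =>
    (hω.integrable.comp_sub_right a).mul_bdd hRJm.aestronglyMeasurable (ae_of_all _ hRJ)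
  have iR0 : Integrable fun z => ω z * R z := by
    have := (iD 0).add iJ
    refine this.congr (ae_of_all _ fun z => ?_)
    simp only [Pi.add_apply, sub_zero]; ring
  have iRs : Integrable fun z => ω (z - Δx) * R z := by
    have := (iD Δx).add iJs
    refine this.congr (ae_of_all _ fun z => ?_)
    simp only [Pi.add_apply]; ring
  have iRs' : Integrable fun z => ω z * R (z + Δx) := by
    simpa using iRs.comp_add_right Δx
  have e1 : ∫ z, ω z * (R z - R (z + Δx)) = (∫ z, ω z * R z) - ∫ z, ω (z - Δx) * R z := by
    simp only [mul_sub]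
    rw [integral_sub iR0 iRs', ← integral_add_right_eq_self (fun z => ω (z - Δx) * R z) Δx]
    simp only [add_sub_cancel_right]
  have e2 : (∫ z, ω z * R z) - ∫ z, ω (z - Δx) * R z
      = (∫ z, (ω z - ω (z - Δx)) * (R z - J z))
        + (∫ z, (ω z - ω (z - Δx) - Δx * deriv ω z) * J z)
        + Δx * ∫ z, deriv ω z * J z := by
    have iA : Integrable fun z => (ω z - ω (z - Δx)) * (R z - J z) := by
      have := (iD 0).sub (iD Δx)
      refine this.congr (ae_of_all _ fun z => ?_)
      simp only [Pi.sub_apply, sub_zero]; ring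
    have iB : Integrable fun z => (ω z - ω (z - Δx) - Δx * deriv ω z) * J z := by
      have := (iJ.sub iJs).sub (iJd.const_mul Δx)
      refine this.congr (ae_of_all _ fun z => ?_)
      simp only [Pi.sub_apply]; ring
    have iAB : Integrable fun z => (ω z - ω (z - Δx)) * (R z - J z)
        + (ω z - ω (z - Δx) - Δx * deriv ω z) * J z := iA.add iB
    rw [← integral_const_mul, ← integral_sub iR0 iRs, ← integral_add iA iB,
      ← integral_add iAB (iJd.const_mul Δx)]
    congr 1; ext z
    ring
  have b1 := neg_le_of_abs_le (hω.abs_integral_sub_comp_mul_le hh ha hRJ)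
  have b2 := neg_le_of_abs_le (hω.abs_integral_taylor_mul_le hh ha
    (l := 2 * ((F₁ + F₂ : NNReal) : ℝ) * C') (by have := hv'.C_nonneg; positivity) hJl hJc)
  rw [abs_of_pos hΔ] at b1
  push_cast at b2
  rw [e1, e2]
  have e3 : 8 * K * (2 * ((F₁ : ℝ) + F₂) * C') * (Δx ^ 2 / h)
      = 16 * K * (F₁ + F₂) * C' * (Δx ^ 2 / h) := by ring
  linarith

/-- The pairing at a fixed shift decreases in one time step up to fluxes, jumps and residual. -/
lemma pairDist_step_le (hlam : lam ∈ Ioo (0 : ℝ) 1) (hc : 0 < c) (hΔ : 0 < Δx) (hΔt : 0 < Δt)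
    (hF : IsNumericalFlux f F F₁ F₂) (hcfl : Δt / Δx * (F₁ + F₂) ≤ 1) (hw : L1BVWith Cw Mw w)
    (hU : HasSchemeBounds c lam F Δx Δt N U C M L ρ) (hn : n < N) (z : ℝ) :
    pairDist w (stepFun Δx (U (n + 1))) z - pairDist w (stepFun Δx (U n)) z
      ≤ -(Δt / Δx) * (pairNumFlux F Δx w (stepFun Δx (U n)) z
          - pairNumFlux F Δx w (stepFun Δx (U n)) (z + Δx))
        - Δt * pairDiscJump c lam Δx w (U (n + 1)) z + Δt * ρ := by
  obtain ⟨r, hrs, hrn, hstep⟩ := hU.step n hn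
  have hV := hU.l1BVWith hΔ hn.le
  have hW := hU.l1BVWith hΔ hn
  obtain ⟨g1, -⟩ := summable_discFracLap hc hlam hΔ hW
  have iW := (integrable_sub_translate hw.int hW z).abs
  have iV := (integrable_sub_translate hw.int hV z).abs
  have iQ := integrable_numEntropyFlux (Δx := Δx) hF hw hV z
  have iQ' := integrable_numEntropyFlux (Δx := Δx) hF hw hV (z + Δx)
  have iS := integrable_sign_mul ((integrable_stepFun hΔ g1).comp_sub_right z)
    (hw.meas.sub (hW.meas.comp (measurable_id.sub_const z)))
  have ir : Integrable fun x => |stepFun Δx r (x - z)| :=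
    ((integrable_stepFun hΔ hrs).comp_sub_right z).abs
  have hpt : ∀ x, |w x - stepFun Δx (U (n + 1)) (x - z)| - |w x - stepFun Δx (U n) (x - z)|
      ≤ -(Δt / Δx) * (numEntropyFlux F (w x) (stepFun Δx (U n) (x - z))
            (stepFun Δx (U n) (x - z + Δx))
          - numEntropyFlux F (w x) (stepFun Δx (U n) (x - (z + Δx)))
            (stepFun Δx (U n) (x - (z + Δx) + Δx)))
        - Δt * (Real.sign (w x - stepFun Δx (U (n + 1)) (x - z))
          * stepFun Δx (discFracLap c lam Δx (U (n + 1))) (x - z))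
        + Δt * |stepFun Δx r (x - z)| := by
    intro x
    have h1 := discrete_entropy_le hF hΔ hΔt hcfl hstep (w x) ⌊(x - z) / Δx⌋
    have e1 : x - (z + Δx) + Δx = x - z := by ring
    rw [e1, ← sub_sub, stepFun_add hΔ, stepFun_sub hΔ]
    exact h1
  have iF : Integrable fun x => -(Δt / Δx) * (numEntropyFlux F (w x) (stepFun Δx (U n) (x - z))
        (stepFun Δx (U n) (x - z + Δx))
      - numEntropyFlux F (w x) (stepFun Δx (U n) (x - (z + Δx)))
        (stepFun Δx (U n) (x - (z + Δx) + Δx))) := (iQ.sub iQ').const_mul _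
  have iFS := iF.sub (iS.const_mul Δt)
  calc _ = ∫ x, (|w x - stepFun Δx (U (n + 1)) (x - z)| - |w x - stepFun Δx (U n) (x - z)|) :=
        (integral_sub iW iV).symm
    _ ≤ _ := integral_mono (iW.sub iV) (iFS.add (ir.const_mul Δt)) hpt
    _ = -(Δt / Δx) * (pairNumFlux F Δx w (stepFun Δx (U n)) z
          - pairNumFlux F Δx w (stepFun Δx (U n)) (z + Δx))
        - Δt * pairDiscJump c lam Δx w (U (n + 1)) z
        + Δt * ∫ x, |stepFun Δx r (x - z)| := by
        rw [integral_add' iFS (ir.const_mul Δt), integral_sub' iF (iS.const_mul Δt),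
          integral_const_mul, integral_const_mul, integral_const_mul, integral_sub iQ iQ']
        rfl
    _ ≤ _ := by
        rw [integral_sub_right_eq_self (fun x => |stepFun Δx r x|) z,
          integral_abs_stepFun hΔ hrs]
        gcongr

/-- The consistency error of the scheme per unit time, when tested at scale `h`. -/
noncomputable def stepError (c lam : ℝ) (F₁ F₂ : NNReal) (K C M L ρ h Δx Δt : ℝ) : ℝ :=
  (4 * K * (3 * F₂ * (C * Δx) + 2 * (F₁ + F₂) * (Δt * L)) + 16 * K * (F₁ + F₂) * C * Δx
    + 8 * K * Δx * ((C + 2 * M) * dConst c lam)) / h + ρ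

/-- One time step of the scheme, for `w` frozen, dissipates the Kuznetsov functional at the rate at
which `w` may produce it. -/
lemma smoothDist_step_le (hω : IsMollifier ω h K) (hh : 0 < h) (hΔh : Δx ≤ h)
    (hlam : lam ∈ Ioo (0 : ℝ) 1) (hc : 0 < c) (hΔ : 0 < Δx) (hΔt : 0 < Δt)
    (hF : IsNumericalFlux f F F₁ F₂) (hcfl : Δt / Δx * (F₁ + F₂) ≤ 1) (hw : L1BVWith Cw Mw w)
    (hU : HasSchemeBounds c lam F Δx Δt N U C M L ρ) (hn : n < N) :
    smoothDist ω w (stepFun Δx (U (n + 1))) - smoothDist ω w (stepFun Δx (U n))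
      ≤ -(Δt * smoothProd ω c lam f w (stepFun Δx (U (n + 1))))
        + Δt * stepError c lam F₁ F₂ K C M L ρ h Δx Δt := by
  have hV := hU.l1BVWith hΔ hn.le
  have hW := hU.l1BVWith hΔ hn
  have iW := integrable_mul_pairDist hω hw.int hW
  have iV := integrable_mul_pairDist hω hw.int hV
  have iS : Integrable fun z => ω z * pairDiscJump c lam Δx w (U (n + 1)) z :=
    hω.integrable_mul_of_bdd (measurable_pairDiscJump hw.meas _)
      (abs_pairDiscJump_le hlam hc hΔ hw.meas hW)
  have hδ : ∫ x, |stepFun Δx (U n) x - stepFun Δx (U (n + 1)) x| ≤ Δt * L := by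
    simpa only [abs_sub_comm] using hU.integral_abs_sub_le hΔ hn
  have hconv := neg_integral_mul_pairNumFlux_sub_le hω hh hΔ hΔh hF hw hV hW hδ
  have hjump := integral_mul_pairJump_sub_le hω hh hΔ hΔh hlam hc hw hW
  have iR : Integrable fun z => ω z * (pairNumFlux F Δx w (stepFun Δx (U n)) z
      - pairNumFlux F Δx w (stepFun Δx (U n)) (z + Δx)) := by
    have hm := measurable_pairNumFlux (Δx := Δx) hF hw.meas hV.meas
    refine hω.integrable_mul_of_bdd (B := 3 * F₂ * (C * Δx) + 3 * F₂ * (C * Δx)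
      + 2 * ((F₁ + F₂ : NNReal) : ℝ) * C * Δx) (hm.sub (hm.comp
        (measurable_id.add_const Δx))) fun z => ?_
    have b1 := abs_le.1 (abs_pairNumFlux_sub_le hF hw hV hΔ z)
    have b2 := abs_le.1 (abs_pairNumFlux_sub_le hF hw hV hΔ (z + Δx))
    have b3 := abs_pairFlux_sub_le hF.lipschitzWith hw hV z (z + Δx)
    rw [sub_add_cancel_left, abs_neg, abs_of_pos hΔ] at b3
    have b4 := abs_le.1 b3
    rw [abs_le]
    constructor <;> linarith [b1.1, b1.2, b2.1, b2.2, b4.1, b4.2]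
  have hr : 0 ≤ Δt / Δx := by positivity
  have key : smoothDist ω w (stepFun Δx (U (n + 1))) - smoothDist ω w (stepFun Δx (U n))
      ≤ -(Δt / Δx) * (∫ z, ω z * (pairNumFlux F Δx w (stepFun Δx (U n)) z
          - pairNumFlux F Δx w (stepFun Δx (U n)) (z + Δx)))
        - Δt * (∫ z, ω z * pairDiscJump c lam Δx w (U (n + 1)) z) + Δt * ρ := by
    have iRS := (iR.const_mul (-(Δt / Δx))).sub (iS.const_mul Δt)
    have iρ := hω.integrable.const_mul (Δt * ρ)
    calc _ = ∫ z, (ω z * pairDist w (stepFun Δx (U (n + 1))) z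
          - ω z * pairDist w (stepFun Δx (U n)) z) := (integral_sub iW iV).symm
      _ ≤ _ := integral_mono (iW.sub iV) (iRS.add iρ) fun z => by
          have := mul_le_mul_of_nonneg_left
            (pairDist_step_le hlam hc hΔ hΔt hF hcfl hw hU hn z) (hω.nonneg z)
          simp only [Pi.add_apply, Pi.sub_apply]
          linarith
      _ = _ := by
          rw [integral_add' iRS iρ, integral_sub' (iR.const_mul (-(Δt / Δx))) (iS.const_mul Δt),
            integral_const_mul, integral_const_mul, integral_const_mul, hω.integral_eq, mul_one]
  have h1 := mul_le_mul_of_nonneg_left hconv hr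
  have h2 := mul_le_mul_of_nonneg_left hjump hΔt.le
  refine key.trans ?_
  have e1 : Δt / Δx * (-(Δx * ∫ z, deriv ω z * pairFlux f w (stepFun Δx (U (n + 1))) z)
        + (4 * K * Δx / h * (3 * F₂ * (C * Δx) + 2 * (F₁ + F₂) * (Δt * L))
          + 16 * K * (F₁ + F₂) * C * (Δx ^ 2 / h)))
      = -(Δt * ∫ z, deriv ω z * pairFlux f w (stepFun Δx (U (n + 1))) z)
        + Δt * ((4 * K * (3 * F₂ * (C * Δx) + 2 * (F₁ + F₂) * (Δt * L))
          + 16 * K * (F₁ + F₂) * C * Δx) / h) := by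
    field_simp
  have e2 : Δt * stepError c lam F₁ F₂ K C M L ρ h Δx Δt
      = Δt * ((4 * K * (3 * F₂ * (C * Δx) + 2 * (F₁ + F₂) * (Δt * L))
          + 16 * K * (F₁ + F₂) * C * Δx) / h)
        + Δt * (8 * K * Δx / h * ((C + 2 * M) * dConst c lam)) + Δt * ρ := by
    unfold stepError; ring
  rw [e1] at h1
  rw [e2, smoothProd]
  linarith

end Step

/-! ### A measurable representative of the solution -/

section Representative

variable {c lam T : ℝ} {f u₀ : ℝ → ℝ} {u : ℝ → ℝ → ℝ}

lemma volume_restrict_strip (T : ℝ) : (volume.restrict (strip T) : Measure (ℝ × ℝ))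
    = (volume : Measure ℝ).prod (volume.restrict (Ioo 0 T)) := by
  rw [strip, Measure.volume_eq_prod, ← Measure.prod_restrict, Measure.restrict_univ]

/-- The nonlocal operator depends on the value at `x` and on the almost everywhere class. -/
lemma fracLap_congr_ae {w v : ℝ → ℝ} (h : w =ᵐ[volume] v) {x : ℝ} (hx : w x = v x) :
    fracLap c lam w x = fracLap c lam v x := by
  rw [fracLap_eq, fracLap_eq]
  congr 1
  refine integral_congr_ae ?_
  have h2 : (fun z => w (x + z)) =ᵐ[volume] fun z => v (x + z) :=
    (measurePreserving_add_left volume x).quasiMeasurePreserving.ae_eq_comp h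
  filter_upwards [h2] with z hz
  rw [hz, hx]

/-- The `L¹` norm of a solution is bounded uniformly in time. -/
lemma IsBVEntropySolution.exists_norm_le (hu : IsBVEntropySolution c lam T f u₀ u) :
    ∃ M : ℝ, 0 ≤ M ∧ ∀ t ∈ Icc 0 T, ∫ x, |u x t| ≤ M := by
  have hcont : ContinuousOn (fun t => ∫ x, |u x t|) (Icc 0 T) := by
    intro t ht
    have h1 := hu.continuousL1 t ht
    have h2 : Tendsto (fun s => (eLpNorm (fun x => u x s - u x t) 1 volume).toReal)
        (𝓝[Icc 0 T] t) (𝓝 0) := by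
      exact (ENNReal.tendsto_toReal ENNReal.zero_ne_top).comp h1
    rw [ContinuousWithinAt, tendsto_iff_norm_sub_tendsto_zero]
    refine tendsto_of_tendsto_of_tendsto_of_le_of_le' tendsto_const_nhds h2
      (Eventually.of_forall fun s => norm_nonneg _) ?_
    filter_upwards [self_mem_nhdsWithin] with s hs
    have i1 := hu.memL1 s hs
    have i2 := hu.memL1 t ht
    have e : (eLpNorm (fun x => u x s - u x t) 1 volume).toReal = ∫ x, |u x s - u x t| := by
      have i3 : Integrable fun x => u x s - u x t := i1.sub i2
      rw [eLpNorm_one_eq_lintegral_enorm, ← integral_norm_eq_lintegral_enorm i3.1]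
      rfl
    rw [e, ← integral_sub i1.abs i2.abs]
    exact abs_integral_le_integral_abs.trans (integral_mono (i1.abs.sub i2.abs).abs
      (i1.sub i2).abs fun x => abs_abs_sub_abs_le_abs_sub _ _)
  obtain ⟨M, hM⟩ := isCompact_Icc.exists_bound_of_continuousOn hcont
  refine ⟨max M 0, le_max_right _ _, fun t ht => (le_abs_self _).trans ((hM t ht).trans
    (le_max_left _ _))⟩

/-- A solution has a Borel representative on the strip all of whose time slices are controlled
in `L¹` and in variation, and which gives the same nonlocal term almost everywhere. -/
lemma IsBVEntropySolution.exists_representative (hu : IsBVEntropySolution c lam T f u₀ u) :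
    ∃ (C M : ℝ) (v : ℝ × ℝ → ℝ), Measurable v ∧ (∀ t, L1BVWith C M fun x => v (x, t)) ∧
      ∀ᵐ p ∂(volume.restrict (strip T)), u p.1 p.2 = v p ∧
        fracLap c lam (fun x => u x p.2) p.1 = fracLap c lam (fun x => v (x, p.2)) p.1 := by
  obtain ⟨M, hM0, hM⟩ := hu.exists_norm_le
  obtain ⟨C, hC⟩ := hu.boundedBV
  have hae := hu.memLinfty.1
  set v₀ := hae.mk (fun p : ℝ × ℝ => u p.1 p.2) with hv₀
  have hv₀m : Measurable v₀ := hae.measurable_mk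
  have hv₀e : ∀ᵐ p ∂(volume.restrict (strip T)), u p.1 p.2 = v₀ p := hae.ae_eq_mk
  have hslice : ∀ᵐ t ∂(volume.restrict (Ioo 0 T)), ∀ᵐ x, u x t = v₀ (x, t) := by
    rw [volume_restrict_strip] at hv₀e
    have := (Measure.measurePreserving_swap (μ := volume.restrict (Ioo 0 T))
      (ν := (volume : Measure ℝ))).quasiMeasurePreserving.ae hv₀e
    exact Measure.ae_ae_of_ae_prod this
  have hgood : ∀ᵐ t ∂(volume.restrict (Ioo 0 T)), t ∈ Ioo 0 T ∧ (∀ᵐ x, u x t = v₀ (x, t)) ∧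
      essVariation (fun x => u x t) ≤ C := by
    filter_upwards [hslice, hC, ae_restrict_mem measurableSet_Ioo] with t h1 h2 h3
    exact ⟨h3, h1, h2⟩
  -- The times with a bad slice are put into a measurable null set, where the representative is
  -- zero.
  obtain ⟨S, hSsub, hSm, hS0⟩ := exists_measurable_superset (volume.restrict (Ioo 0 T))
      {t | ¬(t ∈ Ioo 0 T ∧ (∀ᵐ x, u x t = v₀ (x, t)) ∧ essVariation (fun x => u x t) ≤ C)}
  have hSg : ∀ t, t ∉ S → t ∈ Ioo 0 T ∧ (∀ᵐ x, u x t = v₀ (x, t)) ∧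
      essVariation (fun x => u x t) ≤ C := fun t ht => by
    by_contra hcon
    exact ht (hSsub hcon)
  have hSae : ∀ᵐ t ∂(volume.restrict (Ioo 0 T)), t ∉ S := by
    rw [ae_iff]
    simp only [not_not]
    exact hS0.trans (ae_iff.1 hgood)
  refine ⟨C + 1, M, Prod.snd ⁻¹' Sᶜ |>.indicator v₀,
    hv₀m.indicator (measurable_snd hSm.compl), fun t => ?_, ?_⟩
  · by_cases ht : t ∈ S
    · have e : (fun x => (Prod.snd ⁻¹' Sᶜ).indicator v₀ (x, t)) = fun _ => (0 : ℝ) := by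
        ext x
        exact indicator_of_notMem (by simpa using ht) _
      rw [e]
      exact ⟨measurable_const, integrable_zero _ _ _, by simpa using hM0,
        fun z => by simp; positivity⟩
    · have e : (fun x => (Prod.snd ⁻¹' Sᶜ).indicator v₀ (x, t)) = fun x => v₀ (x, t) := by
        ext x
        exact indicator_of_mem (by simpa using ht) _
      obtain ⟨htI, htu, htv⟩ := hSg t ht
      have hti := hu.memL1 t (Ioo_subset_Icc_self htI)
      have htl := transLip_of_essVariation_le hti htv
      rw [e]
      refine ⟨hv₀m.comp (measurable_id.prodMk measurable_const), hti.congr htu, ?_, fun z => ?_⟩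
      · refine le_trans (le_of_eq (integral_congr_ae ?_)) (hM t (Ioo_subset_Icc_self htI))
        filter_upwards [htu] with x hx
        rw [hx]
      · refine le_trans (le_of_eq (integral_congr_ae ?_)) (htl z)
        have h2 : ∀ᵐ x, u (x + z) t = v₀ (x + z, t) :=
          (measurePreserving_add_right volume z).quasiMeasurePreserving.ae htu
        filter_upwards [htu, h2] with x hx hx2
        rw [hx, hx2]
  · have hS2 : ∀ᵐ p ∂(volume.restrict (strip T)), p.2 ∉ S := by
      rw [volume_restrict_strip]
      exact Measure.quasiMeasurePreserving_snd.ae hSae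
    filter_upwards [hv₀e, hS2] with p hp hpS
    have e : ∀ x, (Prod.snd ⁻¹' Sᶜ).indicator v₀ (x, p.2) = v₀ (x, p.2) := fun x =>
      indicator_of_mem (by simpa using hpS) _
    have e1 : (Prod.snd ⁻¹' Sᶜ).indicator v₀ p = v₀ p := e p.1
    refine ⟨hp.trans e1.symm, ?_⟩
    simp only [e]
    exact fracLap_congr_ae (hSg p.2 hpS).2.1 hp

end Representative

/-! ### The averaged entropy inequality -/

section Fubini

/-- Integrability of the doubled integrands: `a` is controlled by integrating the kernel in `y`, and
`b` by integrating it in the other variable. -/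
lemma integrable_kernel_pair {α : Type*} [MeasurableSpace α] {μ : Measure α} [SFinite μ]
    {X : α → ℝ} (hXm : Measurable X) {κ : ℝ → ℝ} (hκm : Measurable κ) (hκ : Integrable κ)
    (hX : ∀ y, Integrable (fun p => κ (X p - y)) μ) {B : ℝ}
    (hB : ∀ y, ∫ p, |κ (X p - y)| ∂μ ≤ B) {H : α → ℝ → ℝ}
    (hH : Measurable (Function.uncurry H)) {a : α → ℝ} {b : ℝ → ℝ} (ha : Integrable a μ)
    (hb : Integrable b) (ham : Measurable a) (hbm : Measurable b)
    (hHle : ∀ p y, |H p y| ≤ |a p| + |b y|) :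
    Integrable (fun q : α × ℝ => κ (X q.1 - q.2) * H q.1 q.2) (μ.prod volume) := by
  have i1 : Integrable (fun q : α × ℝ => κ (X q.1 - q.2) * a q.1) (μ.prod volume) := by
    have hm : Measurable (fun q : α × ℝ => κ (X q.1 - q.2) * a q.1) := by fun_prop
    rw [integrable_prod_iff hm.aestronglyMeasurable]
    refine ⟨ae_of_all _ fun p => (hκ.comp_sub_left (X p)).mul_const (a p), ?_⟩
    have e : ∀ p, ∫ y, ‖κ (X p - y) * a p‖ = (∫ y, |κ y|) * |a p| := fun p => by
      simp only [Real.norm_eq_abs, abs_mul]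
      rw [integral_mul_const, integral_sub_left_eq_self (fun y => |κ y|)]
    simp only [e]
    exact ha.abs.const_mul _
  have i2 : Integrable (fun q : α × ℝ => κ (X q.1 - q.2) * b q.2) (μ.prod volume) := by
    have hm : Measurable (fun q : α × ℝ => κ (X q.1 - q.2) * b q.2) := by fun_prop
    rw [integrable_prod_iff' hm.aestronglyMeasurable]
    refine ⟨ae_of_all _ fun y => (hX y).mul_const (b y), ?_⟩
    refine (hb.abs.const_mul B).mono' ?_ (ae_of_all _ fun y => ?_)
    · exact (hm.norm.stronglyMeasurable.integral_prod_left (μ := μ)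
        (f := fun p y => ‖κ (X p - y) * b y‖)).aestronglyMeasurable
    · rw [Real.norm_of_nonneg (integral_nonneg fun x => norm_nonneg _)]
      simp only [Real.norm_eq_abs, abs_mul]
      rw [integral_mul_const]
      exact mul_le_mul_of_nonneg_right (hB y) (abs_nonneg _)
  have hm : Measurable (fun q : α × ℝ => κ (X q.1 - q.2) * H q.1 q.2) := by
    have : Measurable fun q : α × ℝ => H q.1 q.2 := hH
    fun_prop
  refine (i1.abs.add i2.abs).mono' hm.aestronglyMeasurable (ae_of_all _ fun q => ?_)
  rw [Real.norm_eq_abs, abs_mul, Pi.add_apply, abs_mul, abs_mul, ← mul_add]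
  exact mul_le_mul_of_nonneg_left (hHle _ _) (abs_nonneg _)

section Plane

variable {κ : ℝ → ℝ} {H : ℝ → ℝ → ℝ} {a b : ℝ → ℝ}

lemma integrable_kernel_sub (hκm : Measurable κ) (hκ : Integrable κ)
    (hH : Measurable (Function.uncurry H)) (ha : Integrable a) (hb : Integrable b)
    (ham : Measurable a) (hbm : Measurable b) (hHle : ∀ x y, |H x y| ≤ |a x| + |b y|) :
    Integrable (fun q : ℝ × ℝ => κ (q.1 - q.2) * H q.1 q.2) (volume.prod volume) :=
  integrable_kernel_pair measurable_id hκm hκ (fun y => hκ.comp_sub_right y)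
    (fun y => (integral_sub_right_eq_self (fun x => |κ x|) y).le) hH ha hb ham hbm hHle

lemma integrable_kernel_shift (hκm : Measurable κ) (hκ : Integrable κ)
    (hH : Measurable (Function.uncurry H)) (ha : Integrable a) (hb : Integrable b)
    (hHle : ∀ x y, |H x y| ≤ |a x| + |b y|) :
    Integrable (fun q : ℝ × ℝ => κ q.2 * H q.1 (q.1 - q.2)) (volume.prod volume) := by
  have hm : Measurable fun q : ℝ × ℝ => H q.1 (q.1 - q.2) :=
    hH.comp (measurable_fst.prodMk (measurable_fst.sub measurable_snd))
  have i1 := ha.abs.mul_prod hκ.abs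
  have i2 : Integrable (fun q : ℝ × ℝ => |κ q.2| * |b (q.1 - q.2)|) (volume.prod volume) :=
    Integrable.convolution_integrand (ContinuousLinearMap.mul ℝ ℝ) hκ.abs hb.abs
  refine (i1.add i2).mono' (by fun_prop) (ae_of_all _ fun q => ?_)
  rw [Real.norm_eq_abs, abs_mul, Pi.add_apply, mul_comm |a q.1|, ← mul_add]
  exact mul_le_mul_of_nonneg_left (hHle _ _) (abs_nonneg _)

lemma integral_kernel_shift (hκm : Measurable κ) (hκ : Integrable κ)
    (hH : Measurable (Function.uncurry H)) (ha : Integrable a) (hb : Integrable b)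
    (hHle : ∀ x y, |H x y| ≤ |a x| + |b y|) :
    ∫ x, ∫ z, κ z * H x (x - z) = ∫ z, κ z * ∫ x, H x (x - z) := by
  rw [integral_integral_swap (integrable_kernel_shift hκm hκ hH ha hb hHle)]
  simp only [integral_const_mul]

lemma integral_kernel_sub (hκm : Measurable κ) (hκ : Integrable κ)
    (hH : Measurable (Function.uncurry H)) (ha : Integrable a) (hb : Integrable b)
    (ham : Measurable a) (hbm : Measurable b) (hHle : ∀ x y, |H x y| ≤ |a x| + |b y|) :
    ∫ y, ∫ x, κ (x - y) * H x y = ∫ z, κ z * ∫ x, H x (x - z) := by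
  rw [← integral_kernel_shift hκm hκ hH ha hb hHle,
    ← integral_integral_swap (integrable_kernel_sub hκm hκ hH ha hb ham hbm hHle)]
  congr 1; ext x
  rw [← integral_sub_left_eq_self (fun z => κ z * H x (x - z)) volume x]
  simp only [sub_sub_cancel]

end Plane

end Fubini

section Averaged

variable {c lam T h K C M C' M' : ℝ} {f u₀ ω η : ℝ → ℝ} {u : ℝ → ℝ → ℝ} {v : ℝ → ℝ}
  {ub : ℝ × ℝ → ℝ}

lemma measurable_fracLap_slice (hub : Measurable ub) :
    Measurable fun p : ℝ × ℝ => fracLap c lam (fun x => ub (x, p.2)) p.1 := by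
  have hk := measurable_singKer lam
  have hm : Measurable fun q : (ℝ × ℝ) × ℝ =>
      (ub (q.1.1 + q.2, q.1.2) - ub (q.1.1, q.1.2)) * singKer lam q.2 := by fun_prop
  have h1 := ((hm.stronglyMeasurable.integral_prod_right (ν := volume)
    (f := fun (p : ℝ × ℝ) (z : ℝ) =>
      (ub (p.1 + z, p.2) - ub (p.1, p.2)) * singKer lam z)).measurable).const_mul c
  have e : (fun p : ℝ × ℝ => fracLap c lam (fun x => ub (x, p.2)) p.1)
      = fun p => c * ∫ z, (ub (p.1 + z, p.2) - ub (p.1, p.2)) * singKer lam z :=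
    funext fun p => fracLap_eq c lam _ _
  rw [e]; exact h1

lemma integrable_strip_of_slice {g : ℝ × ℝ → ℝ} (hg : Measurable g)
    (hi : ∀ t, Integrable fun x => g (x, t)) {B : ℝ} (hB : ∀ t, ∫ x, |g (x, t)| ≤ B) :
    Integrable g ((volume : Measure ℝ).prod (volume.restrict (Ioo 0 T))) := by
  rw [integrable_prod_iff' hg.aestronglyMeasurable]
  refine ⟨ae_of_all _ hi, ?_⟩
  refine Integrable.mono' (g := fun _ => B) (integrable_const _) ?_ (ae_of_all _ fun t => ?_)
  · exact (hg.norm.stronglyMeasurable.integral_prod_left (μ := volume)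
      (f := fun x t => ‖g (x, t)‖)).aestronglyMeasurable
  · rw [Real.norm_of_nonneg (integral_nonneg fun x => norm_nonneg _)]
    exact hB t

/-- The test functions used in the doubling argument. -/
lemma isTestFunction_kernel (hω : IsMollifier ω h K) (hη : ContDiff ℝ (⊤ : ℕ∞) η)
    (hηc : HasCompactSupport η) (hη0 : ∀ t ∈ Icc 0 T, 0 ≤ η t) (y : ℝ) :
    IsTestFunction T fun x t => ω (x - y) * η t where
  smooth := (hω.smooth.comp (contDiff_fst.sub contDiff_const)).mul (hη.comp contDiff_snd)
  compact := by
    refine HasCompactSupport.of_support_subset_isCompact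
      ((isCompact_Icc (a := y - h) (b := y + h)).prod hηc) fun p hp => ?_
    have h1 : ω (p.1 - y) ≠ 0 := left_ne_zero_of_mul hp
    have h2 : η p.2 ≠ 0 := right_ne_zero_of_mul hp
    refine ⟨?_, subset_tsupport _ h2⟩
    by_contra hcon
    refine h1 (hω.eq_zero _ (not_lt.1 fun hlt => hcon ?_))
    have := abs_lt.1 hlt
    exact ⟨by linarith [this.1], by linarith [this.2]⟩
  nonneg := fun x t ht => mul_nonneg (hω.nonneg _) (hη0 t ht)

/-- The entropy inequality with the Kružkov constant `k = v(y)` and a test function centred at `y`,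
integrated over `y`. -/
lemma entropy_averaged_of_hasCompactSupport (hT : 0 < T) (hlam : lam ∈ Ioo (0 : ℝ) 1)
    (hc : 0 < c)
    {L : NNReal} (hf : LipschitzWith L f) (hu : IsBVEntropySolution c lam T f u₀ u)
    (hub : Measurable ub) (hubt : ∀ t, L1BVWith C M fun x => ub (x, t))
    (hue : ∀ᵐ p ∂(volume.restrict (strip T)), u p.1 p.2 = ub p ∧
        fracLap c lam (fun x => u x p.2) p.1 = fracLap c lam (fun x => ub (x, p.2)) p.1)
    {a₀ aT : ℝ → ℝ} (ha₀ : Integrable a₀) (haT : Integrable aT) (ha₀m : Measurable a₀)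
    (haTm : Measurable aT) (h0 : u₀ =ᵐ[volume] a₀) (h1 : (fun x => u x T) =ᵐ[volume] aT)
    (hv : L1BVWith C' M' v) (hω : IsMollifier ω h K) (hη : ContDiff ℝ (⊤ : ℕ∞) η)
    (hηc : HasCompactSupport η) (hη0 : ∀ t ∈ Icc 0 T, 0 ≤ η t) :
    0 ≤ (∫ t in Ioo 0 T, (deriv η t * smoothDist ω (fun x => ub (x, t)) v
          + η t * smoothProd ω c lam f (fun x => ub (x, t)) v))
        + η 0 * smoothDist ω a₀ v - η T * smoothDist ω aT v := by
  have hs := measurable_sign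
  have hvm := hv.meas
  have hηcont : Continuous η := hη.continuous
  have hηd : Continuous (deriv η) := (contDiff_infty_iff_deriv.1 hη).2.continuous
  obtain ⟨B₁, hB₁⟩ := hηd.bounded_above_of_compact_support hηc.deriv
  obtain ⟨B₂, hB₂⟩ := hηcont.bounded_above_of_compact_support hηc
  have hB₁0 : 0 ≤ B₁ := (norm_nonneg _).trans (hB₁ 0)
  have hB₂0 : 0 ≤ B₂ := (norm_nonneg _).trans (hB₂ 0)
  have hωm : Measurable ω := hω.continuous.measurable
  have hω'm : Measurable (deriv ω) := hω.continuous_deriv.measurable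
  set Gu : ℝ × ℝ → ℝ := fun p => fracLap c lam (fun x => ub (x, p.2)) p.1 with hGu
  have hGum : Measurable Gu := measurable_fracLap_slice hub
  set μ : Measure (ℝ × ℝ) := (volume : Measure ℝ).prod (volume.restrict (Ioo 0 T)) with hμ
  have hubi : Integrable ub μ :=
    integrable_strip_of_slice hub (fun t => (hubt t).int) fun t => (hubt t).norm_le
  have hGui : Integrable Gu μ :=
    integrable_strip_of_slice hGum (fun t => (hubt t).integrable_fracLap hlam c)
      fun t => (hubt t).integral_abs_fracLap_le hlam hc
  set H₁ : ℝ × ℝ → ℝ → ℝ := fun p y => |ub p - v y| * deriv η p.2 with hH₁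
  set H₂ : ℝ × ℝ → ℝ → ℝ := fun p y => kruzkovFlux f (ub p) (v y) * η p.2 with hH₂
  set H₃ : ℝ × ℝ → ℝ → ℝ := fun p y => Real.sign (ub p - v y) * Gu p * η p.2 with hH₃
  have habsm : Measurable fun x : ℝ => |x| := continuous_abs.measurable
  have hH₁m : Measurable (Function.uncurry H₁) := by
    have : Measurable fun q : (ℝ × ℝ) × ℝ => |ub q.1 - v q.2| * deriv η q.1.2 := by
      have := hηd.measurable
      fun_prop
    exact this
  have hH₂m : Measurable (Function.uncurry H₂) := by
    have h1 : Measurable fun q : (ℝ × ℝ) × ℝ => kruzkovFlux f (ub q.1) (v q.2) :=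
      (measurable_kruzkovFlux hf.continuous).comp
        ((hub.comp measurable_fst).prodMk (hvm.comp measurable_snd))
    have h2 : Measurable fun q : (ℝ × ℝ) × ℝ => η q.1.2 := by fun_prop
    exact h1.mul h2
  have hH₃m : Measurable (Function.uncurry H₃) := by
    have : Measurable fun q : (ℝ × ℝ) × ℝ => Real.sign (ub q.1 - v q.2) * Gu q.1 * η q.1.2 := by
      fun_prop
    exact this
  have hH₁le : ∀ p y, |H₁ p y| ≤ |B₁ * ub p| + |B₁ * v y| := fun p y => by
    rw [hH₁, abs_mul, abs_mul, abs_mul, abs_abs, abs_of_nonneg hB₁0, ← mul_add, mul_comm]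
    exact mul_le_mul (hB₁ _) (abs_sub _ _) (abs_nonneg _) hB₁0
  have hH₂le : ∀ p y, |H₂ p y| ≤ |2 * L * B₂ * ub p| + |2 * L * B₂ * v y| := fun p y => by
    have hL := L.coe_nonneg
    have h2 : (0 : ℝ) ≤ 2 * L * B₂ := by positivity
    rw [hH₂, abs_mul, abs_mul _ (ub p), abs_mul _ (v y), abs_of_nonneg h2, ← mul_add]
    calc _ ≤ 2 * L * (|ub p| + |v y|) * B₂ :=
          mul_le_mul (abs_kruzkovFlux_le hf _ _) (hB₂ _) (abs_nonneg _) (by positivity)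
      _ = _ := by ring
  have hH₃le : ∀ p y, |H₃ p y| ≤ |B₂ * Gu p| + |(0 : ℝ)| := fun p y => by
    rw [hH₃, abs_zero, add_zero, abs_mul, abs_mul B₂, abs_of_nonneg hB₂0, mul_comm]
    exact mul_le_mul (hB₂ _) (abs_sign_mul_le _ _) (abs_nonneg _) hB₂0
  have hXκ : ∀ {κ : ℝ → ℝ}, Integrable κ → ∀ y, Integrable (fun p : ℝ × ℝ => κ (p.1 - y)) μ :=
    fun {κ} hκ y => by
      have := (hκ.comp_sub_right y).mul_prod
        (integrable_const (1 : ℝ) (μ := volume.restrict (Ioo 0 T)))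
      simpa using this
  have hXB : ∀ {κ : ℝ → ℝ}, Integrable κ → ∀ y, ∫ p : ℝ × ℝ, |κ (p.1 - y)| ∂μ
      ≤ (∫ x, |κ x|) * T := fun {κ} hκ y => by
    have h2 := integral_prod_mul (μ := volume) (ν := volume.restrict (Ioo 0 T))
      (fun x => |κ (x - y)|) (fun _ => (1 : ℝ))
    simp only [mul_one] at h2
    rw [hμ, h2, integral_sub_right_eq_self (fun x => |κ x|) y]
    simp [hT.le]
  have iΦ₁ := integrable_kernel_pair (μ := μ) measurable_fst hωm hω.integrable
    (hXκ hω.integrable) (hXB hω.integrable) hH₁m (hubi.const_mul B₁) (hv.int.const_mul B₁)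
    (hub.const_mul _) (hvm.const_mul _) hH₁le
  have iΦ₂ := integrable_kernel_pair (μ := μ) measurable_fst hω'm hω.integrable_deriv
    (hXκ hω.integrable_deriv) (hXB hω.integrable_deriv) hH₂m (hubi.const_mul (2 * L * B₂))
    (hv.int.const_mul (2 * L * B₂)) (hub.const_mul _) (hvm.const_mul _) hH₂le
  have iΦ₃ := integrable_kernel_pair (μ := μ) measurable_fst hωm hω.integrable
    (hXκ hω.integrable) (hXB hω.integrable) hH₃m (hGui.const_mul B₂) (integrable_zero ℝ ℝ volume)
    (hGum.const_mul _) measurable_const hH₃le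
  set Φ : (ℝ × ℝ) × ℝ → ℝ := fun q => ω (q.1.1 - q.2) * H₁ q.1 q.2
    + deriv ω (q.1.1 - q.2) * H₂ q.1 q.2 + ω (q.1.1 - q.2) * H₃ q.1 q.2 with hΦ
  have iΦ : Integrable Φ (μ.prod volume) := (iΦ₁.add iΦ₂).add iΦ₃
  -- the entropy inequality for each `y`
  have hineq : ∀ y, 0 ≤ (∫ p, Φ (p, y) ∂μ) + (∫ x, ω (x - y) * |a₀ x - v y|) * η 0
      - (∫ x, ω (x - y) * |aT x - v y|) * η T := by
    intro y
    have := hu.entropyIneq (v y) _ (isTestFunction_kernel hω hη hηc hη0 y)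
    have e0 : (∫ x, ω (x - y) * |a₀ x - v y|) * η 0 = ∫ x, ω (x - y) * |a₀ x - v y| * η 0 :=
      (integral_mul_const _ _).symm
    have eT : (∫ x, ω (x - y) * |aT x - v y|) * η T = ∫ x, ω (x - y) * |aT x - v y| * η T :=
      (integral_mul_const _ _).symm
    rw [e0, eT]
    refine this.trans (le_of_eq ?_)
    refine congrArg₂ (· - ·) (congrArg₂ (· + ·) ?_ ?_) ?_
    · rw [hμ, ← volume_restrict_strip]
      refine integral_congr_ae ?_
      filter_upwards [hue] with p hp
      rw [hp.1, hp.2, entropyFlux_eq, deriv_const_mul_field, deriv_mul_const_field,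
        deriv_comp_sub_const]
      simp only [hΦ, hH₁, hH₂, hH₃, hGu, entropy, entropyDeriv]
      ring
    · refine integral_congr_ae ?_
      filter_upwards [h0] with x hx
      rw [hx]; simp only [entropy]; ring
    · refine integral_congr_ae ?_
      filter_upwards [h1] with x hx
      rw [hx]; simp only [entropy]; ring
  have hdm : ∀ {a : ℝ → ℝ}, Measurable a → Measurable (Function.uncurry fun x y => |a x - v y|) :=
    fun {a} ha => by
      have : Measurable fun q : ℝ × ℝ => |a q.1 - v q.2| := by fun_prop
      exact this
  have i₀ := (integrable_kernel_sub hωm hω.integrable (hdm ha₀m) ha₀ hv.int ha₀m hvm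
    fun x y => (abs_abs _).trans_le (abs_sub _ _))
  have iT := (integrable_kernel_sub hωm hω.integrable (hdm haTm) haT hv.int haTm hvm
    fun x y => (abs_abs _).trans_le (abs_sub _ _))
  have hsum : 0 ≤ ∫ y, ((∫ p, Φ (p, y) ∂μ) + (∫ x, ω (x - y) * |a₀ x - v y|) * η 0
      - (∫ x, ω (x - y) * |aT x - v y|) * η T) := integral_nonneg hineq
  have iI : Integrable fun y => ∫ p, Φ (p, y) ∂μ := iΦ.integral_prod_right
  have iI₀ : Integrable fun y => (∫ x, ω (x - y) * |a₀ x - v y|) * η 0 :=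
    i₀.integral_prod_right.mul_const _
  have iIT : Integrable fun y => (∫ x, ω (x - y) * |aT x - v y|) * η T :=
    iT.integral_prod_right.mul_const _
  have iII : Integrable fun y => (∫ p, Φ (p, y) ∂μ) + (∫ x, ω (x - y) * |a₀ x - v y|) * η 0 :=
    iI.add iI₀
  rw [integral_sub iII iIT, integral_add iI iI₀, integral_mul_const, integral_mul_const,
    integral_kernel_sub hωm hω.integrable (hdm ha₀m) ha₀ hv.int ha₀m hvm
      (fun x y => (abs_abs _).trans_le (abs_sub _ _)),
    integral_kernel_sub hωm hω.integrable (hdm haTm) haT hv.int haTm hvm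
      (fun x y => (abs_abs _).trans_le (abs_sub _ _))] at hsum
  refine hsum.trans (le_of_eq ?_)
  rw [mul_comm (η 0), mul_comm (η T)]
  change _ + smoothDist ω a₀ v * η 0 - smoothDist ω aT v * η T = _
  congr 2
  -- exchange the order of integration and shift `y = x - z`
  have hswap : ∫ y : ℝ, ∫ p : ℝ × ℝ, Φ (p, y) ∂μ = ∫ p : ℝ × ℝ, (∫ y : ℝ, Φ (p, y)) ∂μ :=
    (integral_integral_swap (f := fun (p : ℝ × ℝ) (y : ℝ) => Φ (p, y)) iΦ).symm
  rw [hswap, hμ, integral_prod_symm _ iΦ.integral_prod_left]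
  refine setIntegral_congr_fun measurableSet_Ioo fun t _ => ?_
  set w : ℝ → ℝ := fun x => ub (x, t) with hw
  have hwL : L1BVWith C M w := hubt t
  have hmk : Measurable fun q : ℝ × ℝ => ((q.1, t), q.2) := by fun_prop
  have k₁ : Measurable (Function.uncurry fun x y => H₁ (x, t) y) := hH₁m.comp hmk
  have k₂ : Measurable (Function.uncurry fun x y => H₂ (x, t) y) := hH₂m.comp hmk
  have k₃ : Measurable (Function.uncurry fun x y => H₃ (x, t) y) := hH₃m.comp hmk
  have hgi := hwL.integrable_fracLap hlam c
  have hgm : Measurable (fracLap c lam w) := L1BVWith.measurable_fracLap hwL.meas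
  have j₁ := integrable_kernel_shift hωm hω.integrable k₁ (hwL.int.const_mul B₁)
    (hv.int.const_mul B₁) fun x y => hH₁le (x, t) y
  have j₂ := integrable_kernel_shift hω'm hω.integrable_deriv k₂ (hwL.int.const_mul (2 * L * B₂))
    (hv.int.const_mul (2 * L * B₂)) fun x y => hH₂le (x, t) y
  have j₃ := integrable_kernel_shift hωm hω.integrable k₃ (hgi.const_mul B₂)
    (integrable_zero ℝ ℝ volume) fun x y => hH₃le (x, t) y
  have e₁ := integral_kernel_shift hωm hω.integrable k₁ (hwL.int.const_mul B₁)
    (hv.int.const_mul B₁) fun x y => hH₁le (x, t) y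
  have e₂ := integral_kernel_shift hω'm hω.integrable_deriv k₂ (hwL.int.const_mul (2 * L * B₂))
    (hv.int.const_mul (2 * L * B₂)) fun x y => hH₂le (x, t) y
  have e₃ := integral_kernel_shift hωm hω.integrable k₃ (hgi.const_mul B₂)
    (integrable_zero ℝ ℝ volume) fun x y => hH₃le (x, t) y
  have ez : ∀ x, ∫ y, Φ ((x, t), y) = ∫ z, (ω z * H₁ (x, t) (x - z)
      + deriv ω z * H₂ (x, t) (x - z) + ω z * H₃ (x, t) (x - z)) := fun x => by
    rw [← integral_sub_left_eq_self (fun y => Φ ((x, t), y)) volume x]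
    simp only [hΦ, sub_sub_cancel]
  simp only [ez]
  have j₁₂ : Integrable (fun q : ℝ × ℝ => ω q.2 * H₁ (q.1, t) (q.1 - q.2)
      + deriv ω q.2 * H₂ (q.1, t) (q.1 - q.2)) (volume.prod volume) := j₁.add j₂
  have l₁ : ∫ x, ∫ z, (ω z * H₁ (x, t) (x - z) + deriv ω z * H₂ (x, t) (x - z)
        + ω z * H₃ (x, t) (x - z))
      = (∫ x, ∫ z, (ω z * H₁ (x, t) (x - z) + deriv ω z * H₂ (x, t) (x - z)))
        + ∫ x, ∫ z, ω z * H₃ (x, t) (x - z) := integral_integral_add j₁₂ j₃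
  have l₂ : ∫ x, ∫ z, (ω z * H₁ (x, t) (x - z) + deriv ω z * H₂ (x, t) (x - z))
      = (∫ x, ∫ z, ω z * H₁ (x, t) (x - z)) + ∫ x, ∫ z, deriv ω z * H₂ (x, t) (x - z) :=
    integral_integral_add j₁ j₂
  rw [l₁, l₂, e₁, e₂, e₃]
  simp only [hH₁, hH₂, hH₃, hGu, integral_mul_const, ← mul_assoc, smoothDist, smoothProd,
    pairDist, pairFlux, pairJump]
  ring

/-- The averaged entropy inequality for an arbitrary smooth weight in time. -/
lemma entropy_averaged (hT : 0 < T) (hlam : lam ∈ Ioo (0 : ℝ) 1) (hc : 0 < c)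
    {L : NNReal} (hf : LipschitzWith L f) (hu : IsBVEntropySolution c lam T f u₀ u)
    (hub : Measurable ub) (hubt : ∀ t, L1BVWith C M fun x => ub (x, t))
    (hue : ∀ᵐ p ∂(volume.restrict (strip T)), u p.1 p.2 = ub p ∧
        fracLap c lam (fun x => u x p.2) p.1 = fracLap c lam (fun x => ub (x, p.2)) p.1)
    {a₀ aT : ℝ → ℝ} (ha₀ : Integrable a₀) (haT : Integrable aT) (ha₀m : Measurable a₀)
    (haTm : Measurable aT) (h0 : u₀ =ᵐ[volume] a₀) (h1 : (fun x => u x T) =ᵐ[volume] aT)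
    (hv : L1BVWith C' M' v) (hω : IsMollifier ω h K) (hη : ContDiff ℝ (⊤ : ℕ∞) η)
    (hη0 : ∀ t ∈ Icc 0 T, 0 ≤ η t) :
    0 ≤ (∫ t in Ioo 0 T, (deriv η t * smoothDist ω (fun x => ub (x, t)) v
          + η t * smoothProd ω c lam f (fun x => ub (x, t)) v))
        + η 0 * smoothDist ω a₀ v - η T * smoothDist ω aT v := by
  -- a cutoff in time equal to `1` in a neighbourhood of `[0, T]`
  let b : ContDiffBump (T / 2) := ⟨T, 2 * T, hT, by linarith⟩
  have hb1 : ∀ t ∈ Icc 0 T, (b : ℝ → ℝ) =ᶠ[𝓝 t] fun _ => 1 := fun t ht =>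
    b.eventuallyEq_one_of_mem_ball (by
      rw [Metric.mem_ball, Real.dist_eq, abs_lt]
      constructor <;> linarith [ht.1, ht.2])
  have hbe : ∀ t ∈ Icc 0 T, (fun s => η s * b s) =ᶠ[𝓝 t] η := fun t ht => by
    filter_upwards [hb1 t ht] with s hs
    rw [hs, mul_one]
  have key := entropy_averaged_of_hasCompactSupport hT hlam hc hf hu hub hubt hue ha₀ haT ha₀m
    haTm h0 h1 hv hω (hη.mul b.contDiff) b.hasCompactSupport.mul_left
    fun t ht => mul_nonneg (hη0 t ht) b.nonneg
  have e0 : η 0 * b 0 = η 0 := (hbe 0 ⟨le_rfl, hT.le⟩).eq_of_nhds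
  have eT : η T * b T = η T := (hbe T ⟨hT.le, le_rfl⟩).eq_of_nhds
  simp only [e0, eT] at key
  refine key.trans (le_of_eq ?_)
  congr 2
  refine setIntegral_congr_fun measurableSet_Ioo fun t ht => ?_
  have ht' := Ioo_subset_Icc_self ht
  have h2 := (hbe t ht').deriv_eq
  have h3 := (hbe t ht').eq_of_nhds
  rw [h2, h3]

end Averaged

/-! ### From continuous to discrete time -/

section Window

lemma contDiff_smoothTransition : ContDiff ℝ (⊤ : ℕ∞) Real.smoothTransition :=
  Real.smoothTransition.contDiff

lemma hasDerivAt_smoothTransition (x : ℝ) :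
    HasDerivAt Real.smoothTransition (deriv Real.smoothTransition x) x :=
  (contDiff_smoothTransition.differentiable (by simp) x).hasDerivAt

lemma deriv_smoothTransition_of_nonpos {x : ℝ} (hx : x ≤ 0) :
    deriv Real.smoothTransition x = 0 := by
  rcases hx.lt_or_eq with hx | rfl
  · have : Real.smoothTransition =ᶠ[𝓝 x] fun _ => 0 := by
      filter_upwards [Iio_mem_nhds hx] with y hy
      exact Real.smoothTransition.zero_of_nonpos (le_of_lt hy)
    rw [this.deriv_eq, deriv_const]
  · refine IsLocalMin.deriv_eq_zero (Eventually.of_forall fun y => ?_)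
    rw [Real.smoothTransition.zero]
    exact Real.smoothTransition.nonneg y

lemma deriv_smoothTransition_of_one_le {x : ℝ} (hx : 1 ≤ x) :
    deriv Real.smoothTransition x = 0 := by
  refine IsLocalMax.deriv_eq_zero (Eventually.of_forall fun y => ?_)
  rw [Real.smoothTransition.one_of_one_le hx]
  exact Real.smoothTransition.le_one y

lemma continuous_deriv_smoothTransition : Continuous (deriv Real.smoothTransition) :=
  (contDiff_infty_iff_deriv.1 contDiff_smoothTransition).2.continuous

lemma exists_lipschitzWith_deriv_smoothTransition :
    ∃ M : NNReal, LipschitzWith M (deriv Real.smoothTransition) :=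
  ContDiff.lipschitzWith_of_hasCompactSupport
    (HasCompactSupport.intro (isCompact_Icc (a := (0 : ℝ)) (b := 1)) fun x hx => by
      rw [mem_Icc, not_and_or, not_le, not_le] at hx
      rcases hx with hx | hx
      · exact deriv_smoothTransition_of_nonpos hx.le
      · exact deriv_smoothTransition_of_one_le hx.le)
    (contDiff_infty_iff_deriv.1 contDiff_smoothTransition).2 (by simp)

/-- The second order Taylor bound for the smooth step, together with the localization of the
remainder. -/
lemma abs_smoothTransition_taylor_le {M : NNReal}
    (hM : LipschitzWith M (deriv Real.smoothTransition)) {δ : ℝ} (hδ : 0 ≤ δ) (a : ℝ) :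
    |Real.smoothTransition (a + δ) - Real.smoothTransition a - δ * deriv Real.smoothTransition a|
      ≤ (Icc (-δ) 1).indicator (fun _ => M * δ ^ 2) a := by
  by_cases ha : a ∈ Icc (-δ) 1
  · rw [indicator_of_mem ha]
    have h := Convex.norm_image_sub_le_of_norm_hasDerivWithin_le
      (f := fun x => Real.smoothTransition x - x * deriv Real.smoothTransition a)
      (f' := fun x => deriv Real.smoothTransition x - 1 * deriv Real.smoothTransition a)
      (s := Icc a (a + δ)) (x := a) (y := a + δ) (C := M * δ)
      (fun x _ => ((hasDerivAt_smoothTransition x).sub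
        ((hasDerivAt_id x).mul_const _)).hasDerivWithinAt)
      (fun x hx => by
        have := hM.dist_le_mul x a
        rw [Real.dist_eq, Real.dist_eq] at this
        rw [one_mul, Real.norm_eq_abs]
        refine this.trans (mul_le_mul_of_nonneg_left ?_ M.coe_nonneg)
        rw [abs_of_nonneg (by linarith [hx.1])]
        linarith [hx.2])
      (convex_Icc _ _) ⟨le_rfl, by linarith⟩ ⟨by linarith, le_rfl⟩
    simp only [Real.norm_eq_abs, add_sub_cancel_left, abs_of_nonneg hδ] at h
    calc _ = |Real.smoothTransition (a + δ) - (a + δ) * deriv Real.smoothTransition a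
          - (Real.smoothTransition a - a * deriv Real.smoothTransition a)| := by congr 1; ring
      _ ≤ _ := h.trans (le_of_eq (by ring))
  · rw [indicator_of_notMem ha]
    rw [mem_Icc, not_and_or, not_le, not_le] at ha
    rcases ha with ha | ha
    · rw [deriv_smoothTransition_of_nonpos (by linarith),
        Real.smoothTransition.zero_of_nonpos (by linarith : a + δ ≤ 0),
        Real.smoothTransition.zero_of_nonpos (by linarith : a ≤ 0)]
      simp
    · rw [deriv_smoothTransition_of_one_le ha.le,
        Real.smoothTransition.one_of_one_le (by linarith : 1 ≤ a + δ),
        Real.smoothTransition.one_of_one_le ha.le]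
      simp

lemma hasDerivAt_smoothTransition_window (ε r t : ℝ) :
    HasDerivAt (fun t => Real.smoothTransition ((r - t) / ε))
      (-(deriv Real.smoothTransition ((r - t) / ε) / ε)) t := by
  have h1 : HasDerivAt (fun t : ℝ => (r - t) / ε) (-1 / ε) t :=
    (((hasDerivAt_id t).const_sub r)).div_const ε
  have := (hasDerivAt_smoothTransition ((r - t) / ε)).comp t h1
  refine this.congr_deriv ?_
  ring

lemma contDiff_smoothTransition_window (ε r : ℝ) :
    ContDiff ℝ (⊤ : ℕ∞) fun t => Real.smoothTransition ((r - t) / ε) :=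
  contDiff_smoothTransition.comp ((contDiff_const.sub contDiff_id).div_const ε)

/-- Transfer of a comparison in continuous time, valid against all smooth weights, to a comparison
in discrete time. The functions `E n`, `A n` are the distance of the moving object at time `t` to
the `n`-th discrete object and its dissipation; `E₀ n`, `E₁ n` are the distances at the initial and
the final time. No continuity in `t` is used: the distances are compared after averaging over the
backward window `[nΔt - ε, nΔt]`. -/
lemma final_le_of_averaged_of_step {M : NNReal}
    (hM : LipschitzWith M (deriv Real.smoothTransition)) {T Δt ε BE BA R : ℝ} {N : ℕ}
    (hΔt : 0 < Δt) (hN : N * Δt = T) (hε : 0 < ε) (hεT : ε ≤ T) (hR : 0 ≤ R) {E A : ℕ → ℝ → ℝ}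
    {E₀ E₁ : ℕ → ℝ} (hEm : ∀ n ≤ N, Measurable (E n)) (hAm : ∀ n ≤ N, Measurable (A n))
    (hE : ∀ n ≤ N, ∀ t, |E n t| ≤ BE) (hA : ∀ n ≤ N, ∀ t, |A n t| ≤ BA)
    (hav : ∀ n ≤ N, ∀ η : ℝ → ℝ, ContDiff ℝ (⊤ : ℕ∞) η → (∀ t ∈ Icc 0 T, 0 ≤ η t) →
      0 ≤ (∫ t in Ioo 0 T, (deriv η t * E n t + η t * A n t)) + η 0 * E₀ n - η T * E₁ n)
    (hstep : ∀ n < N, ∀ t, E (n + 1) t - E n t ≤ -(Δt * A (n + 1) t) + Δt * R) :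
    ∃ m ≤ N, m * Δt ≤ ε + Δt ∧
      E₁ N ≤ E₀ m + BA * (2 * ε + Δt) + T * (BA * M * (ε + Δt) * Δt / ε ^ 2 + R) := by
  set S := Real.smoothTransition with hS
  set s := deriv Real.smoothTransition with hs
  have hT : 0 < T := hε.trans_le hεT
  have hBA : 0 ≤ BA := (abs_nonneg _).trans (hA N le_rfl 0)
  set μ : Measure ℝ := volume.restrict (Ioo 0 T) with hμ
  have hs0 : ∀ x, 0 ≤ s x := fun x => Real.smoothTransition.monotone.deriv_nonneg
  have hsM : ∀ x, |s x| ≤ M := fun x => by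
    rcases le_or_gt x 0 with hx | hx
    · rw [hs, deriv_smoothTransition_of_nonpos hx, abs_zero]; exact M.coe_nonneg
    rcases le_or_gt 1 x with hx1 | hx1
    · rw [hs, deriv_smoothTransition_of_one_le hx1, abs_zero]; exact M.coe_nonneg
    · have := hM.dist_le_mul x 0
      have hs00 : s 0 = 0 := deriv_smoothTransition_of_nonpos le_rfl
      rw [Real.dist_eq, Real.dist_eq, hs00, sub_zero, sub_zero, abs_of_pos hx] at this
      exact this.trans (mul_le_of_le_one_right M.coe_nonneg hx1.le)
  have hsc : Continuous s := continuous_deriv_smoothTransition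
  have hSc : Continuous S := Real.smoothTransition.continuous
  -- the normalised window ending at time `r`
  set θ : ℝ → ℝ → ℝ := fun r t => s ((r - t) / ε) / ε with hθ
  have hθ0 : ∀ r t, 0 ≤ θ r t := fun r t => div_nonneg (hs0 _) hε.le
  have hθc : ∀ r, Continuous (θ r) := fun r => by simp only [hθ]; fun_prop
  have hθb : ∀ r t, |θ r t| ≤ M / ε := fun r t => by
    rw [hθ, abs_div, abs_of_pos hε]
    exact div_le_div_of_nonneg_right (hsM _) hε.le
  have hWd : ∀ r t, HasDerivAt (fun t => S ((r - t) / ε)) (-θ r t) t :=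
    fun r t => hasDerivAt_smoothTransition_window ε r t
  have hWc : ∀ r, Continuous fun t => S ((r - t) / ε) := fun r => by fun_prop
  have hS0 : ∀ x, 0 ≤ S x := Real.smoothTransition.nonneg
  have hS1 : ∀ x, S x ≤ 1 := Real.smoothTransition.le_one
  have hint : ∀ {p q : ℝ → ℝ} {B B' : ℝ}, Continuous p → Measurable q → (∀ t, |p t| ≤ B) →
      (∀ t, |q t| ≤ B') → Integrable (fun t => p t * q t) μ := by
    intro p q B B' hp hq hpB hqB
    refine Integrable.of_bound (hp.measurable.mul hq).aestronglyMeasurable (B * B')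
      (ae_of_all _ fun t => ?_)
    rw [Real.norm_eq_abs, abs_mul]
    exact mul_le_mul (hpB t) (hqB t) (abs_nonneg _) ((abs_nonneg _).trans (hpB t))
  have hS_abs : ∀ r t, |S ((r - t) / ε)| ≤ 1 := fun r t => by
    rw [abs_of_nonneg (hS0 _)]; exact hS1 _
  have iθE : ∀ r, ∀ n ≤ N, Integrable (fun t => θ r t * E n t) μ :=
    fun r n hn => hint (hθc r) (hEm n hn) (hθb r) (hE n hn)
  have iθA : ∀ r, ∀ n ≤ N, Integrable (fun t => θ r t * A n t) μ :=
    fun r n hn => hint (hθc r) (hAm n hn) (hθb r) (hA n hn)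
  have iSA : ∀ r, ∀ n ≤ N, Integrable (fun t => S ((r - t) / ε) * A n t) μ :=
    fun r n hn => hint (hWc r) (hAm n hn) (hS_abs r) (hA n hn)
  have iA : ∀ n ≤ N, Integrable (A n) μ := fun n hn => by
    have := hint (p := fun _ => 1) continuous_const (hAm n hn) (fun _ => abs_one.le) (hA n hn)
    simpa using this
  have iθ : ∀ r, Integrable (θ r) μ := fun r => by
    have := hint (hθc r) (measurable_const (a := (1 : ℝ))) (hθb r) (fun _ => abs_one.le)
    simpa using this
  have hθ1 : ∀ r, ∫ t, θ r t ∂μ ≤ 1 := fun r => by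
    rw [hμ, ← integral_Ioc_eq_integral_Ioo, ← intervalIntegral.integral_of_le hT.le,
      intervalIntegral.integral_eq_sub_of_hasDerivAt (f := fun t => -S ((r - t) / ε))
        (fun t _ => (hWd r t).neg.congr_deriv (neg_neg _)) ((hθc r).intervalIntegrable _ _)]
    linarith [hS0 ((r - T) / ε), hS1 ((r - 0) / ε)]
  set H : ℕ → ℝ := fun n => ∫ t, θ (n * Δt) t * E n t ∂μ with hH
  set Q : ℝ := BA * M * (ε + Δt) * Δt / ε ^ 2 + R with hQ
  -- one step of the averaged distance
  have hone : ∀ n : ℕ, ε ≤ n * Δt → n < N → H (n + 1) ≤ H n + Δt * Q := by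
    intro n hn hnN
    set r : ℝ := n * Δt with hr
    have hr' : ((n + 1 : ℕ) : ℝ) * Δt = r + Δt := by push_cast; ring
    have hrT : r + Δt ≤ T := by
      rw [← hN, ← hr']
      exact mul_le_mul_of_nonneg_right (by exact_mod_cast hnN) hΔt.le
    have hn1 : n + 1 ≤ N := hnN
    -- `χ` vanishes at both end points, because the whole window lies in the time interval, and its
    -- derivative is the difference of the windows ending at `r` and at `r + Δt`.
    set χ : ℝ → ℝ := fun t => S ((r + Δt - t) / ε) - S ((r - t) / ε) with hχ
    have hχd : ∀ t, deriv χ t = θ r t - θ (r + Δt) t := fun t => by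
      refine ((hWd (r + Δt) t).sub (hWd r t)).deriv.trans ?_
      ring
    have hχ0 : χ 0 = 0 := by
      simp only [hχ, sub_zero]
      rw [hS, Real.smoothTransition.one_of_one_le, Real.smoothTransition.one_of_one_le, sub_self]
      · rwa [one_le_div hε]
      · rw [one_le_div hε]; linarith
    have hχT : χ T = 0 := by
      simp only [hχ]
      rw [hS, Real.smoothTransition.zero_of_nonpos, Real.smoothTransition.zero_of_nonpos, sub_self]
      · exact div_nonpos_of_nonpos_of_nonneg (by linarith) hε.le
      · exact div_nonpos_of_nonpos_of_nonneg (by linarith) hε.le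
    have h1 := hav (n + 1) hn1 χ
      ((contDiff_smoothTransition_window ε (r + Δt)).sub (contDiff_smoothTransition_window ε r))
      fun t _ => sub_nonneg.2 (Real.smoothTransition.monotone
        (div_le_div_of_nonneg_right (by linarith) hε.le))
    rw [hχ0, hχT, zero_mul, zero_mul, add_zero, sub_zero] at h1
    have iχA : Integrable (fun t => χ t * A (n + 1) t) μ := by
      simp only [hχ, sub_mul]
      exact (iSA _ _ hn1).sub (iSA _ _ hn1)
    have e1 : ∫ t in Ioo 0 T, (deriv χ t * E (n + 1) t + χ t * A (n + 1) t)
        = (∫ t, θ r t * E (n + 1) t ∂μ) - H (n + 1) + ∫ t, χ t * A (n + 1) t ∂μ := by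
      simp only [hH, hr', hχd, sub_mul]
      have i2 : Integrable (fun t => θ r t * E (n + 1) t - θ (r + Δt) t * E (n + 1) t) μ :=
        (iθE r _ hn1).sub (iθE _ _ hn1)
      rw [← integral_sub (iθE r _ hn1) (iθE _ _ hn1), ← integral_add i2 iχA]
    rw [e1] at h1
    have h2 : (∫ t, θ r t * E (n + 1) t ∂μ) - H n
        ≤ -(Δt * ∫ t, θ r t * A (n + 1) t ∂μ) + Δt * R := by
      have i2 : Integrable (fun t => -(Δt * (θ r t * A (n + 1) t))) μ :=
        ((iθA r _ hn1).const_mul Δt).neg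
      have i3 : Integrable (fun t => -(Δt * (θ r t * A (n + 1) t)) + Δt * R * θ r t) μ :=
        i2.add ((iθ r).const_mul _)
      have h3 : ∫ t, (θ r t * E (n + 1) t - θ r t * E n t) ∂μ
          ≤ ∫ t, (-(Δt * (θ r t * A (n + 1) t)) + Δt * R * θ r t) ∂μ := by
        refine integral_mono ((iθE r _ hn1).sub (iθE r _ hnN.le)) i3 fun t => ?_
        have := mul_le_mul_of_nonneg_left (hstep n hnN t) (hθ0 r t)
        simp only
        linarith
      rw [integral_sub (iθE r _ hn1) (iθE r _ hnN.le),
        integral_add i2 ((iθ r).const_mul _), integral_neg,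
        integral_const_mul, integral_const_mul] at h3
      have h4 : Δt * R * ∫ t, θ r t ∂μ ≤ Δt * R :=
        mul_le_of_le_one_right (by positivity) (hθ1 r)
      linarith
    -- `χ` is the integral of the windows ending in `[r, r + Δt]`, hence close to `Δt * θ r`.
    have h5 : (∫ t, χ t * A (n + 1) t ∂μ) - Δt * ∫ t, θ r t * A (n + 1) t ∂μ
        ≤ Δt * (BA * M * (ε + Δt) * Δt / ε ^ 2) := by
      rw [← integral_const_mul, ← integral_sub iχA ((iθA r _ hn1).const_mul Δt)]
      set b : ℝ := M * (Δt / ε) ^ 2 * BA with hb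
      have hb0 : 0 ≤ b := by positivity
      have hi : Integrable ((Icc (r - ε) (r + Δt)).indicator fun _ => b) volume :=
        (integrable_indicator_iff measurableSet_Icc).2 (integrableOn_const (by simp))
      have hle : ∀ t, χ t * A (n + 1) t - Δt * (θ r t * A (n + 1) t)
          ≤ (Icc (r - ε) (r + Δt)).indicator (fun _ => b) t := by
        intro t
        have h6 := abs_smoothTransition_taylor_le hM (div_nonneg hΔt.le hε.le) ((r - t) / ε)
        have h7 : (Icc (-(Δt / ε)) 1).indicator (fun _ => M * (Δt / ε) ^ 2) ((r - t) / ε) * BA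
            = (Icc (r - ε) (r + Δt)).indicator (fun _ => b) t := by
          have hiff : (r - t) / ε ∈ Icc (-(Δt / ε)) 1 ↔ t ∈ Icc (r - ε) (r + Δt) := by
            rw [mem_Icc, mem_Icc, ← neg_div, div_le_div_iff_of_pos_right hε, div_le_one hε]
            constructor <;> rintro ⟨h8, h9⟩ <;> constructor <;> linarith
          by_cases ht : t ∈ Icc (r - ε) (r + Δt)
          · rw [indicator_of_mem ht, indicator_of_mem (hiff.2 ht)]
          · rw [indicator_of_notMem ht, indicator_of_notMem (fun h => ht (hiff.1 h)), zero_mul]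
        rw [← h7]
        calc _ = (χ t - Δt * θ r t) * A (n + 1) t := by ring
          _ ≤ |χ t - Δt * θ r t| * |A (n + 1) t| := by rw [← abs_mul]; exact le_abs_self _
          _ ≤ _ := by
            refine mul_le_mul ?_ (hA _ hn1 t) (abs_nonneg _) ((abs_nonneg _).trans h6)
            refine le_trans (le_of_eq ?_) h6
            simp only [hχ, hθ]
            rw [show (r + Δt - t) / ε = (r - t) / ε + Δt / ε by ring]
            congr 1; ring
      calc _ ≤ ∫ t, (Icc (r - ε) (r + Δt)).indicator (fun _ => b) t ∂μ :=
            integral_mono (iχA.sub ((iθA r _ hn1).const_mul Δt)) hi.restrict hle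
        _ ≤ ∫ t, (Icc (r - ε) (r + Δt)).indicator (fun _ => b) t :=
            setIntegral_le_integral hi (ae_of_all _ fun t => indicator_nonneg (fun _ _ => hb0) t)
        _ = (Δt + ε) * b := by
            rw [integral_indicator measurableSet_Icc, setIntegral_const, Real.volume_real_Icc_of_le
              (by linarith), smul_eq_mul]
            ring
        _ = _ := by rw [hb]; field_simp; ring
    rw [hQ, mul_add]
    linarith
  -- the first grid time at which the whole window lies in the time interval
  have hmε : ε ≤ (⌈ε / Δt⌉₊ : ℝ) * Δt := by
    rw [← div_le_iff₀ hΔt]; exact Nat.le_ceil _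
  have hmN : ⌈ε / Δt⌉₊ ≤ N := by
    rw [Nat.ceil_le, div_le_iff₀ hΔt, hN]; exact hεT
  have hmt : (⌈ε / Δt⌉₊ : ℝ) * Δt ≤ ε + Δt := by
    have := (Nat.ceil_lt_add_one (div_nonneg hε.le hΔt.le)).le
    calc _ ≤ (ε / Δt + 1) * Δt := mul_le_mul_of_nonneg_right this hΔt.le
      _ = _ := by field_simp
  set m := ⌈ε / Δt⌉₊ with hm
  have hsum : ∀ k, m + k ≤ N → H (m + k) ≤ H m + k * Δt * Q := by
    intro k
    induction k with
    | zero => intro _; simp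
    | succ k ih =>
      intro hk
      have h1 := ih (by omega)
      have h2 := hone (m + k) (hmε.trans (mul_le_mul_of_nonneg_right (by
        exact_mod_cast Nat.le_add_right m k) hΔt.le)) (by omega)
      have h3 : H (m + (k + 1)) ≤ H (m + k) + Δt * Q := h2
      push_cast
      linarith
  have hQ0 : 0 ≤ Q := by positivity
  have hHN : H N ≤ H m + T * Q := by
    have := hsum (N - m) (by omega)
    rw [Nat.add_sub_cancel' hmN] at this
    refine this.trans (add_le_add_right (mul_le_mul_of_nonneg_right ?_ hQ0) _)
    rw [← hN]
    exact mul_le_mul_of_nonneg_right (by exact_mod_cast Nat.sub_le N m) hΔt.le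
  -- Production on a short time interval.
  have hlocal : ∀ n ≤ N, ∀ p : ℝ → ℝ, ∀ l r : ℝ, l ≤ r → (∀ t, 0 ≤ p t) → (∀ t, p t ≤ 1) →
      (∀ t ∈ Ioo 0 T, t ∉ Icc l r → p t = 0) → Integrable (fun t => p t * A n t) μ →
      ∫ t, p t * A n t ∂μ ≤ BA * (r - l) := by
    intro n hn p l r hlr hp0 hp1 hp hi
    have hi' : Integrable ((Icc l r).indicator fun _ => BA) volume :=
      (integrable_indicator_iff measurableSet_Icc).2 (integrableOn_const (by simp))
    calc _ ≤ ∫ t, (Icc l r).indicator (fun _ => BA) t ∂μ := by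
          refine setIntegral_mono_on hi hi'.integrableOn measurableSet_Ioo fun t ht => ?_
          by_cases htl : t ∈ Icc l r
          · rw [indicator_of_mem htl]
            calc _ ≤ p t * BA :=
                  mul_le_mul_of_nonneg_left ((le_abs_self _).trans (hA n hn t)) (hp0 t)
              _ ≤ BA := mul_le_of_le_one_left hBA (hp1 t)
          · rw [indicator_of_notMem htl, hp t ht htl, zero_mul]
      _ ≤ ∫ t, (Icc l r).indicator (fun _ => BA) t :=
          setIntegral_le_integral hi' (ae_of_all _ fun t => indicator_nonneg (fun _ _ => hBA) t)
      _ = _ := by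
          rw [integral_indicator measurableSet_Icc, setIntegral_const,
            Real.volume_real_Icc_of_le hlr, smul_eq_mul]
          ring
  -- the weight decreases from `1` to `0` over the window ending at `r`
  have hinit : H m ≤ E₀ m + BA * (ε + Δt) := by
    set r : ℝ := m * Δt with hr
    have hrT : r ≤ T := by
      rw [← hN]
      exact mul_le_mul_of_nonneg_right (by exact_mod_cast hmN) hΔt.le
    have h1 := hav m hmN _ (contDiff_smoothTransition_window ε r) fun t _ => hS0 _
    have hd : ∀ t, deriv (fun t => S ((r - t) / ε)) t = -θ r t := fun t => (hWd r t).deriv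
    simp only [hS] at hd
    simp only [hd] at h1
    have e0 : Real.smoothTransition ((r - 0) / ε) = 1 :=
      Real.smoothTransition.one_of_one_le (by rwa [sub_zero, one_le_div hε])
    have eT : Real.smoothTransition ((r - T) / ε) = 0 :=
      Real.smoothTransition.zero_of_nonpos
        (div_nonpos_of_nonpos_of_nonneg (by linarith) hε.le)
    rw [e0, eT, one_mul, zero_mul, sub_zero] at h1
    have e1 : ∫ t in Ioo 0 T, (-θ r t * E m t + S ((r - t) / ε) * A m t)
        = -H m + ∫ t, S ((r - t) / ε) * A m t ∂μ := by
      have i2 : Integrable (fun t => -(θ r t * E m t)) μ := (iθE r m hmN).neg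
      simp only [hH, neg_mul]
      rw [← integral_neg, ← integral_add i2 (iSA r m hmN)]
    rw [e1] at h1
    have h2 := hlocal m hmN _ 0 r (hε.le.trans hmε) (fun t => hS0 _) (fun t => hS1 _)
      (fun t ht htn => Real.smoothTransition.zero_of_nonpos
        (div_nonpos_of_nonpos_of_nonneg (sub_nonpos.2 (not_lt.1 fun hlt =>
          htn ⟨ht.1.le, hlt.le⟩)) hε.le)) (iSA r m hmN)
    have h3 : BA * (r - 0) ≤ BA * (ε + Δt) :=
      mul_le_mul_of_nonneg_left (by rw [sub_zero]; exact hmt) hBA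
    linarith
  -- the weight increases from `0` to `1` over the last window
  have hfin : E₁ N ≤ H N + BA * ε := by
    have h1 := hav N le_rfl (fun t => 1 - S ((T - t) / ε))
      (contDiff_const.sub (contDiff_smoothTransition_window ε T)) fun t _ => sub_nonneg.2 (hS1 _)
    have hd : ∀ t, deriv (fun t => 1 - S ((T - t) / ε)) t = θ T t := fun t => by
      rw [((hWd T t).const_sub 1).deriv, neg_neg]
    simp only [hd] at h1
    have e0 : S ((T - 0) / ε) = 1 :=
      Real.smoothTransition.one_of_one_le (by rwa [sub_zero, one_le_div hε])
    have eT : S ((T - T) / ε) = 0 :=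
      Real.smoothTransition.zero_of_nonpos (by rw [sub_self, zero_div])
    rw [e0, eT, sub_self, sub_zero, zero_mul, add_zero, one_mul] at h1
    have iη : Integrable (fun t => (1 - S ((T - t) / ε)) * A N t) μ := by
      simp only [sub_mul, one_mul]
      exact (iA N le_rfl).sub (iSA T N le_rfl)
    have e1 : ∫ t in Ioo 0 T, (θ T t * E N t + (1 - S ((T - t) / ε)) * A N t)
        = H N + ∫ t, (1 - S ((T - t) / ε)) * A N t ∂μ := by
      simp only [hH, hN]
      rw [← integral_add (iθE T N le_rfl) iη]
    rw [e1] at h1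
    have h2 := hlocal N le_rfl _ (T - ε) T (by linarith) (fun t => sub_nonneg.2 (hS1 _))
      (fun t => by linarith [hS0 ((T - t) / ε)])
      (fun t ht htn => by
        rw [sub_eq_zero, eq_comm]
        refine Real.smoothTransition.one_of_one_le ?_
        rw [one_le_div hε]
        by_contra hlt
        exact htn ⟨by linarith, ht.2.le⟩) iη
    linarith
  refine ⟨m, hmN, hmt, ?_⟩
  linarith

end Window

/-! ### The error estimate -/

section Slices

variable {c lam h K : ℝ} {f ω v : ℝ → ℝ} {ub : ℝ × ℝ → ℝ}

/-- Joint measurability of `G` makes the doubled integrals measurable in time. -/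
lemma measurable_integral_integral_slice {κ : ℝ → ℝ} (hκ : Measurable κ) {G : ℝ × ℝ → ℝ → ℝ → ℝ}
    (hG : Measurable fun q : (ℝ × ℝ) × ℝ => G (q.2, q.1.1) q.1.1 (q.2 - q.1.2)) :
    Measurable fun t => ∫ z, κ z * ∫ x, G (x, t) t (x - z) := by
  have h1 : Measurable fun p : ℝ × ℝ => ∫ x, G (x, p.1) p.1 (x - p.2) :=
    (hG.stronglyMeasurable.integral_prod_right (ν := volume)
      (f := fun (p : ℝ × ℝ) (x : ℝ) => G (x, p.1) p.1 (x - p.2))).measurable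
  have h2 : Measurable fun p : ℝ × ℝ => κ p.2 * ∫ x, G (x, p.1) p.1 (x - p.2) :=
    (hκ.comp measurable_snd).mul h1
  exact (h2.stronglyMeasurable.integral_prod_right (ν := volume)
    (f := fun t z : ℝ => κ z * ∫ x, G (x, t) t (x - z))).measurable

lemma measurable_smoothDist_slice (hω : IsMollifier ω h K) (hub : Measurable ub)
    (hv : Measurable v) : Measurable fun t => smoothDist ω (fun x => ub (x, t)) v := by
  have ha : Measurable fun x : ℝ => |x| := continuous_abs.measurable
  exact measurable_integral_integral_slice hω.continuous.measurable
    (G := fun p _ y => |ub p - v y|) (by fun_prop)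

lemma measurable_smoothProd_slice (hω : IsMollifier ω h K) (hf : Continuous f)
    (hub : Measurable ub) (hv : Measurable v) :
    Measurable fun t => smoothProd ω c lam f (fun x => ub (x, t)) v := by
  have hs := measurable_sign
  have hg := measurable_fracLap_slice (c := c) (lam := lam) hub
  refine (measurable_integral_integral_slice hω.continuous_deriv.measurable
    (G := fun p _ y => kruzkovFlux f (ub p) (v y)) ?_).add
    (measurable_integral_integral_slice hω.continuous.measurable
    (G := fun p t y => Real.sign (ub p - v y) * fracLap c lam (fun x => ub (x, t)) p.1) ?_)
  · exact (measurable_kruzkovFlux hf).comp (by fun_prop : Measurable fun q : (ℝ × ℝ) × ℝ =>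
      (ub (q.2, q.1.1), v (q.2 - q.1.2)))
  · have h1 : Measurable fun q : (ℝ × ℝ) × ℝ =>
        fracLap c lam (fun x => ub (x, q.1.1)) q.2 :=
      hg.comp (by fun_prop : Measurable fun q : (ℝ × ℝ) × ℝ => (q.2, q.1.1))
    have h2 : Measurable fun q : (ℝ × ℝ) × ℝ =>
      Real.sign (ub (q.2, q.1.1) - v (q.2 - q.1.2)) := by fun_prop
    exact h2.mul h1

end Slices

section Rate

variable {c lam T : ℝ} {f u₀ a₀ : ℝ → ℝ} {F : ℝ → ℝ → ℝ} {F₁ F₂ : NNReal} {u : ℝ → ℝ → ℝ}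
  {Δx Δt C M L ρ h K Cu Mu : ℝ} {N n : ℕ} {U : ℕ → ℤ → ℝ} {ω : ℝ → ℝ}

lemma integral_abs_sub_triangle {a b e : ℝ → ℝ} (ha : Integrable a) (hb : Integrable b)
    (he : Integrable e) :
    ∫ x, |a x - e x| ≤ (∫ x, |a x - b x|) + ∫ x, |b x - e x| := by
  have h1 : Integrable fun x => |a x - b x| := (ha.sub hb).abs
  have h2 : Integrable fun x => |b x - e x| := (hb.sub he).abs
  rw [← integral_add h1 h2]
  exact integral_mono (ha.sub he).abs (h1.add h2) fun x => abs_sub_le _ _ _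

lemma integral_abs_sub_le_add {a b : ℝ → ℝ} (ha : Integrable a) (hb : Integrable b) :
    ∫ x, |a x - b x| ≤ (∫ x, |a x|) + ∫ x, |b x| := by
  rw [← integral_add ha.abs hb.abs]
  exact integral_mono (ha.sub hb).abs (ha.abs.add hb.abs) fun x => abs_sub _ _

lemma HasSchemeBounds.integral_abs_sub_zero_le (hU : HasSchemeBounds c lam F Δx Δt N U C M L ρ)
    (hΔ : 0 < Δx) (hn : n ≤ N) :
    ∫ x, |stepFun Δx (U 0) x - stepFun Δx (U n) x| ≤ n * Δt * L := by
  induction n with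
  | zero => simp
  | succ n ih =>
    have h1 := hU.integral_abs_sub_le hΔ hn
    have h2 := integral_abs_sub_triangle (hU.l1BVWith hΔ (Nat.zero_le N)).int
      (hU.l1BVWith hΔ (Nat.le_of_succ_le hn)).int (hU.l1BVWith hΔ hn).int
    have h3 := ih (Nat.le_of_succ_le hn)
    simp only [abs_sub_comm (stepFun Δx (U (n + 1)) _)] at h1
    push_cast
    linarith

/-- The Kuznetsov estimate with the spatial and the temporal smoothing scale both equal to `h`. -/
lemma integral_abs_sub_le_of_hasSchemeBounds {Ms : NNReal}
    (hMs : LipschitzWith Ms (deriv Real.smoothTransition)) (hlam : lam ∈ Ioo (0 : ℝ) 1)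
    (hc : 0 < c) (hF : IsNumericalFlux f F F₁ F₂) (hu : IsBVEntropySolution c lam T f u₀ u)
    {ub : ℝ × ℝ → ℝ} (hub : Measurable ub) (hubt : ∀ t, L1BVWith Cu Mu fun x => ub (x, t))
    (hue : ∀ᵐ p ∂(volume.restrict (strip T)), u p.1 p.2 = ub p ∧
        fracLap c lam (fun x => u x p.2) p.1 = fracLap c lam (fun x => ub (x, p.2)) p.1)
    {aT : ℝ → ℝ} (haT : Integrable aT) (haTm : Measurable aT)
    (h0 : u₀ =ᵐ[volume] a₀) (h1 : (fun x => u x T) =ᵐ[volume] aT) (ha₀ : L1BVWith C M a₀)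
    (hω : IsMollifier ω h K) (hh : 0 < h) (hhT : h ≤ T) (hΔh : Δx ≤ h) (hΔ : 0 < Δx)
    (hΔt : 0 < Δt) (hN : N * Δt = T) (hcfl : ((F₁ : ℝ) + F₂) * (Δt / Δx) ≤ 1) (hL : 0 ≤ L)
    (hρ : 0 ≤ ρ) (hU0 : U 0 = cellAverage Δx a₀)
    (hU : HasSchemeBounds c lam F Δx Δt N U C M L ρ) {BA : ℝ}
    (hBA : BA = 4 * K * (F₁ + F₂) * C + (Cu + 2 * Mu) * dConst c lam) :
    ∫ x, |aT x - stepFun Δx (U N) x| ≤ 2 * C * Δx + (h + Δt) * L + 2 * (C * h)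
      + BA * (2 * h + Δt) + T * (BA * Ms * (h + Δt) * Δt / h ^ 2
        + stepError c lam F₁ F₂ K C M L ρ h Δx Δt) := by
  have hT : 0 < T := hh.trans_le hhT
  have hf : LipschitzWith (F₁ + F₂) f := hF.lipschitzWith
  have hV : ∀ n ≤ N, L1BVWith C M (stepFun Δx (U n)) := fun n hn => hU.l1BVWith hΔ hn
  have hK := hω.K_nonneg hh
  have hR : 0 ≤ stepError c lam F₁ F₂ K C M L ρ h Δx Δt := by
    have := dConst_nonneg (lam := lam) hc
    have := ha₀.C_nonneg
    have := ha₀.M_nonneg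
    unfold stepError
    positivity
  obtain ⟨m, hm, hmt, hle⟩ := final_le_of_averaged_of_step hMs hΔt hN hh hhT hR
    (E := fun n t => smoothDist ω (fun x => ub (x, t)) (stepFun Δx (U n)))
    (A := fun n t => smoothProd ω c lam f (fun x => ub (x, t)) (stepFun Δx (U n)))
    (E₀ := fun n => smoothDist ω a₀ (stepFun Δx (U n)))
    (E₁ := fun n => smoothDist ω aT (stepFun Δx (U n)))
    (BE := Mu + M + C * h) (BA := BA)
    (fun n hn => measurable_smoothDist_slice hω hub (hV n hn).meas)
    (fun n hn => measurable_smoothProd_slice hω hf.continuous hub (hV n hn).meas)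
    (fun n hn t => by
      have h2 := abs_le.1 (abs_smoothDist_sub_le hω (hubt t).int (hV n hn))
      have h3 := integral_abs_sub_le_add (hubt t).int (hV n hn).int
      have h4 : 0 ≤ ∫ x, |ub (x, t) - stepFun Δx (U n) x| := integral_nonneg fun _ => abs_nonneg _
      have h5 := (hubt t).norm_le
      have h6 := (hV n hn).norm_le
      have h7 := (hubt t).M_nonneg
      have h8 := (hV n hn).M_nonneg
      rw [abs_le]
      constructor <;> linarith [h2.1, h2.2])
    (fun n hn t => by
      have := abs_smoothProd_le hω hh hlam hc hf (hubt t) (hV n hn)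
      rw [hBA]
      push_cast at this
      exact this)
    (fun n hn η hη hη0 => entropy_averaged hT hlam hc hf hu hub hubt hue ha₀.int haT ha₀.meas haTm
      h0 h1 (hV n hn) hω hη hη0)
    (fun n hn t => smoothDist_step_le hω hh hΔh hlam hc hΔ hΔt hF (by linarith) (hubt t) hU hn)
  have h2 := abs_le.1 (abs_smoothDist_sub_le hω haT (hV N le_rfl))
  have h3 := abs_le.1 (abs_smoothDist_sub_le hω ha₀.int (hV m hm))
  have h4 := integral_abs_sub_triangle ha₀.int (hV 0 (Nat.zero_le N)).int (hV m hm).int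
  have h5 := hU.integral_abs_sub_zero_le hΔ hm
  have h6 := integral_abs_sub_cellAverage_le hΔ ha₀
  rw [← hU0] at h6
  have h7 := mul_le_mul_of_nonneg_right hmt hL
  linarith [h2.1, h3.2]

/-- With `Δx = h²` and `Δt = O(h²)` the consistency error is of order `h`, up to the residual. -/
lemma stepError_le (F₁ F₂ : NNReal) {q : ℝ} (hK : 0 ≤ K) (hL : 0 ≤ L)
    (hh : 0 < h)
    (hΔt : Δt ≤ q * h ^ 2) :
    stepError c lam F₁ F₂ K C M L ρ h (h ^ 2) Δt
      ≤ (4 * K * (3 * F₂ * C + 2 * (F₁ + F₂) * (q * L)) + 16 * K * (F₁ + F₂) * C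
          + 8 * K * ((C + 2 * M) * dConst c lam)) * h + ρ := by
  have h1 : 4 * K * (2 * (F₁ + F₂) * (Δt * L)) ≤ 4 * K * (2 * (F₁ + F₂) * (q * h ^ 2 * L)) := by
    gcongr
  unfold stepError
  refine add_le_add_left ?_ ρ
  rw [div_le_iff₀ hh]
  linarith

/-- The error estimate in terms of the consistency error `ρ` of the discretization of the nonlocal
term. -/
lemma exists_rate (hlam : lam ∈ Ioo (0 : ℝ) 1) (hc : 0 < c) (hT : 0 < T)
    (hF : IsNumericalFlux f F F₁ F₂) (hF₁₂ : 0 < F₁ + F₂)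
    (hu : IsBVEntropySolution c lam T f u₀ u) (h0 : u₀ =ᵐ[volume] a₀) (ha₀ : L1BVWith C M a₀)
    (hL : 0 ≤ L) :
    ∃ B : ℝ, 0 < B ∧ ∀ (Δx Δt ρ : ℝ) (N : ℕ) (U : ℕ → ℤ → ℝ), 0 < Δx → 0 < Δt → N * Δt = T →
      ((F₁ : ℝ) + F₂) * (Δt / Δx) ≤ 1 → 0 ≤ ρ → U 0 = cellAverage Δx a₀ →
      HasSchemeBounds c lam F Δx Δt N U C M L ρ →
      ∫ x, |u x T - stepFun Δx (U N) x| ≤ B * √Δx + T * ρ := by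
  obtain ⟨Ms, hMs⟩ := exists_lipschitzWith_deriv_smoothTransition
  obtain ⟨K, hK, hmoll⟩ := exists_isMollifier
  obtain ⟨Cu, Mu, ub, hub, hubt, hue⟩ := hu.exists_representative
  have iT : Integrable fun x => u x T := hu.memL1 T ⟨hT.le, le_rfl⟩
  set aT : ℝ → ℝ := iT.1.mk _ with haT'
  have haTm : Measurable aT := iT.1.measurable_mk
  have h1 : (fun x => u x T) =ᵐ[volume] aT := iT.1.ae_eq_mk
  have haT : Integrable aT := iT.congr h1
  set Λ : ℝ := (F₁ : ℝ) + F₂ with hΛ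
  have hΛ0 : 0 < Λ := by rw [hΛ]; exact_mod_cast hF₁₂
  have hd := dConst_nonneg (lam := lam) hc
  have hC := ha₀.C_nonneg
  have hM := ha₀.M_nonneg
  have hCu := (hubt 0).C_nonneg
  have hMu := (hubt 0).M_nonneg
  set BA : ℝ := 4 * K * (F₁ + F₂) * C + (Cu + 2 * Mu) * dConst c lam with hBA
  have hBA0 : 0 ≤ BA := by positivity
  -- `MT` serves the coarse meshes only.
  set MT : ℝ := ∫ x, |aT x| with hMT
  have hMT0 : 0 ≤ MT := integral_nonneg fun _ => abs_nonneg _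
  clear_value aT
  have hmin : 0 < min 1 T := lt_min one_pos hT
  set q : ℝ := 1 / Λ with hq
  have hq0 : 0 < q := by positivity
  set B₁ : ℝ := 2 * C + (1 + q) * L + 2 * C + BA * (2 + q) + T * (BA * Ms * (1 + q) * q
    + (4 * K * (3 * F₂ * C + 2 * (F₁ + F₂) * (q * L)) + 16 * K * (F₁ + F₂) * C
      + 8 * K * ((C + 2 * M) * dConst c lam))) with hB₁
  have hB₁0 : 0 ≤ B₁ := by positivity
  clear_value B₁ BA MT q
  refine ⟨B₁ + (MT + M) / min 1 T + 1, by positivity, ?_⟩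
  intro Δx Δt ρ N U hΔ hΔt hN hcfl hρ hU0 hU
  have hV := hU.l1BVWith hΔ le_rfl
  have e : ∫ x, |u x T - stepFun Δx (U N) x| = ∫ x, |aT x - stepFun Δx (U N) x| := by
    refine integral_congr_ae ?_
    filter_upwards [h1] with x hx
    rw [← hx]
  rw [e]
  set h : ℝ := √Δx with hh'
  have hh : 0 < h := Real.sqrt_pos.2 hΔ
  have hTρ : 0 ≤ T * ρ := by positivity
  have hh2 : Δx = h ^ 2 := (Real.sq_sqrt hΔ.le).symm
  rcases le_or_gt h (min 1 T) with hsmall | hlarge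
  · have hh1 : h ≤ 1 := hsmall.trans (min_le_left _ _)
    have hΔh : Δx ≤ h := by rw [hh2]; nlinarith
    obtain ⟨ω, hω⟩ := hmoll h hh
    have key := integral_abs_sub_le_of_hasSchemeBounds hMs hlam hc hF hu hub hubt hue haT haTm h0
      h1 ha₀ hω hh (hsmall.trans (min_le_right _ _)) hΔh hΔ hΔt hN hcfl hL hρ hU0 hU hBA
    have hΔt2 : Δt ≤ q * h ^ 2 := by
      have hq1 : q * Λ = 1 := by rw [hq]; field_simp
      have hcfl2 : Λ * Δt ≤ Δx := by
        rw [← mul_div_assoc, div_le_one hΔ] at hcfl; exact hcfl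
      rw [← hh2]
      calc Δt = q * (Λ * Δt) := by rw [← mul_assoc, hq1, one_mul]
        _ ≤ q * Δx := mul_le_mul_of_nonneg_left hcfl2 hq0.le
    have hΔt1 : Δt ≤ q * h := hΔt2.trans (mul_le_mul_of_nonneg_left (hh2 ▸ hΔh) hq0.le)
    have k1 : 2 * C * Δx ≤ 2 * C * h := by gcongr
    have k2 : (h + Δt) * L ≤ (h + q * h) * L := by gcongr
    have k3 : BA * (2 * h + Δt) ≤ BA * (2 * h + q * h) := by gcongr
    have k4 : BA * Ms * (h + Δt) * Δt / h ^ 2 ≤ BA * Ms * (h + q * h) * (q * h ^ 2) / h ^ 2 := by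
      gcongr
    have k4' : BA * Ms * (h + q * h) * (q * h ^ 2) / h ^ 2 = BA * Ms * (1 + q) * q * h := by
      rw [div_eq_iff (by positivity)]; ring
    have k5 := stepError_le (c := c) (lam := lam) F₁ F₂ hK hL hh hΔt2 (ρ := ρ)
      (C := C) (M := M)
    rw [← hh2] at k5
    rw [k4'] at k4
    have k6 := mul_le_mul_of_nonneg_left (add_le_add k4 k5) hT.le
    have k7 : 0 ≤ ((MT + M) / min 1 T + 1) * h := by positivity
    calc _ ≤ B₁ * h + T * ρ := by
          refine key.trans ?_
          rw [hB₁]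
          linarith only [k1, k2, k3, k6]
      _ ≤ _ := by linarith
  · have k1 := integral_abs_sub_le_add haT hV.int
    rw [← hMT] at k1
    have k2 := hV.norm_le
    have k3 : MT + M ≤ (MT + M) / min 1 T * h := by
      rw [div_mul_eq_mul_div, le_div_iff₀ hmin]
      exact mul_le_mul_of_nonneg_left hlarge.le (by positivity)
    have k4 : 0 ≤ (B₁ + 1) * h := by positivity
    linarith

/-- Functions in `L¹ ∩ BV` have a Borel representative which is Lipschitz under translations. -/
lemma MemL1BV.exists_l1BVWith {w : ℝ → ℝ} (hw : MemL1BV w) :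
    ∃ (C M : ℝ) (a : ℝ → ℝ), w =ᵐ[volume] a ∧ L1BVWith C M a := by
  obtain ⟨hi, hv⟩ := hw
  have e := hi.1.ae_eq_mk
  have hi' : Integrable (hi.1.mk w) := hi.congr e
  have hess : essVariation (hi.1.mk w) = essVariation w := by
    unfold essVariation
    refine iInf_congr fun v => iInf_congr_Prop ⟨fun h => h.trans e.symm, fun h => h.trans e⟩ ?_
    intro _; rfl
  refine ⟨(essVariation w).toNNReal + 1, ∫ x, |hi.1.mk w x|, hi.1.mk w, e,
    hi.1.measurable_mk, hi', le_rfl, transLip_of_essVariation_le hi' ?_⟩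
  rw [hess, ENNReal.coe_toNNReal hv.ne]

lemma cellAverage_congr_ae {w v : ℝ → ℝ} (h : w =ᵐ[volume] v) (i : ℤ) :
    cellAverage Δx w i = cellAverage Δx v i := by
  unfold cellAverage
  rw [integral_congr_ae (ae_restrict_of_ae h)]

/-- The scheme sees the initial datum only through its almost everywhere class. -/
lemma IsImplicitExplicitSolution.of_ae (hU : IsImplicitExplicitSolution c lam F u₀ Δx Δt N U)
    (h : u₀ =ᵐ[volume] a₀) : IsImplicitExplicitSolution c lam F a₀ Δx Δt N U where
  bounded := hU.bounded
  init := fun i => (hU.init i).trans (cellAverage_congr_ae h i)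
  step := hU.step

lemma IsExplicitSolution.of_ae (hU : IsExplicitSolution c lam F u₀ Δx Δt N U)
    (h : u₀ =ᵐ[volume] a₀) : IsExplicitSolution c lam F a₀ Δx Δt N U where
  init := fun i => (hU.init i).trans (cellAverage_congr_ae h i)
  step := hU.step

lemma eLpNorm_sub_interpolant_le {w : ℝ → ℝ} {B : ℝ} (hΔt : 0 < Δt) (hN : N * Δt = T)
    (hw : Integrable w) (hU : Integrable (stepFun Δx (U N)))
    (hB : ∫ x, |w x - stepFun Δx (U N) x| ≤ B) :
    eLpNorm (fun x => w x - interpolant Δx Δt U x T) 1 volume ≤ ENNReal.ofReal B := by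
  have hfl : ⌊T / Δt⌋₊ = N := by
    rw [← hN, mul_div_assoc, div_self hΔt.ne', mul_one, Nat.floor_natCast]
  have hi : Integrable fun x => w x - stepFun Δx (U N) x := hw.sub hU
  simp only [interpolant, hfl]
  rw [eLpNorm_one_eq_lintegral_enorm, ← ofReal_integral_norm_eq_lintegral_enorm hi]
  exact ENNReal.ofReal_le_ofReal hB

end Rate

end FractalCL

theorem theorem026
    (c lam T : ℝ) (hc : 0 < c) (hlam : lam ∈ Set.Ioo (0 : ℝ) 1) (hT : 0 < T)
    (f : ℝ → ℝ) (hf : ∃ K : NNReal, LipschitzWith K f)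
    (F : ℝ → ℝ → ℝ) (F₁ F₂ : NNReal) (hF : FractalCL.IsNumericalFlux f F F₁ F₂)
    (hF₁₂ : 0 < F₁ + F₂)
    (u₀ : ℝ → ℝ) (hu₀ : FractalCL.MemL1BV u₀)
    (u : ℝ → ℝ → ℝ) (hu : FractalCL.IsBVEntropySolution c lam T f u₀ u) :
    (∃ cT : ℝ, 0 < cT ∧
      ∀ (Δx Δt : ℝ) (N : ℕ), 0 < Δx → 0 < Δt → (N : ℝ) * Δt = T →
        ((F₁ : ℝ) + (F₂ : ℝ)) * (Δt / Δx) ≤ 1 →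
        ∀ U : ℕ → ℤ → ℝ, FractalCL.IsImplicitExplicitSolution c lam F u₀ Δx Δt N U →
          MeasureTheory.eLpNorm (fun x => u x T - FractalCL.interpolant Δx Δt U x T) 1
              MeasureTheory.volume
            ≤ ENNReal.ofReal (cT * Real.sqrt Δx)) ∧
    (∃ cT : ℝ, 0 < cT ∧
      ∀ (Δx Δt : ℝ) (N : ℕ), 0 < Δx → 0 < Δt → (N : ℝ) * Δt = T →
        ((F₁ : ℝ) + (F₂ : ℝ)) * (Δt / Δx) + FractalCL.dConst c lam * (Δt / Δx ^ lam) ≤ 1 →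
        ∀ U : ℕ → ℤ → ℝ, FractalCL.IsExplicitSolution c lam F u₀ Δx Δt N U →
          MeasureTheory.eLpNorm (fun x => u x T - FractalCL.interpolant Δx Δt U x T) 1
              MeasureTheory.volume
            ≤ ENNReal.ofReal (cT * (Real.sqrt Δx + Δx ^ (1 - lam)))) := by
  obtain ⟨C, M, a₀, h0, ha₀⟩ := hu₀.exists_l1BVWith
  have hd := FractalCL.dConst_nonneg (lam := lam) hc
  have hC := ha₀.C_nonneg
  have hM := ha₀.M_nonneg
  set L : ℝ := (F₁ + F₂) * C + (C + 2 * M) * FractalCL.dConst c lam with hL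
  have hL0 : 0 ≤ L := by positivity
  obtain ⟨B, hB, hrate⟩ := FractalCL.exists_rate hlam hc hT hF hF₁₂ hu h0 ha₀ hL0
  have iT := hu.memL1 T ⟨hT.le, le_rfl⟩
  have hΛ : (0 : ℝ) < F₁ + F₂ := by exact_mod_cast hF₁₂
  constructor
  · refine ⟨B, hB, fun Δx Δt N hΔ hΔt hN hcfl U hU => ?_⟩
    have hU' := hU.of_ae h0
    have hb := hU'.hasSchemeBounds hc hlam hF ha₀ hΔ hΔt hcfl
    have h1 := hrate Δx Δt 0 N U hΔ hΔt hN hcfl le_rfl (funext hU'.init) hb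
    rw [mul_zero, add_zero] at h1
    exact FractalCL.eLpNorm_sub_interpolant_le hΔt hN iT (hb.l1BVWith hΔ le_rfl).int h1
  · set B' : ℝ := 2 * T * FractalCL.dConst c lam * L / (F₁ + F₂) with hB'
    have hB'0 : 0 ≤ B' := by positivity
    refine ⟨B + B', by positivity, fun Δx Δt N hΔ hΔt hN hcfl U hU => ?_⟩
    have hU' := hU.of_ae h0
    have hb := hU'.hasSchemeBounds hc hlam hF ha₀ hΔ hΔt hcfl
    have hcfl' : ((F₁ : ℝ) + F₂) * (Δt / Δx) ≤ 1 := by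
      have : 0 ≤ FractalCL.dConst c lam * (Δt / Δx ^ lam) := by positivity
      linarith
    have h1 := hrate Δx Δt _ N U hΔ hΔt hN hcfl' (by positivity) (funext hU'.init) hb
    refine FractalCL.eLpNorm_sub_interpolant_le hΔt hN iT (hb.l1BVWith hΔ le_rfl).int
      (h1.trans ?_)
    have hpos : 0 < Δx ^ lam := Real.rpow_pos_of_pos hΔ lam
    have hΔt' : Δt ≤ Δx / (F₁ + F₂) := by
      rw [← mul_div_assoc, div_le_one hΔ] at hcfl'
      rw [le_div_iff₀ hΛ]
      linarith
    have e : Δx ^ (1 - lam) = Δx / Δx ^ lam := by rw [Real.rpow_sub hΔ, Real.rpow_one]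
    have h2 : T * (2 * (FractalCL.dConst c lam / Δx ^ lam) * (Δt * L))
        ≤ B' * Δx ^ (1 - lam) := by
      calc _ ≤ T * (2 * (FractalCL.dConst c lam / Δx ^ lam) * (Δx / (F₁ + F₂) * L)) := by gcongr
        _ = _ := by rw [e, hB']; ring
    have h3 : 0 ≤ B * Δx ^ (1 - lam) := by positivity
    have h4 : 0 ≤ B' * √Δx := by positivity
    linarith
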